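/- All manifolds (Hausdorff, second countable, finite-dimensional, without boundary), vector bundles and maps are smooth and real. Let $(A\to M,\rho_A,[\cdot,\cdot]_A)$ and $(B\to N,\rho_B,[\cdot,\cdot]_B)$ be Lie algebroids. **Pull-back morphisms.** A map $\varphi:M\to N$ is admissible for $B$ if the rank of $\{(b,u)\in B_{\varphi(m)}\oplus T_mM\mid \rho_B b=(T\varphi)u\}$ does not depend on $m\in M$. Then these spaces are the fibers of a vector bundle $B\oplus_{TN}TM\subset\varphi^!B\oplus TM$ ($\varphi^!B$ denoting here the pull-back vector bundle), which is a Lie algebroid over $M$, the pull-back Lie algebroid of $B$ by $\varphi$: its anchor is $(b,u)\mapsto u$ and its bracket is $$\Big[\big(\textstyle\sum_i f_i\otimes b_i,u\big),\big(\sum_j g_j\otimes c_j,v\big)\Big]=\Big(\textstyle\sum_{i,j}f_ig_j\otimes[b_i,c_j]_B+\sum_j(u\cdot g_j)\otimes c_j-\sum_i(v\cdot f_i)\otimes b_i,\ [u,v]\Big),$$ for $f_i,g_j\in C^\infty(M)$, $b_i,c_j\in\Gamma B$, $u,v\in\Gamma(TM)$. A Lie algebroid morphism $(\Phi,\varphi)$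 from $A$ to $B$ (a vector bundle map for which pull-back of forms $\Gamma(\wedge^\bullet B^*)\to\Gamma(\wedge^\bullet A^*)$ commutes with the Lie algebroid differentials) is a *pull-back morphism* if $\varphi$ is admissible and $\Phi$ is the composition of a Lie algebroid isomorphism, over the identity of $M$, from $A$ to the pull-back Lie algebroid of $B$, and of the projection $(b,u)\mapsto b$. **Representations and modular classes.** A representation of $A$ on a vector bundle $L\to M$ (an $A$-module structure) is a flat $A$-connection on $L$. The canonical representation $D^A$ of $A$ on the line bundle $L^A=\wedge^{\rm top}A\otimes\wedge^{\rm top}(T^*M)$ is given by $D^A_a(\omega\otimes\mu)=[a,\omega]_A\otimes\mu+\omega\otimes\mathcal L_{\rho_A a}\mu$. If $(\Phi,\varphi)$ is a Lie algebroid morphism from $A$ to $B$ and $D$ is a representation of $B$ on $K\to N$, the pull-back representation $\Phi^!D$ of $A$ on $\varphi^!K$ is the one such that $(a\cdot(y\circ\varphi))(m)=(b\cdot y)(\varphi(m))$ for $y\in\Gamma K$, $a\in\Gamma A$, $b\in\Gamma B$ and $m\in M$ with $\Phi(a(m))=b(\varphi(m))$. The characteristic class in $H^1(A)$ of a representation $D$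 of $A$ on a line bundle $L$ is the class of the cocycle $\alpha\in\Gamma(A^*)$ defined by $\langle\alpha,a\rangle\lambda=a\cdot\lambda$, if $L$ has a nowhere-vanishing section $\lambda$, and one-half of the characteristic class of $D\otimes D$ on $L\otimes L$ otherwise. The modular class $\operatorname{Mod}A\in H^1(A)$ is the characteristic class of $D^A$, and the modular class of a morphism $(\Phi,\varphi)$ from $A$ to $B$ is $\operatorname{Mod}\Phi=\operatorname{Mod}A-\Phi^*(\operatorname{Mod}B)\in H^1(A)$. **The canonical isomorphism.** Let $(\Phi,\varphi)$ be a pull-back morphism from $A$ to $B$, and assume that $\varphi$ is a submersion. Then $$0\to A\xrightarrow{\ (\Phi,\rho_A)\ }\varphi^!B\oplus TM\xrightarrow{\ (b,u)\mapsto (T\varphi)u-\rho_B b\ }\varphi^!TN\to0$$ is exact. The associated isomorphism $\wedge^{\rm top}A\otimes\wedge^{\rm top}(\varphi^!TN)\cong\wedge^{\rm top}(\varphi^!B\oplus TM)=\wedge^{\rm top}(\varphi^!B)\otimes\wedge^{\rm top}(TM)$, which wedges an element of $\wedge^{\rm top}A$ with any lift of an element of $\wedge^{\rm top}(\varphi^!TN)$,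 induces a canonical isomorphism of line bundles $\ell^\varphi:L^A\to\varphi^!L^B$. **Proposition 3.8.** Let $(\Phi,\varphi)$ be a pull-back morphism from a Lie algebroid $A\to M$ to a Lie algebroid $B\to N$, such that $\varphi:M\to N$ is a submersion. (i) The canonical isomorphism $\ell^\varphi:L^A\to\varphi^!L^B$ is an isomorphism of $A$-modules, from $L^A$ with the representation $D^A$ to $\varphi^!L^B$ with the representation $\Phi^!D^B$. (ii) The modular class $\operatorname{Mod}\Phi$ vanishes. -/

import Mathlib

open Bundle Filter Topology Module
open scoped Manifold ContDiff TensorProduct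

noncomputable section

namespace ModularClass

/-! ### Smooth vector bundles presented by their sections

Manifolds `M`, `N` are modelled on finite-dimensional real normed spaces `E`, `E'`; the vector
bundles `A → M`, `B → N` have typical fibres `F`, `F'`.  Smooth sections of `A` are
`Cₛ^∞⟮𝓘(ℝ, E); F, A⟯`. -/

section SectionSpaces

/-- A bundle `L` of vector spaces over `M`, together with the `C^∞(M)`-module of its smooth
sections.  It is used for the bundles obtained by algebraic constructions (the canonical line
bundle of a Lie algebroid, pull-backs, tensor products). -/
structure SectionSpace (E : Type*) [NormedAddCommGroup E] [NormedSpace ℝ E]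
    {M : Type*} [TopologicalSpace M] [ChartedSpace E M]
    (L : M → Type*) [∀ x, AddCommGroup (L x)] [∀ x, Module ℝ (L x)] where
  /-- the space of smooth sections -/
  carrier : Submodule ℝ (∀ x, L x)
  fun_smul_mem : ∀ (f : C^∞⟮𝓘(ℝ, E), M; ℝ⟯) (s : ∀ x, L x), s ∈ carrier →
    (fun x ↦ f x • s x) ∈ carrier

variable {E : Type*} [NormedAddCommGroup E] [NormedSpace ℝ E]
  {M : Type*} [TopologicalSpace M] [ChartedSpace E M]
  {L : M → Type*} [∀ x, AddCommGroup (L x)] [∀ x, Module ℝ (L x)]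
  {L' : M → Type*} [∀ x, AddCommGroup (L' x)] [∀ x, Module ℝ (L' x)]
  {E' : Type*} [NormedAddCommGroup E'] [NormedSpace ℝ E']
  {N : Type*} [TopologicalSpace N] [ChartedSpace E' N]
  {K : N → Type*} [∀ x, AddCommGroup (K x)] [∀ x, Module ℝ (K x)]

/-- The product of a smooth section by a smooth function. -/
def SectionSpace.funSMul (S : SectionSpace E L) (f : C^∞⟮𝓘(ℝ, E), M; ℝ⟯) (s : S.carrier) :
    S.carrier :=
  ⟨fun x ↦ f x • s.1 x, S.fun_smul_mem f s.1 s.2⟩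

variable (E) in
/-- Finite combinations, with coefficients in `C^∞(M)`, of the sections belonging to `G`. -/
def combinations (G : Set (∀ x : M, L x)) : Submodule ℝ (∀ x, L x) :=
  Submodule.span ℝ {s | ∃ f : C^∞⟮𝓘(ℝ, E), M; ℝ⟯, ∃ g ∈ G, s = fun x ↦ f x • g x}

theorem combinations_fun_smul (G : Set (∀ x : M, L x)) (f : C^∞⟮𝓘(ℝ, E), M; ℝ⟯)
    {t : ∀ x, L x} (ht : t ∈ combinations E G) :
    (fun x ↦ f x • t x) ∈ combinations E G := by
  induction ht using Submodule.span_induction with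
  | mem t ht =>
    obtain ⟨g, u, hu, rfl⟩ := ht
    refine Submodule.subset_span ⟨f * g, u, hu, ?_⟩
    funext x
    simp [mul_smul]
  | zero =>
    have h : (fun x ↦ f x • (0 : ∀ x, L x) x) = 0 := by funext x; simp
    rw [h]
    exact Submodule.zero_mem _
  | add s t _ _ hs ht =>
    have h : (fun x ↦ f x • (s + t) x) = (fun x ↦ f x • s x) + fun x ↦ f x • t x := by
      funext x; simp
    rw [h]
    exact Submodule.add_mem _ hs ht
  | smul c t _ ht =>
    have h : (fun x ↦ f x • (c • t) x) = c • fun x ↦ f x • t x := by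
      funext x; exact smul_comm _ _ _
    rw [h]
    exact Submodule.smul_mem _ c ht

variable (E) in
/-- The bundle whose smooth sections are, locally, the finite `C^∞(M)`-combinations of the
sections belonging to `G`. -/
def SectionSpace.generate (G : Set (∀ x : M, L x)) : SectionSpace E L where
  carrier :=
    { carrier := {s | ∀ x, ∃ t ∈ combinations E G, ∀ᶠ y in 𝓝 x, s y = t y}
      add_mem' := by
        intro s s' hs hs' x
        obtain ⟨t, ht, h⟩ := hs x
        obtain ⟨t', ht', h'⟩ := hs' x
        refine ⟨t + t', Submodule.add_mem _ ht ht', ?_⟩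
        filter_upwards [h, h'] with y hy hy'
        simp [hy, hy']
      zero_mem' := fun x ↦ ⟨0, Submodule.zero_mem _, Eventually.of_forall fun _ ↦ rfl⟩
      smul_mem' := by
        intro c s hs x
        obtain ⟨t, ht, h⟩ := hs x
        refine ⟨c • t, Submodule.smul_mem _ c ht, ?_⟩
        filter_upwards [h] with y hy
        simp [hy] }
  fun_smul_mem := by
    intro f s hs x
    obtain ⟨t, ht, h⟩ := hs x
    refine ⟨_, combinations_fun_smul G f ht, ?_⟩
    filter_upwards [h] with y hy
    simp [hy]

theorem SectionSpace.generate_mem {G : Set (∀ x : M, L x)} {g : ∀ x, L x} (hg : g ∈ G) :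
    g ∈ (SectionSpace.generate E G).carrier := fun x ↦
  ⟨g, Submodule.subset_span ⟨1, g, hg, by funext x; simp⟩, Eventually.of_forall fun _ ↦ rfl⟩

/-- The pull-back bundle `φ^!K`, with fibre `K (φ m)` at `m`: its smooth sections are locally the
`C^∞(M)`-combinations of the pulled-back sections `y ∘ φ`, with `y` a smooth section of `K`. -/
def SectionSpace.pullback (S : SectionSpace E' K) (E : Type*) [NormedAddCommGroup E]
    [NormedSpace ℝ E] {M : Type*} [TopologicalSpace M] [ChartedSpace E M] (φ : M → N) :
    SectionSpace E (fun m ↦ K (φ m)) :=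
  SectionSpace.generate E {s | ∃ y ∈ S.carrier, s = fun m ↦ y (φ m)}

/-- The pulled-back section `φ^!y = y ∘ φ`. -/
def SectionSpace.pullbackSec (S : SectionSpace E' K) (φ : M → N) (y : S.carrier) :
    (S.pullback E φ).carrier :=
  ⟨fun m ↦ y.1 (φ m), SectionSpace.generate_mem ⟨y.1, y.2, rfl⟩⟩

/-- The tensor product of two bundles. -/
def SectionSpace.tensor (S : SectionSpace E L) (S' : SectionSpace E L') :
    SectionSpace E (fun x ↦ L x ⊗[ℝ] L' x) :=
  SectionSpace.generate E {s | ∃ y ∈ S.carrier, ∃ z ∈ S'.carrier, s = fun x ↦ y x ⊗ₜ[ℝ] z x}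

/-- The section `y ⊗ z` of a tensor product. -/
def SectionSpace.tmul (S : SectionSpace E L) (S' : SectionSpace E L')
    (y : S.carrier) (z : S'.carrier) : (S.tensor S').carrier :=
  ⟨fun x ↦ y.1 x ⊗ₜ[ℝ] z.1 x, SectionSpace.generate_mem ⟨y.1, y.2, z.1, z.2, rfl⟩⟩

end SectionSpaces

/-! ### Lie algebroids -/

section LieAlgebroids

variable {E : Type*} [NormedAddCommGroup E] [NormedSpace ℝ E]
  {M : Type*} [TopologicalSpace M] [ChartedSpace E M]

/-- The derivative `v · f` of a function `f` on `M` along a tangent vector `v` at `x`. -/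
def dirDeriv (f : M → ℝ) (x : M) (v : TangentSpace 𝓘(ℝ, E) x) : ℝ :=
  mfderiv 𝓘(ℝ, E) 𝓘(ℝ, ℝ) f x v

variable {F : Type*} [NormedAddCommGroup F] [NormedSpace ℝ F]
  {A : M → Type*} [TopologicalSpace (TotalSpace F A)] [∀ x, TopologicalSpace (A x)]
  [∀ x, AddCommGroup (A x)] [∀ x, Module ℝ (A x)] [FiberBundle F A] [VectorBundle ℝ F A]

/-- The product `f a` of a smooth section `a` by a smooth function `f`. -/
def funSMul (f : C^∞⟮𝓘(ℝ, E), M; ℝ⟯) (a : Cₛ^∞⟮𝓘(ℝ, E); F, A⟯) : Cₛ^∞⟮𝓘(ℝ, E); F, A⟯ :=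
  ⟨fun x ↦ f x • a x, f.contMDiff.smul_section a.contMDiff⟩

end LieAlgebroids

/-- A Lie algebroid structure on the vector bundle `A → M`: an anchor `ρ : A → TM`, which is a
smooth bundle map, and a Lie bracket on smooth sections, such that
`[a, f b] = f [a, b] + (ρ(a) f) b`.  The compatibility `ρ [a, b] = [ρ a, ρ b]` of the anchor with
the brackets (which is a consequence of the other axioms) is recorded as well. -/
structure LieAlgebroid (E : Type*) [NormedAddCommGroup E] [NormedSpace ℝ E]
    {M : Type*} [TopologicalSpace M] [ChartedSpace E M] [IsManifold 𝓘(ℝ, E) ∞ M]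
    (F : Type*) [NormedAddCommGroup F] [NormedSpace ℝ F]
    (A : M → Type*) [TopologicalSpace (TotalSpace F A)] [∀ x, TopologicalSpace (A x)]
    [∀ x, AddCommGroup (A x)] [∀ x, Module ℝ (A x)] [FiberBundle F A] [VectorBundle ℝ F A] where
  /-- the anchor -/
  anchor : ∀ x, A x →ₗ[ℝ] TangentSpace 𝓘(ℝ, E) x
  contMDiff_anchor : ContMDiff (𝓘(ℝ, E).prod 𝓘(ℝ, F)) (𝓘(ℝ, E).prod 𝓘(ℝ, E)) ∞
    (fun p : TotalSpace F A ↦ (⟨p.1, anchor p.1 p.2⟩ : TangentBundle 𝓘(ℝ, E) M))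
  /-- the bracket of smooth sections -/
  bracket : Cₛ^∞⟮𝓘(ℝ, E); F, A⟯ →ₗ[ℝ] Cₛ^∞⟮𝓘(ℝ, E); F, A⟯ →ₗ[ℝ] Cₛ^∞⟮𝓘(ℝ, E); F, A⟯
  bracket_self : ∀ a, bracket a a = 0
  jacobi : ∀ a b c,
    bracket a (bracket b c) = bracket (bracket a b) c + bracket b (bracket a c)
  leibniz : ∀ a (f : C^∞⟮𝓘(ℝ, E), M; ℝ⟯) b x,
    bracket a (funSMul f b) x = f x • bracket a b x + dirDeriv f x (anchor x (a x)) • b x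
  anchor_bracket : ∀ a b x, anchor x (bracket a b x) =
    VectorField.mlieBracket 𝓘(ℝ, E) (fun y ↦ anchor y (a y)) (fun y ↦ anchor y (b y)) x

/-! ### Forms, the Lie algebroid differential, and cohomology in degree one -/

section Forms

variable (E : Type*) [NormedAddCommGroup E] [NormedSpace ℝ E]
  {M : Type*} [TopologicalSpace M] [ChartedSpace E M]
  (F : Type*) [NormedAddCommGroup F] [NormedSpace ℝ F]
  (A : M → Type*) [TopologicalSpace (TotalSpace F A)] [∀ x, TopologicalSpace (A x)]
  [∀ x, AddCommGroup (A x)] [∀ x, Module ℝ (A x)] [FiberBundle F A] [VectorBundle ℝ F A]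

/-- Smooth sections of `∧ᵏ A^*`: families of alternating `k`-linear forms on the fibres, whose
values on smooth sections of `A` are smooth functions. -/
def formSubmodule (k : ℕ) : Submodule ℝ (∀ x, A x [⋀^Fin k]→ₗ[ℝ] ℝ) where
  carrier := {θ | ∀ a : Fin k → Cₛ^∞⟮𝓘(ℝ, E); F, A⟯,
    ContMDiff 𝓘(ℝ, E) 𝓘(ℝ, ℝ) ∞ (fun x ↦ θ x (fun i ↦ a i x))}
  add_mem' := fun hθ hη a ↦ (hθ a).add (hη a)
  zero_mem' := fun _ ↦ contMDiff_const
  smul_mem' := fun _ _ hθ a ↦ contMDiff_const.mul (hθ a)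

/-- The type of smooth sections of `∧ᵏ A^*`. -/
def Form (k : ℕ) : Type _ := formSubmodule E F A k

instance (k : ℕ) : AddCommGroup (Form E F A k) :=
  inferInstanceAs (AddCommGroup (formSubmodule E F A k))

instance (k : ℕ) : Module ℝ (Form E F A k) :=
  inferInstanceAs (Module ℝ (formSubmodule E F A k))

variable {E F A}

theorem dirDeriv_add {f g : M → ℝ} (hf : ContMDiff 𝓘(ℝ, E) 𝓘(ℝ, ℝ) ∞ f)
    (hg : ContMDiff 𝓘(ℝ, E) 𝓘(ℝ, ℝ) ∞ g) (x : M) (v : TangentSpace 𝓘(ℝ, E) x) :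
    dirDeriv (fun y ↦ f y + g y) x v = dirDeriv f x v + dirDeriv g x v := by
  have h := mfderiv_add (hf.mdifferentiableAt (by simp) : MDifferentiableAt 𝓘(ℝ, E) 𝓘(ℝ, ℝ) f x)
    (hg.mdifferentiableAt (by simp) : MDifferentiableAt 𝓘(ℝ, E) 𝓘(ℝ, ℝ) g x)
  exact congrArg (fun T ↦ T v) h

theorem dirDeriv_const_mul {f : M → ℝ} (c : ℝ) (hf : ContMDiff 𝓘(ℝ, E) 𝓘(ℝ, ℝ) ∞ f)
    (x : M) (v : TangentSpace 𝓘(ℝ, E) x) :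
    dirDeriv (fun y ↦ c * f y) x v = c * dirDeriv f x v := by
  have h := const_smul_mfderiv
    (hf.mdifferentiableAt (by simp) : MDifferentiableAt 𝓘(ℝ, E) 𝓘(ℝ, ℝ) f x) c
  exact congrArg (fun T ↦ T v) h

variable [IsManifold 𝓘(ℝ, E) ∞ M]

/-- `IsDifferential 𝒜 θ η` means `η = d_A θ`, that is,
`η(a₀, …, a_k) = ∑ i, (-1)^i ρ(a_i) · θ(a₀, …, â_i, …, a_k)
  + ∑ i < j, (-1)^(i+j) θ([a_i, a_j], a₀, …, â_i, …, â_j, …, a_k)`.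
In the second sum the entry `[a_i, a_j]` is written at the place of `a_j`, instead of the first
place, so that the sign becomes `(-1)^(i+1)`. -/
def IsDifferential (𝒜 : LieAlgebroid E F A) {k : ℕ} (θ : Form E F A k) (η : Form E F A (k + 1)) :
    Prop :=
  ∀ (a : Fin (k + 1) → Cₛ^∞⟮𝓘(ℝ, E); F, A⟯) (x : M),
    η.1 x (fun i ↦ a i x) =
      ∑ i : Fin (k + 1), (-1 : ℝ) ^ (i : ℕ) *
        dirDeriv (fun y ↦ θ.1 y (fun l ↦ a (i.succAbove l) y)) x (𝒜.anchor x (a i x)) +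
      ∑ i : Fin (k + 1), ∑ j ∈ Finset.Ioi i, (-1 : ℝ) ^ ((i : ℕ) + 1) *
        θ.1 x (fun l ↦ Function.update a j (𝒜.bracket (a i) (a j)) (i.succAbove l) x)

theorem IsDifferential.add {𝒜 : LieAlgebroid E F A} {k : ℕ} {θ θ' : Form E F A k}
    {η η' : Form E F A (k + 1)} (h : IsDifferential 𝒜 θ η) (h' : IsDifferential 𝒜 θ' η') :
    IsDifferential 𝒜 (θ + θ') (η + η') := by
  intro a x
  have e : ∀ i : Fin (k + 1), dirDeriv (fun y ↦ (θ + θ').1 y (fun l ↦ a (i.succAbove l) y)) x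
      (𝒜.anchor x (a i x)) = _ :=
    fun i ↦ dirDeriv_add (θ.2 fun l ↦ a (i.succAbove l)) (θ'.2 fun l ↦ a (i.succAbove l)) x _
  simp only [e]
  change η.1 x _ + η'.1 x _ = _
  rw [h a x, h' a x]
  have e' : ∀ v, (θ + θ').1 x v = θ.1 x v + θ'.1 x v := fun _ ↦ rfl
  simp only [e', mul_add, Finset.sum_add_distrib]
  ring

theorem IsDifferential.smul {𝒜 : LieAlgebroid E F A} {k : ℕ} {θ : Form E F A k}
    {η : Form E F A (k + 1)} (c : ℝ) (h : IsDifferential 𝒜 θ η) :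
    IsDifferential 𝒜 (c • θ) (c • η) := by
  intro a x
  have e : ∀ i : Fin (k + 1), dirDeriv (fun y ↦ (c • θ).1 y (fun l ↦ a (i.succAbove l) y)) x
      (𝒜.anchor x (a i x)) = _ :=
    fun i ↦ dirDeriv_const_mul c (θ.2 fun l ↦ a (i.succAbove l)) x _
  simp only [e]
  change c * η.1 x _ = _
  rw [h a x]
  have e' : ∀ v, (c • θ).1 x v = c * θ.1 x v := fun _ ↦ rfl
  simp only [e', mul_add, Finset.mul_sum, mul_left_comm c]

theorem IsDifferential.zero (𝒜 : LieAlgebroid E F A) {k : ℕ} :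
    IsDifferential 𝒜 (0 : Form E F A k) 0 := by
  intro a x
  have e : ∀ (l : ℕ) (v : Fin l → A x), (0 : Form E F A l).1 x v = 0 := fun _ _ ↦ rfl
  have e' : ∀ (v : ∀ y, Fin k → A y) (u : TangentSpace 𝓘(ℝ, E) x),
      dirDeriv (fun y ↦ (0 : Form E F A k).1 y (v y)) x u = 0 := by
    intro v u
    have h : (fun y ↦ (0 : Form E F A k).1 y (v y)) = fun _ : M ↦ (0 : ℝ) := rfl
    rw [h, dirDeriv, mfderiv_const]
    rfl
  rw [e]
  simp only [e, e']
  simp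

/-- The space of `d_A`-closed sections of `A^*`. -/
def cocycles (𝒜 : LieAlgebroid E F A) : Submodule ℝ (Form E F A 1) where
  carrier := {α | IsDifferential 𝒜 α 0}
  add_mem' := fun h h' ↦ by simpa using h.add h'
  zero_mem' := IsDifferential.zero 𝒜
  smul_mem' := fun c _ h ↦ by simpa using h.smul c

/-- The space of sections of `A^*` of the form `d_A f`, for `f ∈ C^∞(M)`. -/
def coboundaries (𝒜 : LieAlgebroid E F A) : Submodule ℝ (Form E F A 1) where
  carrier := {α | ∃ f : Form E F A 0, IsDifferential 𝒜 f α}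
  add_mem' := fun ⟨f, h⟩ ⟨f', h'⟩ ↦ ⟨f + f', h.add h'⟩
  zero_mem' := ⟨0, IsDifferential.zero 𝒜⟩
  smul_mem' := fun c _ ⟨f, h⟩ ↦ ⟨c • f, h.smul c⟩

/-- The Lie algebroid cohomology space `H¹(A)`. -/
abbrev H1 (𝒜 : LieAlgebroid E F A) : Type _ :=
  cocycles 𝒜 ⧸ (coboundaries 𝒜).submoduleOf (cocycles 𝒜)

/-- The class in `H¹(A)` of a closed section of `A^*`. -/
def H1.mk {𝒜 : LieAlgebroid E F A} (α : cocycles 𝒜) : H1 𝒜 :=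
  Submodule.Quotient.mk α

end Forms

/-! ### Morphisms of Lie algebroids -/

section Morphisms

variable {E : Type*} [NormedAddCommGroup E] [NormedSpace ℝ E]
  {M : Type*} [TopologicalSpace M] [ChartedSpace E M]
  {F : Type*} [NormedAddCommGroup F] [NormedSpace ℝ F]
  {A : M → Type*} [TopologicalSpace (TotalSpace F A)] [∀ x, TopologicalSpace (A x)]
  [∀ x, AddCommGroup (A x)] [∀ x, Module ℝ (A x)] [FiberBundle F A] [VectorBundle ℝ F A]
  {E' : Type*} [NormedAddCommGroup E'] [NormedSpace ℝ E'] [FiniteDimensional ℝ E']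
  {N : Type*} [TopologicalSpace N] [ChartedSpace E' N] [T2Space N] [IsManifold 𝓘(ℝ, E') ∞ N]
  {F' : Type*} [NormedAddCommGroup F'] [NormedSpace ℝ F'] [FiniteDimensional ℝ F']
  {B : N → Type*} [TopologicalSpace (TotalSpace F' B)] [∀ x, TopologicalSpace (B x)]
  [∀ x, AddCommGroup (B x)] [∀ x, Module ℝ (B x)] [FiberBundle F' B] [VectorBundle ℝ F' B]
  [ContMDiffVectorBundle ∞ F' B 𝓘(ℝ, E')]

/-- The value of a smooth form on sections along a smooth map is smooth. -/
theorem Form.contMDiff_along {k : ℕ} (θ : Form E' F' B k) {φ : M → N}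
    (s : Fin k → ∀ m, B (φ m))
    (hφ : ContMDiff 𝓘(ℝ, E) 𝓘(ℝ, E') ∞ φ)
    (hs : ∀ i, ContMDiff 𝓘(ℝ, E) (𝓘(ℝ, E').prod 𝓘(ℝ, F')) ∞
      (fun m ↦ (⟨φ m, s i m⟩ : TotalSpace F' B))) :
    ContMDiff 𝓘(ℝ, E) 𝓘(ℝ, ℝ) ∞ (fun m ↦ θ.1 (φ m) (fun i ↦ s i m)) := by
  intro m₀
  have : ContMDiffVectorBundle 1 F' B 𝓘(ℝ, E') := ContMDiffVectorBundle.of_le (n := ∞) (by simp)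
  let e := trivializationAt F' B (φ m₀)
  let b := Module.finBasis ℝ F'
  have hmem : φ m₀ ∈ e.baseSet := FiberBundle.mem_baseSet_trivializationAt' (φ m₀)
  -- a bump function equal to `1` near `φ m₀`, supported in the domain of the local frame
  obtain ⟨χ, -, hχ⟩ := (SmoothBumpFunction.nhds_basis_tsupport (I := 𝓘(ℝ, E')) (φ m₀)).mem_iff.1
    (e.open_baseSet.mem_nhds hmem)
  let t : Fin (finrank ℝ F') → Cₛ^∞⟮𝓘(ℝ, E'); F', B⟯ := fun j ↦
    ⟨fun y ↦ χ y • e.localFrame b j y,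
      ContMDiffOn.smul_section_of_tsupport (u := e.baseSet) χ.contMDiff.contMDiffOn
        e.open_baseSet hχ (e.contMDiffOn_localFrame_baseSet ∞ b j)⟩
  let c : Fin k → Fin (finrank ℝ F') → M → ℝ := fun i j m ↦ b.repr (e ⟨φ m, s i m⟩).2 j
  have hc : ∀ i j, ContMDiffAt 𝓘(ℝ, E) 𝓘(ℝ, ℝ) ∞ (c i j) m₀ := by
    intro i j
    have h1 : ContMDiffAt 𝓘(ℝ, E) 𝓘(ℝ, F') ∞ (fun m ↦ (e ⟨φ m, s i m⟩).2) m₀ :=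
      ((e.contMDiffAt_iff (IB := 𝓘(ℝ, E')) (f := fun m ↦ (⟨φ m, s i m⟩ : TotalSpace F' B))
        (x₀ := m₀) (e.mem_source.2 hmem)).1 (hs i m₀)).2
    let l : F' →L[ℝ] ℝ := (b.coord j).toContinuousLinearMap
    exact (l.contMDiff.contMDiffAt (x := (e ⟨φ m₀, s i m₀⟩).2)).comp m₀ h1
  have key : (fun m ↦ θ.1 (φ m) (fun i ↦ s i m)) =ᶠ[𝓝 m₀] fun m ↦
      ∑ r : Fin k → Fin (finrank ℝ F'), (∏ i, c i (r i) m) * θ.1 (φ m) (fun i ↦ t (r i) (φ m)) := by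
    have h1 : ∀ᶠ m in 𝓝 m₀, φ m ∈ e.baseSet :=
      hφ.continuous.continuousAt.eventually (e.open_baseSet.mem_nhds hmem)
    have h2 : ∀ᶠ m in 𝓝 m₀, χ (φ m) = 1 :=
      hφ.continuous.continuousAt.eventually χ.eventuallyEq_one
    filter_upwards [h1, h2] with m hm hm1
    have h3 : ∀ i, s i m = ∑ j, c i j m • t j (φ m) := by
      intro i
      have h4 := (e.basisAt b hm).sum_repr (s i m)
      rw [← h4]
      refine Finset.sum_congr rfl fun j _ ↦ ?_
      have h5 : t j (φ m) = e.basisAt b hm j := by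
        change χ (φ m) • e.localFrame b j (φ m) = _
        rw [hm1, one_smul, e.localFrame_apply_of_mem_baseSet b hm]
      rw [h5]
      congr 1
    have h6 : (fun i ↦ s i m) = fun i ↦ ∑ j, c i j m • t j (φ m) := funext h3
    rw [h6]
    change (θ.1 (φ m)).toMultilinearMap _ = _
    rw [MultilinearMap.map_sum]
    refine Finset.sum_congr rfl fun r _ ↦ ?_
    rw [MultilinearMap.map_smul_univ]
    rfl
  refine ContMDiffAt.congr_of_eventuallyEq ?_ key
  refine ContMDiffAt.sum fun r _ ↦ ?_
  refine ContMDiffAt.mul (ContMDiffAt.prod fun i _ ↦ hc i (r i)) ?_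
  exact (θ.2 fun i ↦ t (r i)).contMDiffAt.comp m₀ (hφ m₀)

end Morphisms

/-- A smooth map `(Φ, φ)` of vector bundles from `A → M` to `B → N`. -/
structure BundleMap (E : Type*) [NormedAddCommGroup E] [NormedSpace ℝ E]
    {M : Type*} [TopologicalSpace M] [ChartedSpace E M]
    (F : Type*) [NormedAddCommGroup F] [NormedSpace ℝ F]
    (A : M → Type*) [TopologicalSpace (TotalSpace F A)] [∀ x, TopologicalSpace (A x)]
    [∀ x, AddCommGroup (A x)] [∀ x, Module ℝ (A x)] [FiberBundle F A] [VectorBundle ℝ F A]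
    (E' : Type*) [NormedAddCommGroup E'] [NormedSpace ℝ E']
    {N : Type*} [TopologicalSpace N] [ChartedSpace E' N]
    (F' : Type*) [NormedAddCommGroup F'] [NormedSpace ℝ F']
    (B : N → Type*) [TopologicalSpace (TotalSpace F' B)] [∀ x, TopologicalSpace (B x)]
    [∀ x, AddCommGroup (B x)] [∀ x, Module ℝ (B x)] [FiberBundle F' B] [VectorBundle ℝ F' B] where
  /-- the map `φ` between the bases -/
  base : M → N
  contMDiff_base : ContMDiff 𝓘(ℝ, E) 𝓘(ℝ, E') ∞ base
  /-- the linear maps between the fibres -/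
  map : ∀ m, A m →ₗ[ℝ] B (base m)
  contMDiff_map : ContMDiff (𝓘(ℝ, E).prod 𝓘(ℝ, F)) (𝓘(ℝ, E').prod 𝓘(ℝ, F')) ∞
    (fun p : TotalSpace F A ↦ (⟨base p.1, map p.1 p.2⟩ : TotalSpace F' B))

section Main

variable {E : Type*} [NormedAddCommGroup E] [NormedSpace ℝ E]
  {M : Type*} [TopologicalSpace M] [ChartedSpace E M] [IsManifold 𝓘(ℝ, E) ∞ M]
  {F : Type*} [NormedAddCommGroup F] [NormedSpace ℝ F]
  {A : M → Type*} [TopologicalSpace (TotalSpace F A)] [∀ x, TopologicalSpace (A x)]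
  [∀ x, AddCommGroup (A x)] [∀ x, Module ℝ (A x)] [FiberBundle F A] [VectorBundle ℝ F A]
  {E' : Type*} [NormedAddCommGroup E'] [NormedSpace ℝ E'] [FiniteDimensional ℝ E']
  {N : Type*} [TopologicalSpace N] [ChartedSpace E' N] [T2Space N] [IsManifold 𝓘(ℝ, E') ∞ N]
  {F' : Type*} [NormedAddCommGroup F'] [NormedSpace ℝ F'] [FiniteDimensional ℝ F']
  {B : N → Type*} [TopologicalSpace (TotalSpace F' B)] [∀ x, TopologicalSpace (B x)]
  [∀ x, AddCommGroup (B x)] [∀ x, Module ℝ (B x)] [FiberBundle F' B] [VectorBundle ℝ F' B]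
  [ContMDiffVectorBundle ∞ F' B 𝓘(ℝ, E')]

/-- The pull-back of forms by a bundle map `(Φ, φ)`:
`(Φ^* θ)_m (a₁, …, a_k) = θ_{φ(m)} (Φ a₁, …, Φ a_k)`. -/
def BundleMap.pullbackForm (Φ : BundleMap E F A E' F' B) (k : ℕ) :
    Form E' F' B k →ₗ[ℝ] Form E F A k where
  toFun θ := ⟨fun m ↦ (θ.1 (Φ.base m)).compLinearMap (Φ.map m), fun a ↦
    θ.contMDiff_along (fun i m ↦ Φ.map m (a i m)) Φ.contMDiff_base
      (fun i ↦ Φ.contMDiff_map.comp (a i).contMDiff)⟩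
  map_add' _ _ := rfl
  map_smul' _ _ := rfl

/-- `(Φ, φ)` is a morphism of Lie algebroids: the pull-back of forms is a chain map. -/
def IsMorphism (𝒜 : LieAlgebroid E F A) (ℬ : LieAlgebroid E' F' B)
    (Φ : BundleMap E F A E' F' B) : Prop :=
  ∀ (k : ℕ) (θ : Form E' F' B k) (η : Form E' F' B (k + 1)),
    IsDifferential ℬ θ η → IsDifferential 𝒜 (Φ.pullbackForm k θ) (Φ.pullbackForm (k + 1) η)

/-- The linear map `Φ^* : H¹(B) → H¹(A)` induced by a morphism of Lie algebroids. -/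
def H1.map {𝒜 : LieAlgebroid E F A} {ℬ : LieAlgebroid E' F' B} {Φ : BundleMap E F A E' F' B}
    (hΦ : IsMorphism 𝒜 ℬ Φ) : H1 ℬ →ₗ[ℝ] H1 𝒜 :=
  Submodule.mapQ _ _
    ((Φ.pullbackForm 1).restrict (p := cocycles ℬ) (q := cocycles 𝒜) fun α hα ↦ by
      have h := hΦ 1 α 0 hα
      rwa [map_zero] at h)
    (by
      rintro ⟨α, hα⟩ ⟨f, hf⟩
      exact ⟨Φ.pullbackForm 0 f, hΦ 0 f α hf⟩)

/-! ### Pull-back Lie algebroids and pull-back morphisms -/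

/-- The fibre `{(b, u) ∈ B_{φ(m)} ⊕ T_m M | ρ_B b = (Tφ) u}` at `m` of `B ⊕_{TN} TM`. -/
def pullbackFiber (ℬ : LieAlgebroid E' F' B) (φ : M → N) (m : M) :
    Submodule ℝ (B (φ m) × TangentSpace 𝓘(ℝ, E) m) :=
  LinearMap.eqLocus
    ((ℬ.anchor (φ m)).comp (LinearMap.fst ℝ (B (φ m)) (TangentSpace 𝓘(ℝ, E) m)))
    ((mfderiv 𝓘(ℝ, E) 𝓘(ℝ, E') φ m).toLinearMap.comp
      (LinearMap.snd ℝ (B (φ m)) (TangentSpace 𝓘(ℝ, E) m)))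

/-- `φ` is admissible for `B`: the rank of `B ⊕_{TN} TM` is constant. -/
def IsAdmissible (E : Type*) [NormedAddCommGroup E] [NormedSpace ℝ E]
    {M : Type*} [TopologicalSpace M] [ChartedSpace E M] [IsManifold 𝓘(ℝ, E) ∞ M]
    (ℬ : LieAlgebroid E' F' B) (φ : M → N) : Prop :=
  ∃ k : ℕ, ∀ m : M, finrank ℝ (pullbackFiber (E := E) ℬ φ m) = k

/-- Smooth sections of `B ⊕_{TN} TM`, as a sub-bundle of `φ^!B ⊕ TM`. -/
def IsSmoothPullbackSection (ℬ : LieAlgebroid E' F' B) (φ : M → N)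
    (s : ∀ m : M, pullbackFiber (E := E) ℬ φ m) : Prop :=
  ContMDiff 𝓘(ℝ, E) (𝓘(ℝ, E').prod 𝓘(ℝ, F')) ∞
    (fun m ↦ (⟨φ m, (s m).1.1⟩ : TotalSpace F' B)) ∧
  ContMDiff 𝓘(ℝ, E) (𝓘(ℝ, E).prod 𝓘(ℝ, E)) ∞
    (fun m ↦ (⟨m, (s m).1.2⟩ : TangentBundle 𝓘(ℝ, E) M))

/-- `IsPullbackBracket ℬ φ s t r` means that `r` is the bracket, in the pull-back Lie algebroid of
`B` by `φ`, of the sections `s = (∑ fᵢ ⊗ bᵢ, u)` and `t = (∑ gⱼ ⊗ cⱼ, v)`: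
`r = (∑ fᵢ gⱼ ⊗ [bᵢ, cⱼ] + ∑ (u · gⱼ) ⊗ cⱼ - ∑ (v · fᵢ) ⊗ bᵢ, [u, v])`. -/
def IsPullbackBracket (ℬ : LieAlgebroid E' F' B) (φ : M → N)
    (s t r : ∀ m : M, pullbackFiber (E := E) ℬ φ m) : Prop :=
  (∀ (k l : ℕ) (f : Fin k → C^∞⟮𝓘(ℝ, E), M; ℝ⟯) (b : Fin k → Cₛ^∞⟮𝓘(ℝ, E'); F', B⟯)
      (g : Fin l → C^∞⟮𝓘(ℝ, E), M; ℝ⟯) (c : Fin l → Cₛ^∞⟮𝓘(ℝ, E'); F', B⟯),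
      (∀ m, (s m).1.1 = ∑ i, f i m • b i (φ m)) →
      (∀ m, (t m).1.1 = ∑ j, g j m • c j (φ m)) →
      ∀ m, (r m).1.1 =
        ∑ i, ∑ j, (f i m * g j m) • ℬ.bracket (b i) (c j) (φ m) +
        ∑ j, dirDeriv (g j) m (s m).1.2 • c j (φ m) -
        ∑ i, dirDeriv (f i) m (t m).1.2 • b i (φ m)) ∧
  ∀ m, (r m).1.2 =
    VectorField.mlieBracket 𝓘(ℝ, E) (fun y ↦ (s y).1.2) (fun y ↦ (t y).1.2) m

/-- An isomorphism `Ψ`, over the identity of `M`, from the Lie algebroid `A` to the pull-back Lie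
algebroid of `B` by `φ`.  The total space of the latter is `B ⊕_{TN} TM`, its anchor is the
projection onto the second component, and its bracket is `IsPullbackBracket`. -/
structure PullbackIso (𝒜 : LieAlgebroid E F A) (ℬ : LieAlgebroid E' F' B) (φ : M → N) where
  /-- the isomorphisms between the fibres -/
  toEquiv : ∀ m, A m ≃ₗ[ℝ] pullbackFiber (E := E) ℬ φ m
  smooth_iff : ∀ a : (∀ m, A m),
    ContMDiff 𝓘(ℝ, E) (𝓘(ℝ, E).prod 𝓘(ℝ, F)) ∞ (fun m ↦ (⟨m, a m⟩ : TotalSpace F A)) ↔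
      IsSmoothPullbackSection ℬ φ (fun m ↦ toEquiv m (a m))
  anchor_eq : ∀ m (a : A m), (toEquiv m a).1.2 = 𝒜.anchor m a
  bracket_eq : ∀ a a' : Cₛ^∞⟮𝓘(ℝ, E); F, A⟯,
    IsPullbackBracket ℬ φ (fun m ↦ toEquiv m (a m)) (fun m ↦ toEquiv m (a' m))
      (fun m ↦ toEquiv m (𝒜.bracket a a' m))

/-- `(Φ, φ)` is a pull-back morphism: it is a morphism of Lie algebroids, `φ` is admissible, and
`Φ` is the composition of an isomorphism `Ψ` from `A` to the pull-back Lie algebroid of `B` by `φ`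
and of the projection of the latter onto its first component. -/
def IsPullbackMorphism (𝒜 : LieAlgebroid E F A) (ℬ : LieAlgebroid E' F' B)
    (Φ : BundleMap E F A E' F' B) : Prop :=
  IsMorphism 𝒜 ℬ Φ ∧ IsAdmissible E ℬ Φ.base ∧
    ∃ Ψ : PullbackIso 𝒜 ℬ Φ.base, ∀ m (a : A m), Φ.map m a = (Ψ.toEquiv m a).1.1

/-! ### Representations -/

section Representations

variable {L : M → Type*} [∀ x, AddCommGroup (L x)] [∀ x, Module ℝ (L x)]
  {L' : M → Type*} [∀ x, AddCommGroup (L' x)] [∀ x, Module ℝ (L' x)]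
  {K : N → Type*} [∀ x, AddCommGroup (K x)] [∀ x, Module ℝ (K x)]

/-- `D : ΓA × ΓL → ΓL` is a representation of the Lie algebroid `A` on `L`, in other words an
`A`-module structure on `L`. -/
structure IsRepresentation (𝒜 : LieAlgebroid E F A) (S : SectionSpace E L)
    (D : Cₛ^∞⟮𝓘(ℝ, E); F, A⟯ → S.carrier → S.carrier) : Prop where
  add_left : ∀ a a' s, D (a + a') s = D a s + D a' s
  add_right : ∀ a s s', D a (s + s') = D a s + D a s'
  smul_right : ∀ a (c : ℝ) s, D a (c • s) = c • D a s
  fun_smul_left : ∀ (f : C^∞⟮𝓘(ℝ, E), M; ℝ⟯) a s, D (funSMul f a) s = S.funSMul f (D a s)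
  leibniz : ∀ a (f : C^∞⟮𝓘(ℝ, E), M; ℝ⟯) s x,
    (D a (S.funSMul f s)).1 x = f x • (D a s).1 x + dirDeriv f x (𝒜.anchor x (a x)) • s.1 x
  flat : ∀ a a' s, D a (D a' s) - D a' (D a s) = D (𝒜.bracket a a') s

/-- `D''` is the tensor product of the representations `D` on `L` and `D'` on `L'`: it is a
representation on `L ⊗ L'` and `a · (y ⊗ z) = (a · y) ⊗ z + y ⊗ (a · z)`. -/
def IsTensorRep (𝒜 : LieAlgebroid E F A) (S : SectionSpace E L) (S' : SectionSpace E L')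
    (D : Cₛ^∞⟮𝓘(ℝ, E); F, A⟯ → S.carrier → S.carrier)
    (D' : Cₛ^∞⟮𝓘(ℝ, E); F, A⟯ → S'.carrier → S'.carrier)
    (D'' : Cₛ^∞⟮𝓘(ℝ, E); F, A⟯ → (S.tensor S').carrier → (S.tensor S').carrier) : Prop :=
  IsRepresentation 𝒜 (S.tensor S') D'' ∧
    ∀ a y z, D'' a (S.tmul S' y z) = S.tmul S' (D a y) z + S.tmul S' y (D' a z)

/-- The tensor product of representations: the unique representation on `L ⊗ L'` satisfying
`IsTensorRep`. -/
def tensorRep (𝒜 : LieAlgebroid E F A) (S : SectionSpace E L) (S' : SectionSpace E L')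
    (D : Cₛ^∞⟮𝓘(ℝ, E); F, A⟯ → S.carrier → S.carrier)
    (D' : Cₛ^∞⟮𝓘(ℝ, E); F, A⟯ → S'.carrier → S'.carrier) :
    Cₛ^∞⟮𝓘(ℝ, E); F, A⟯ → (S.tensor S').carrier → (S.tensor S').carrier :=
  Classical.epsilon (IsTensorRep 𝒜 S S' D D')

/-- `D'` is the pull-back `Φ^!D`, by a morphism `(Φ, φ)` from `A` to `B`, of the representation `D`
of `B` on `K`: it is a representation of `A` on `φ^!K` and, at every point `m`,
`(a · φ^!y)(m) = (b · y)(φ(m))` whenever `Φ (a(m)) = b(φ(m))`. -/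
def IsPullbackRep (𝒜 : LieAlgebroid E F A) (Φ : BundleMap E F A E' F' B) (S : SectionSpace E' K)
    (D : Cₛ^∞⟮𝓘(ℝ, E'); F', B⟯ → S.carrier → S.carrier)
    (D' : Cₛ^∞⟮𝓘(ℝ, E); F, A⟯ → (S.pullback E Φ.base).carrier →
      (S.pullback E Φ.base).carrier) : Prop :=
  IsRepresentation 𝒜 (S.pullback E Φ.base) D' ∧
    ∀ a b y m, Φ.map m (a m) = b (Φ.base m) →
      (D' a (S.pullbackSec Φ.base y)).1 m = (D b y).1 (Φ.base m)

/-- The pull-back `Φ^!D` of a representation: the unique representation of `A` on `φ^!K`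
satisfying `IsPullbackRep`. -/
def pullbackRep (𝒜 : LieAlgebroid E F A) (Φ : BundleMap E F A E' F' B) (S : SectionSpace E' K)
    (D : Cₛ^∞⟮𝓘(ℝ, E'); F', B⟯ → S.carrier → S.carrier) :
    Cₛ^∞⟮𝓘(ℝ, E); F, A⟯ → (S.pullback E Φ.base).carrier → (S.pullback E Φ.base).carrier :=
  Classical.epsilon (IsPullbackRep 𝒜 Φ S D)

/-- A fibrewise linear map `ℓ : L → L'` is an isomorphism of `A`-modules, from `L` with the
representation `D` to `L'` with the representation `D'`. -/
structure IsModuleIso (𝒜 : LieAlgebroid E F A) (S : SectionSpace E L) (S' : SectionSpace E L')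
    (D : Cₛ^∞⟮𝓘(ℝ, E); F, A⟯ → S.carrier → S.carrier)
    (D' : Cₛ^∞⟮𝓘(ℝ, E); F, A⟯ → S'.carrier → S'.carrier)
    (ℓ : ∀ m, L m →ₗ[ℝ] L' m) : Prop where
  isRepresentation_source : IsRepresentation 𝒜 S D
  isRepresentation_target : IsRepresentation 𝒜 S' D'
  bijective : ∀ m, Function.Bijective (ℓ m)
  smooth_iff : ∀ s : (∀ m, L m), s ∈ S.carrier ↔ (fun m ↦ ℓ m (s m)) ∈ S'.carrier
  equivariant : ∀ a (s : S.carrier) (s' : S'.carrier), (∀ m, s'.1 m = ℓ m (s.1 m)) →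
    ∀ m, (D' a s').1 m = ℓ m ((D a s).1 m)

/-! ### Characteristic classes of representations on line bundles -/

/-- `α` is the characteristic cocycle of the representation `D` associated to `s`:
`⟨α, a⟩ s = a · s` for every section `a` of `A`. -/
def IsCharacteristicCocycle {𝒜 : LieAlgebroid E F A} {S : SectionSpace E L}
    (D : Cₛ^∞⟮𝓘(ℝ, E); F, A⟯ → S.carrier → S.carrier) (s : S.carrier) (α : cocycles 𝒜) : Prop :=
  ∀ a x, α.1.1 x (fun _ ↦ a x) • s.1 x = (D a s).1 x

/-- `c` is the characteristic class of the representation `D` of `A` on the line bundle `L`: the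
class of the characteristic cocycle of any nowhere-vanishing section if `L` has such a section
(`L` is orientable), and one-half of the class so defined by `D ⊗ D` on `L ⊗ L` otherwise. -/
def IsCharacteristicClass (𝒜 : LieAlgebroid E F A) (S : SectionSpace E L)
    (D : Cₛ^∞⟮𝓘(ℝ, E); F, A⟯ → S.carrier → S.carrier) (c : H1 𝒜) : Prop :=
  (∃ (s : S.carrier) (α : cocycles 𝒜), (∀ x, s.1 x ≠ 0) ∧ IsCharacteristicCocycle D s α ∧
    c = H1.mk α) ∨
  ((¬ ∃ s : S.carrier, ∀ x, s.1 x ≠ 0) ∧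
    ∃ (s : (S.tensor S).carrier) (α : cocycles 𝒜), (∀ x, s.1 x ≠ 0) ∧
      IsCharacteristicCocycle (tensorRep 𝒜 S S D D) s α ∧ (2 : ℝ) • c = H1.mk α)

end Representations

/-! ### The canonical representation and the modular class -/

variable (E F A) in
/-- The fibre at `x` of the canonical line bundle `L^A = ∧^top A ⊗ ∧^top (T^*M)`. -/
abbrev CanonicalFiber (x : M) : Type _ :=
  (⋀[ℝ]^(finrank ℝ F) (A x)) ⊗[ℝ]
    ((TangentSpace 𝓘(ℝ, E) x) [⋀^Fin (finrank ℝ E)]→ₗ[ℝ] ℝ)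

variable (E M) in
/-- Smooth top-degree differential forms on `M`. -/
abbrev TopForm : Type _ := Form E E (fun x : M ↦ TangentSpace 𝓘(ℝ, E) x) (finrank ℝ E)

/-- The section `(a₁ ∧ … ∧ a_p) ⊗ μ` of `L^A`, where `p` is the rank of `A`. -/
def wedgeTmul (a : Fin (finrank ℝ F) → Cₛ^∞⟮𝓘(ℝ, E); F, A⟯) (μ : TopForm E M) (x : M) :
    CanonicalFiber E F A x :=
  exteriorPower.ιMulti ℝ (finrank ℝ F) (fun i ↦ a i x) ⊗ₜ[ℝ] μ.1 x

variable (E F A) in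
/-- The canonical line bundle `L^A = ∧^top A ⊗ ∧^top (T^*M)`, with its smooth sections. -/
def canonicalLine : SectionSpace E (CanonicalFiber E F A) :=
  SectionSpace.generate E {s | ∃ a μ, s = wedgeTmul a μ}

/-- The smooth section `(a₁ ∧ … ∧ a_p) ⊗ μ` of `L^A`. -/
def wedgeTmulSec (a : Fin (finrank ℝ F) → Cₛ^∞⟮𝓘(ℝ, E); F, A⟯) (μ : TopForm E M) :
    (canonicalLine E F A).carrier :=
  ⟨wedgeTmul a μ, SectionSpace.generate_mem ⟨a, μ, rfl⟩⟩

/-- `μ'` is the Lie derivative of `μ` along the vector field `u`. -/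
def IsLieDerivative (u : ∀ x : M, TangentSpace 𝓘(ℝ, E) x) (μ μ' : TopForm E M) : Prop :=
  ∀ (X : Fin (finrank ℝ E) → Cₛ^∞⟮𝓘(ℝ, E); E, fun x : M ↦ TangentSpace 𝓘(ℝ, E) x⟯) (x : M),
    μ'.1 x (fun i ↦ X i x) = dirDeriv (fun y ↦ μ.1 y (fun i ↦ X i y)) x (u x) -
      ∑ i, μ.1 x (Function.update (fun j ↦ X j x) i
        (VectorField.mlieBracket 𝓘(ℝ, E) u (fun y ↦ X i y) x))

/-- `D` is the canonical representation of `A` on `L^A`: it is a representation and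
`a · ((a₁ ∧ … ∧ a_p) ⊗ μ) = [a, a₁ ∧ … ∧ a_p] ⊗ μ + (a₁ ∧ … ∧ a_p) ⊗ 𝓛_{ρ a} μ`, where
`[a, a₁ ∧ … ∧ a_p] = ∑ i, a₁ ∧ … ∧ [a, a_i] ∧ … ∧ a_p` is the Gerstenhaber bracket. -/
def IsCanonicalRep (𝒜 : LieAlgebroid E F A)
    (D : Cₛ^∞⟮𝓘(ℝ, E); F, A⟯ → (canonicalLine E F A).carrier → (canonicalLine E F A).carrier) :
    Prop :=
  IsRepresentation 𝒜 (canonicalLine E F A) D ∧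
    ∀ a b μ μ', IsLieDerivative (fun x ↦ 𝒜.anchor x (a x)) μ μ' →
      D a (wedgeTmulSec b μ) =
        ∑ i, wedgeTmulSec (Function.update b i (𝒜.bracket a (b i))) μ + wedgeTmulSec b μ'

/-- The canonical representation `D^A` of `A` on `L^A`: the unique representation satisfying
`IsCanonicalRep`. -/
def canonicalRep (𝒜 : LieAlgebroid E F A) :
    Cₛ^∞⟮𝓘(ℝ, E); F, A⟯ → (canonicalLine E F A).carrier → (canonicalLine E F A).carrier :=
  Classical.epsilon (IsCanonicalRep 𝒜)

/-- The modular class `Mod A ∈ H¹(A)` of a Lie algebroid: the characteristic class of its canonical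
representation. -/
def modularClass (𝒜 : LieAlgebroid E F A) : H1 𝒜 :=
  Classical.epsilon (IsCharacteristicClass 𝒜 (canonicalLine E F A) (canonicalRep 𝒜))

/-- The modular class `Mod Φ = Mod A - Φ^*(Mod B)` of a morphism of Lie algebroids. -/
def morphismModularClass {𝒜 : LieAlgebroid E F A} {ℬ : LieAlgebroid E' F' B}
    {Φ : BundleMap E F A E' F' B} (hΦ : IsMorphism 𝒜 ℬ Φ) : H1 𝒜 :=
  modularClass 𝒜 - H1.map hΦ (modularClass ℬ)

end Main

/-! ### The canonical isomorphism `ℓ^φ` -/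

section Canonical

variable {V W T Q : Type*} [AddCommGroup V] [Module ℝ V] [AddCommGroup W] [Module ℝ W]
  [AddCommGroup T] [Module ℝ T] [AddCommGroup Q] [Module ℝ Q]

/-- Evaluation of the second factor of `X ⊗ ∧^q Q^*` on `q` vectors of `Q`. -/
def evalForm (X : Type*) [AddCommGroup X] [Module ℝ X] {q : ℕ} (Y : Fin q → Q) :
    X ⊗[ℝ] (Q [⋀^Fin q]→ₗ[ℝ] ℝ) →ₗ[ℝ] X :=
  (TensorProduct.rid ℝ X).toLinearMap.comp (LinearMap.lTensor X
    { toFun := fun ν ↦ ν Y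
      map_add' := fun _ _ ↦ rfl
      map_smul' := fun _ _ ↦ rfl })

/-- Let `0 → V --i--> W ⊕ T --κ--> Q → 0` be an exact sequence, with `dim V = r`, `dim W = p`,
`dim T = n`, `dim Q = q`.  The canonical isomorphisms `∧^r V ⊗ ∧^q Q ≅ ∧^{p+n} (W ⊕ T)`, which maps
`X ⊗ (κ w₁ ∧ … ∧ κ w_q)` to `i(X) ∧ w₁ ∧ … ∧ w_q`, and `∧^p W ⊗ ∧^n T ≅ ∧^{p+n} (W ⊕ T)`, which is
the wedge product, together induce an isomorphism
`ℓ : ∧^r V ⊗ ∧^n T^* ≅ ∧^p W ⊗ ∧^q Q^*`.  Explicitly, if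
`i(X) ∧ w₁ ∧ … ∧ w_q = Z ∧ ξ₁ ∧ … ∧ ξ_n`, then `ℓ (X ⊗ μ)`, evaluated on `(κ w₁, …, κ w_q)`, is
`μ(ξ₁, …, ξ_n) Z`.  This property characterizes `ℓ`. -/
def IsCanonicalIso {r p n q : ℕ} (i : V →ₗ[ℝ] W × T) (κ : W × T →ₗ[ℝ] Q)
    (ℓ : (⋀[ℝ]^r V) ⊗[ℝ] (T [⋀^Fin n]→ₗ[ℝ] ℝ) →ₗ[ℝ] (⋀[ℝ]^p W) ⊗[ℝ] (Q [⋀^Fin q]→ₗ[ℝ] ℝ)) :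
    Prop :=
  ∀ (X : ⋀[ℝ]^r V) (μ : T [⋀^Fin n]→ₗ[ℝ] ℝ) (w : Fin q → W × T) (Z : ⋀[ℝ]^p W) (ξ : Fin n → T),
    ExteriorAlgebra.map i X.1 * ExteriorAlgebra.ιMulti ℝ q w =
      ExteriorAlgebra.map (LinearMap.inl ℝ W T) Z.1 *
        ExteriorAlgebra.ιMulti ℝ n (fun j ↦ LinearMap.inr ℝ W T (ξ j)) →
    evalForm (⋀[ℝ]^p W) (fun j ↦ κ (w j)) (ℓ (X ⊗ₜ[ℝ] μ)) = μ ξ • Z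

variable {E : Type*} [NormedAddCommGroup E] [NormedSpace ℝ E]
  {M : Type*} [TopologicalSpace M] [ChartedSpace E M] [IsManifold 𝓘(ℝ, E) ∞ M]
  {F : Type*} [NormedAddCommGroup F] [NormedSpace ℝ F]
  {A : M → Type*} [TopologicalSpace (TotalSpace F A)] [∀ x, TopologicalSpace (A x)]
  [∀ x, AddCommGroup (A x)] [∀ x, Module ℝ (A x)] [FiberBundle F A] [VectorBundle ℝ F A]
  {E' : Type*} [NormedAddCommGroup E'] [NormedSpace ℝ E']
  {N : Type*} [TopologicalSpace N] [ChartedSpace E' N] [IsManifold 𝓘(ℝ, E') ∞ N]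
  {F' : Type*} [NormedAddCommGroup F'] [NormedSpace ℝ F']
  {B : N → Type*} [TopologicalSpace (TotalSpace F' B)] [∀ x, TopologicalSpace (B x)]
  [∀ x, AddCommGroup (B x)] [∀ x, Module ℝ (B x)] [FiberBundle F' B] [VectorBundle ℝ F' B]

/-- The canonical isomorphism `ℓ^φ : L^A → φ^!L^B` at `m`, for a pull-back morphism `(Φ, φ)` over a
map `φ` transverse to `B`.  It comes from the exact sequence
`0 → A_m → B_{φ(m)} ⊕ T_m M → T_{φ(m)} N → 0`, where the first map is `a ↦ (Φ a, ρ_A a)`, which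
identifies `A_m` with the fibre of `B ⊕_{TN} TM`, and the second is `(b, u) ↦ (Tφ) u - ρ_B b`. -/
def canonicalIso (𝒜 : LieAlgebroid E F A) (ℬ : LieAlgebroid E' F' B)
    (Φ : BundleMap E F A E' F' B) (m : M) :
    CanonicalFiber E F A m →ₗ[ℝ] CanonicalFiber E' F' B (Φ.base m) :=
  Classical.epsilon (IsCanonicalIso ((Φ.map m).prod (𝒜.anchor m))
    ((mfderiv 𝓘(ℝ, E) 𝓘(ℝ, E') Φ.base m).toLinearMap.comp (LinearMap.snd ℝ _ _) -
      (ℬ.anchor (Φ.base m)).comp (LinearMap.fst ℝ _ _)))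

end Canonical

end ModularClass

end

open ModularClass

noncomputable section

set_option linter.unusedSectionVars false

namespace ModularClass

/-! ### Top exterior powers -/

section TopForms

variable {V : Type*} [AddCommGroup V] [Module ℝ V] {X : Type*} [AddCommGroup X] [Module ℝ X]

/-! Locally, a pull-back Lie algebroid over a submersion consists of a copy of `B` and of the
vertical directions of `φ`; the latter enter `∧^top A` and `∧^top (T^*M)` as mutually dual factors,
so that their contributions to the canonical representation cancel.

Near a point `m`, choose sections `b_j` of `A` which are `Φ`-related to a frame `c_j` of `B`,
further sections of `A` related to `0` whose anchors `ξ_k` span the kernel of `Tφ` at `m`, and lifts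
`ξ_{d+l}` of a frame `Y_l` of `TN` (`exists_adaptedFrame`). If `ν(Y) = 1`, then `ℓ^φ` maps `(b₁ ∧ …
∧ b_r) ⊗ μ` to `μ(ξ)` times the pull-back of `(c₁ ∧ … ∧ c_p) ⊗ ν`. Differentiate along a section `a`
related to `b₀`. Brackets of related sections are related (`Related.bracket`), so the terms in `[a,
b_j]` become terms in `[b₀, c_j]`. The terms in `[ρ a, ξ_k]` arise twice, from the vertical sections
of `A` and from the Lie derivative of `μ`, with opposite signs
(`IsCanonicalIso.evalForm_derivative`). Finally `[ρ a, ξ_{d+l}]` lifts `[ρ b₀, Y_l]` and produces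
the Lie derivative of `ν`. What remains is the Leibniz rule for `Φ^!D^B` on `μ(ξ)` times a
pulled-back section (`AdaptedFrame.canonicalIso_derivative`). A connection on a line bundle is
determined by a local frame, it depends on `a` only through `a(m)`, and every `a(m)` extends to a
related section (`exists_related`): this gives (i).

For (ii), the square of a real line bundle always has a nowhere-vanishing section. With such
sections `t` and `t'` for `L^A` and `L^B`, `(ℓ ⊗ ℓ) t = f · (t' ∘ φ)` for a nowhere-vanishing `f`,
and equivariance says that the characteristic cocycles satisfy `α - Φ^*α' = d log |f|`
(`exists_comparison`). Hence `2 Mod Φ = 0` in a real vector space.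

The representations, `ℓ^φ` and the modular classes are defined by `Classical.epsilon`, so their
existence must be established. For representations this rests on `exists_connection`, which glues a
connection from values prescribed on sections containing local frames; flatness is then checked on
such frames. Uniqueness of these objects is not needed, since the arguments apply to any object with
the characterizing property. -/

theorem multilinear_eq_of_sub_mem {ι R U Y : Type*} [Fintype ι] [DecidableEq ι] [CommRing R]
    [AddCommGroup U] [Module R U] [AddCommGroup Y] [Module R Y]
    (f : MultilinearMap R (fun _ : ι ↦ U) Y) (S : Submodule R U)
    (h : ∀ w j, w j ∈ S → f w = 0) (w w' : ι → U) (hw : ∀ j, w j - w' j ∈ S) : f w = f w' := by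
  -- Entries of `w` are replaced by those of `w'` one at a time; each replacement changes `f` by its
  -- value on a family with an entry in `S`.
  have key : ∀ s : Finset ι, f (s.piecewise w' w) = f w := by
    intro s
    induction s using Finset.induction_on with
    | empty => simp
    | insert j s hj ih =>
      rw [← ih, Finset.piecewise_insert, ← sub_eq_zero]
      have h1 : s.piecewise w' w = Function.update (s.piecewise w' w) j (w j) := by
        rw [Function.eq_update_self_iff]
        simp [hj]
      conv_lhs => rw [h1]
      rw [Function.update_idem, ← f.map_update_sub]
      refine h _ j ?_
      rw [Function.update_self, ← neg_sub]
      exact S.neg_mem (hw j)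
  rw [← key Finset.univ, Finset.piecewise_univ]

/-- Two alternating maps of top degree are proportional. -/
theorem alternating_smul_comm [Module.Finite ℝ V] {r : ℕ} (hV : finrank ℝ V = r) (f : V [⋀^Fin r]→ₗ[ℝ] ℝ)
    (g : V [⋀^Fin r]→ₗ[ℝ] X) (e v : Fin r → V) : f e • g v = f v • g e := by
  by_cases he : LinearIndependent ℝ e
  · let b := basisOfLinearIndependentOfCardEqFinrank' e he (by simp [hV])
    have hb : ⇑b = e := coe_basisOfLinearIndependentOfCardEqFinrank' _ _ _
    have h : f e • g = (LinearMap.toSpanSingleton ℝ X (g e)).compAlternatingMap f := by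
      -- It suffices to test on injective families of basis vectors, and in top degree these are the
      -- permutations of `e`: both sides change by the same sign.
      refine b.ext_alternating fun s hs ↦ ?_
      let σ : Equiv.Perm (Fin r) := Equiv.ofBijective s (Finite.injective_iff_bijective.1 hs)
      have h1 : (fun i ↦ b (s i)) = e ∘ σ := by funext i; simp [hb, σ]
      rw [h1, AlternatingMap.smul_apply, LinearMap.compAlternatingMap_apply,
        LinearMap.toSpanSingleton_apply, AlternatingMap.map_perm, AlternatingMap.map_perm]
      rw [smul_comm, smul_assoc]
    have := congrArg (fun F ↦ F v) h
    simpa using this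
  · rw [f.map_linearDependent e he, g.map_linearDependent e he, zero_smul, smul_zero]

/-- Cramer's rule. -/
theorem sum_alternating_update [Module.Finite ℝ V] {r : ℕ} (hV : finrank ℝ V = r) (f : V [⋀^Fin r]→ₗ[ℝ] ℝ)
    (e : Fin r → V) (he : f e ≠ 0) (v : V) :
    v = ∑ j, (f (Function.update e j v) / f e) • e j := by
  have hli : LinearIndependent ℝ e := by
    by_contra h
    exact he (f.map_linearDependent e h)
  let b := basisOfLinearIndependentOfCardEqFinrank' e hli (by simp [hV])
  have hb : ⇑b = e := coe_basisOfLinearIndependentOfCardEqFinrank' _ _ _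
  have h : ∀ j, f (Function.update e j v) = b.repr v j * f e := by
    intro j
    conv_lhs => rw [← b.sum_repr v]
    rw [hb, f.map_update_sum, Finset.sum_eq_single j]
    · rw [f.map_update_smul, Function.update_eq_self, smul_eq_mul]
    · intro k _ hk
      rw [f.map_update_smul, f.map_update_self e hk.symm, smul_zero]
    · simp
  conv_lhs => rw [← b.sum_repr v]
  refine Finset.sum_congr rfl fun j _ ↦ ?_
  rw [h, mul_div_assoc, div_self he, mul_one, hb]

theorem linearIndependent_of_alternating_ne_zero {r : ℕ} (f : V [⋀^Fin r]→ₗ[ℝ] ℝ)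
    {e : Fin r → V} (he : f e ≠ 0) : LinearIndependent ℝ e := by
  by_contra h
  exact he (f.map_linearDependent e h)

theorem span_eq_top_of_alternating_ne_zero [Module.Finite ℝ V] {r : ℕ} (hV : finrank ℝ V = r)
    (f : V [⋀^Fin r]→ₗ[ℝ] ℝ) {e : Fin r → V} (he : f e ≠ 0) :
    Submodule.span ℝ (Set.range e) = ⊤ := by
  refine eq_top_iff.2 fun v _ ↦ ?_
  rw [sum_alternating_update hV f e he v]
  exact Submodule.sum_mem _ fun j _ ↦ Submodule.smul_mem _ _ (Submodule.subset_span ⟨j, rfl⟩)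

theorem exists_alternating_eq_one [Module.Finite ℝ V] {r : ℕ} (hV : finrank ℝ V = r) :
    ∃ (e : Fin r → V) (f : V [⋀^Fin r]→ₗ[ℝ] ℝ), f e = 1 :=
  ⟨finBasisOfFinrankEq ℝ V hV, (finBasisOfFinrankEq ℝ V hV).det, Basis.det_self _⟩

/-- The linear form on `∧^r V` defined by an alternating form. -/
def wedgeLift {r : ℕ} (f : V [⋀^Fin r]→ₗ[ℝ] X) : ⋀[ℝ]^r V →ₗ[ℝ] X :=
  exteriorPower.alternatingMapLinearEquiv f

theorem wedgeLift_ιMulti {r : ℕ} (f : V [⋀^Fin r]→ₗ[ℝ] X) (v : Fin r → V) :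
    wedgeLift f (exteriorPower.ιMulti ℝ r v) = f v :=
  exteriorPower.alternatingMapLinearEquiv_apply_ιMulti f v

theorem wedge_eq_smul [Module.Finite ℝ V] {r : ℕ} (hV : finrank ℝ V = r) (f : V [⋀^Fin r]→ₗ[ℝ] ℝ) {e : Fin r → V}
    (he : f e = 1) (Z : ⋀[ℝ]^r V) : Z = wedgeLift f Z • exteriorPower.ιMulti ℝ r e := by
  have h : (LinearMap.id : ⋀[ℝ]^r V →ₗ[ℝ] ⋀[ℝ]^r V) =
      (LinearMap.toSpanSingleton ℝ _ (exteriorPower.ιMulti ℝ r e)).comp (wedgeLift f) := by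
    refine exteriorPower.linearMap_ext ?_
    ext1 v
    have := alternating_smul_comm hV f (exteriorPower.ιMulti ℝ r) e v
    rw [he, one_smul] at this
    simpa [wedgeLift_ιMulti] using this
  exact congrArg (fun F ↦ F Z) h

theorem evalForm_tmul (X : Type*) [AddCommGroup X] [Module ℝ X] {Q : Type*} [AddCommGroup Q]
    [Module ℝ Q] {q : ℕ} (Y : Fin q → Q) (x : X) (ν : Q [⋀^Fin q]→ₗ[ℝ] ℝ) :
    evalForm X Y (x ⊗ₜ[ℝ] ν) = ν Y • x := by
  simp [evalForm]

/-- Every top-degree form is a multiple of `ν`, with coefficient its value at `Y`, so the second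
tensor factor can always be normalized to `ν`. -/
theorem eq_evalForm_tmul [Module.Finite ℝ V] {q : ℕ} (hV : finrank ℝ V = q) {ν : V [⋀^Fin q]→ₗ[ℝ] ℝ}
    {Y : Fin q → V} (hY : ν Y = 1) (z : X ⊗[ℝ] (V [⋀^Fin q]→ₗ[ℝ] ℝ)) :
    z = evalForm X Y z ⊗ₜ[ℝ] ν := by
  induction z with
  | zero => simp
  | tmul x η =>
    rw [evalForm_tmul, TensorProduct.smul_tmul]
    congr 1
    ext v
    have := alternating_smul_comm hV ν η Y v
    rw [hY, one_smul] at this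
    rw [this, AlternatingMap.smul_apply, smul_eq_mul, smul_eq_mul, mul_comm]
  | add z z' hz hz' =>
    conv_lhs => rw [hz, hz']
    rw [map_add, TensorProduct.add_tmul]

/-- Allows equalities in `X ⊗ ∧^q Q^*` to be checked on a single family of vectors. -/
theorem evalForm_injective [Module.Finite ℝ V] {q : ℕ} (hV : finrank ℝ V = q) {ν : V [⋀^Fin q]→ₗ[ℝ] ℝ}
    {Y : Fin q → V} (hY : ν Y = 1) : Function.Injective (evalForm X Y (q := q)) := by
  intro z z' h
  rw [eq_evalForm_tmul hV hY z, eq_evalForm_tmul hV hY z', h]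

end TopForms

/-! ### Linear algebra of the canonical isomorphism of a short exact sequence -/

section CanonicalLinear

variable {V W T Q U : Type*} [AddCommGroup V] [Module ℝ V] [AddCommGroup W] [Module ℝ W]
  [AddCommGroup T] [Module ℝ T] [AddCommGroup Q] [Module ℝ Q] [AddCommGroup U] [Module ℝ U]

/-- The product is linear in the `j`-th vector of `w`, and it has a repeated entry when that vector
is one of the `v k`. -/
theorem wedge_eq_zero_of_mem_span {r q : ℕ} (v : Fin r → U) (w : Fin q → U) (j : Fin q)
    (hj : w j ∈ Submodule.span ℝ (Set.range v)) :
    ExteriorAlgebra.ιMulti ℝ r v * ExteriorAlgebra.ιMulti ℝ q w = 0 := by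
  let L : U →ₗ[ℝ] ExteriorAlgebra ℝ U :=
    (LinearMap.mulLeft ℝ (ExteriorAlgebra.ιMulti ℝ r v)).comp
      ((ExteriorAlgebra.ιMulti ℝ q).toMultilinearMap.toLinearMap w j)
  have hL : Submodule.span ℝ (Set.range v) ≤ LinearMap.ker L := by
    rw [Submodule.span_le]
    rintro _ ⟨k, rfl⟩
    change ExteriorAlgebra.ιMulti ℝ r v *
      ExteriorAlgebra.ιMulti ℝ q (Function.update w j (v k)) = 0
    rw [ExteriorAlgebra.ιMulti_mul_ιMulti]
    refine AlternatingMap.map_eq_zero_of_eq _ _ (i := Fin.castAdd q k) (j := Fin.natAdd r j)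
      (by simp) ?_
    intro h
    have := congrArg Fin.val h
    simp at this
    omega
  have := hL hj
  change ExteriorAlgebra.ιMulti ℝ r v *
      ExteriorAlgebra.ιMulti ℝ q (Function.update w j (w j)) = 0 at this
  rwa [Function.update_eq_self] at this

theorem wedge_congr_of_sub_mem_span {r q : ℕ} (v : Fin r → U) (w w' : Fin q → U)
    (h : ∀ j, w j - w' j ∈ Submodule.span ℝ (Set.range v)) :
    ExteriorAlgebra.ιMulti ℝ r v * ExteriorAlgebra.ιMulti ℝ q w =
      ExteriorAlgebra.ιMulti ℝ r v * ExteriorAlgebra.ιMulti ℝ q w' := by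
  refine multilinear_eq_of_sub_mem
    ((LinearMap.mulLeft ℝ (ExteriorAlgebra.ιMulti ℝ r v)).compMultilinearMap
      (ExteriorAlgebra.ιMulti ℝ q).toMultilinearMap) (Submodule.span ℝ (Set.range v)) ?_ w w' h
  exact fun w j hj ↦ wedge_eq_zero_of_mem_span v w j hj

theorem wedge_eq_zero_of_mem_span' {r q : ℕ} (v : Fin r → U) (w : Fin q → U) (j : Fin q)
    (hj : w j ∈ Submodule.span ℝ (Set.range v)) :
    ExteriorAlgebra.ιMulti ℝ q w * ExteriorAlgebra.ιMulti ℝ r v = 0 := by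
  let L : U →ₗ[ℝ] ExteriorAlgebra ℝ U :=
    (LinearMap.mulRight ℝ (ExteriorAlgebra.ιMulti ℝ r v)).comp
      ((ExteriorAlgebra.ιMulti ℝ q).toMultilinearMap.toLinearMap w j)
  have hL : Submodule.span ℝ (Set.range v) ≤ LinearMap.ker L := by
    rw [Submodule.span_le]
    rintro _ ⟨k, rfl⟩
    change ExteriorAlgebra.ιMulti ℝ q (Function.update w j (v k)) *
      ExteriorAlgebra.ιMulti ℝ r v = 0
    rw [ExteriorAlgebra.ιMulti_mul_ιMulti]
    refine AlternatingMap.map_eq_zero_of_eq _ _ (i := Fin.castAdd r j) (j := Fin.natAdd q k)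
      (by simp) ?_
    intro h
    have := congrArg Fin.val h
    simp at this
    omega
  have := hL hj
  change ExteriorAlgebra.ιMulti ℝ q (Function.update w j (w j)) *
    ExteriorAlgebra.ιMulti ℝ r v = 0 at this
  rwa [Function.update_eq_self] at this

theorem wedge_congr_of_sub_mem_span' {r q : ℕ} (v : Fin r → U) (w w' : Fin q → U)
    (h : ∀ j, w j - w' j ∈ Submodule.span ℝ (Set.range v)) :
    ExteriorAlgebra.ιMulti ℝ q w * ExteriorAlgebra.ιMulti ℝ r v =
      ExteriorAlgebra.ιMulti ℝ q w' * ExteriorAlgebra.ιMulti ℝ r v := by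
  refine multilinear_eq_of_sub_mem
    ((LinearMap.mulRight ℝ (ExteriorAlgebra.ιMulti ℝ r v)).compMultilinearMap
      (ExteriorAlgebra.ιMulti ℝ q).toMultilinearMap) (Submodule.span ℝ (Set.range v)) ?_ w w' h
  exact fun w j hj ↦ wedge_eq_zero_of_mem_span' v w j hj

/-- The determinant of the basis `u` factors through the exterior power and equals `1` on `u`. -/
theorem ιMulti_ne_zero {N : ℕ} [Module.Finite ℝ U] (hU : finrank ℝ U = N) {u : Fin N → U}
    (hu : LinearIndependent ℝ u) : ExteriorAlgebra.ιMulti ℝ N u ≠ 0 := by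
  let b := basisOfLinearIndependentOfCardEqFinrank' u hu (by simp [hU])
  have hb : ⇑b = u := coe_basisOfLinearIndependentOfCardEqFinrank' _ _ _
  intro h
  have h1 : exteriorPower.ιMulti ℝ N u = 0 := Subtype.ext h
  have h2 := wedgeLift_ιMulti b.det u
  rw [h1, map_zero, ← hb, Basis.det_self] at h2
  exact zero_ne_one h2

/-- Adapted bases of a short exact sequence `0 → V → U → Q → 0`. -/
theorem exact_wedge [Module.Finite ℝ U] [Module.Finite ℝ V] [Module.Finite ℝ Q] {r q : ℕ}
    (hV : finrank ℝ V = r) (hQ : finrank ℝ Q = q) {i : V →ₗ[ℝ] U} {κ : U →ₗ[ℝ] Q}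
    (hi : Function.Injective i) (hκ : Function.Surjective κ)
    (hex : LinearMap.ker κ = LinearMap.range i) {e : Fin r → V} {f : V [⋀^Fin r]→ₗ[ℝ] ℝ}
    (he : f e = 1) {Y : Fin q → Q} {ν : Q [⋀^Fin q]→ₗ[ℝ] ℝ} (hY : ν Y = 1) {w₀ : Fin q → U}
    (hw₀ : ∀ j, κ (w₀ j) = Y j) :
    ExteriorAlgebra.map i (exteriorPower.ιMulti ℝ r e).1 * ExteriorAlgebra.ιMulti ℝ q w₀ ≠ 0 ∧
    ∀ (Z : ⋀[ℝ]^r V) (w : Fin q → U),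
      ExteriorAlgebra.map i Z.1 * ExteriorAlgebra.ιMulti ℝ q w =
        (wedgeLift f Z * ν (fun j ↦ κ (w j))) •
          (ExteriorAlgebra.map i (exteriorPower.ιMulti ℝ r e).1 *
            ExteriorAlgebra.ιMulti ℝ q w₀) := by
  have heV := span_eq_top_of_alternating_ne_zero hV f (e := e) (by simp [he])
  have hspan : Submodule.span ℝ (Set.range (i ∘ e)) = LinearMap.range i := by
    rw [Set.range_comp, ← Submodule.map_span, heV, Submodule.map_top]
  have hlie : LinearIndependent ℝ e := linearIndependent_of_alternating_ne_zero f (by simp [he])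
  have hliY : LinearIndependent ℝ Y := linearIndependent_of_alternating_ne_zero ν (by simp [hY])
  constructor
  · rw [exteriorPower.ιMulti_apply_coe, ExteriorAlgebra.map_apply_ιMulti,
      ExteriorAlgebra.ιMulti_mul_ιMulti]
    refine ιMulti_ne_zero ?_ ?_
    · rw [← LinearMap.finrank_range_add_finrank_ker κ, hex, LinearMap.finrank_range_of_inj hi,
        LinearMap.range_eq_top.2 hκ, finrank_top, hV, hQ, add_comm]
    · rw [Fintype.linearIndependent_iff] at hlie hliY ⊢
      intro g hg
      rw [Fin.sum_univ_add] at hg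
      simp only [Fin.append_left, Fin.append_right, Function.comp_apply] at hg
      have h1 : ∀ v, κ (i v) = 0 := fun v ↦ by
        have : i v ∈ LinearMap.ker κ := hex ▸ ⟨v, rfl⟩
        exact this
      -- Applying `κ` kills the part coming from `V` and leaves a relation among the `Y j`; once
      -- these coefficients vanish, injectivity of `i` reduces the rest to a relation among the `e
      -- k`.
      have h2 := congrArg κ hg
      simp only [map_add, map_sum, map_smul, h1, hw₀, smul_zero, Finset.sum_const_zero, zero_add,
        map_zero] at h2
      have h3 := hliY _ h2
      simp only [h3, zero_smul, Finset.sum_const_zero, add_zero] at hg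
      have h4 := hlie (fun k ↦ g (Fin.castAdd q k)) (hi (by simpa using hg))
      intro k
      refine Fin.addCases h4 h3 k
  · intro Z w
    conv_lhs => rw [wedge_eq_smul hV f he Z]
    rw [Submodule.coe_smul, map_smul, smul_mul_assoc, mul_smul]
    congr 1
    rw [exteriorPower.ιMulti_apply_coe, ExteriorAlgebra.map_apply_ιMulti]
    let b := basisOfLinearIndependentOfCardEqFinrank' Y hliY (by simp [hQ])
    have hb : ⇑b = Y := coe_basisOfLinearIndependentOfCardEqFinrank' _ _ _
    -- A linear section of `κ`. Since `w j` and `σ (κ (w j))` differ by an element of the image of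
    -- `i`, they are interchangeable after wedging with a top vector of that image; then everything
    -- depends on `κ (w j)` only.
    let σ : Q →ₗ[ℝ] U := b.constr ℝ w₀
    have hσ : ∀ j, σ (Y j) = w₀ j := fun j ↦ by rw [← hb]; exact b.constr_basis ℝ w₀ j
    have hκσ : ∀ y, κ (σ y) = y := by
      have : κ.comp σ = LinearMap.id := b.ext fun j ↦ by
        rw [LinearMap.comp_apply, hb, hσ, hw₀, LinearMap.id_apply]
      exact fun y ↦ congrArg (fun F ↦ F y) this
    rw [wedge_congr_of_sub_mem_span (i ∘ e) w (fun j ↦ σ (κ (w j)))]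
    · have := alternating_smul_comm hQ ν
        (((LinearMap.mulLeft ℝ (ExteriorAlgebra.ιMulti ℝ r (i ∘ e))).compAlternatingMap
          (ExteriorAlgebra.ιMulti ℝ q)).compLinearMap σ) Y (fun j ↦ κ (w j))
      rw [hY, one_smul] at this
      have h5 : σ ∘ Y = w₀ := funext hσ
      rw [← h5]
      exact this
    · intro j
      rw [hspan, ← hex, LinearMap.mem_ker, map_sub, hκσ, sub_self]

variable {r p n q : ℕ} {i : V →ₗ[ℝ] W × T} {κ : W × T →ₗ[ℝ] Q}

/-- The data which determine a canonical isomorphism in adapted bases. -/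
theorem exists_adapted [Module.Finite ℝ V] [Module.Finite ℝ W] [Module.Finite ℝ T]
    [Module.Finite ℝ Q] (hV : finrank ℝ V = r) (hW : finrank ℝ W = p) (hT : finrank ℝ T = n)
    (hQ : finrank ℝ Q = q)
    (hi : Function.Injective i) (hκ : Function.Surjective κ)
    (hex : LinearMap.ker κ = LinearMap.range i)
    {e : Fin r → V} {f : V [⋀^Fin r]→ₗ[ℝ] ℝ} (he : f e = 1)
    {c : Fin p → W} {g : W [⋀^Fin p]→ₗ[ℝ] ℝ} (hc : g c = 1)
    {ξ : Fin n → T} {τ : T [⋀^Fin n]→ₗ[ℝ] ℝ} (hξ : τ ξ = 1)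
    {Y : Fin q → Q} {ν : Q [⋀^Fin q]→ₗ[ℝ] ℝ} (hY : ν Y = 1) :
    ∃ (k : ℝ) (w₀ : Fin q → W × T), k ≠ 0 ∧ (∀ j, κ (w₀ j) = Y j) ∧
      ExteriorAlgebra.map i (exteriorPower.ιMulti ℝ r e).1 * ExteriorAlgebra.ιMulti ℝ q w₀ =
        k • (ExteriorAlgebra.map (LinearMap.inl ℝ W T) (exteriorPower.ιMulti ℝ p c).1 *
          ExteriorAlgebra.ιMulti ℝ n (fun j ↦ LinearMap.inr ℝ W T (ξ j))) ∧
      ∀ (X : ⋀[ℝ]^r V) (w : Fin q → W × T) (Z : ⋀[ℝ]^p W) (ξ' : Fin n → T),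
        ExteriorAlgebra.map i X.1 * ExteriorAlgebra.ιMulti ℝ q w =
          ExteriorAlgebra.map (LinearMap.inl ℝ W T) Z.1 *
            ExteriorAlgebra.ιMulti ℝ n (fun j ↦ LinearMap.inr ℝ W T (ξ' j)) →
        k * (wedgeLift f X * ν (fun j ↦ κ (w j))) = wedgeLift g Z * τ ξ' := by
  choose w₀ hw₀ using fun j ↦ hκ (Y j)
  obtain ⟨h1, h2⟩ := exact_wedge hV hQ hi hκ hex he hY hw₀
  -- The same computation for the split sequence `0 → W → W × T → T → 0`. The scalar `k` below is
  -- the ratio of the two reference generators of the top exterior power of `W × T`.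
  obtain ⟨h3, h4⟩ := exact_wedge (U := W × T) (i := LinearMap.inl ℝ W T)
    (κ := LinearMap.snd ℝ W T) hW hT
    LinearMap.inl_injective LinearMap.snd_surjective (LinearMap.range_inl ℝ W T).symm hc hξ
    (w₀ := fun j ↦ LinearMap.inr ℝ W T (ξ j)) (fun _ ↦ rfl)
  have hN : r + q = p + n := by
    rw [← hW, ← hT, ← finrank_prod, ← LinearMap.finrank_range_add_finrank_ker κ, hex,
      LinearMap.finrank_range_of_inj hi, LinearMap.range_eq_top.2 hκ, finrank_top, hV, hQ, add_comm]
  obtain ⟨k, hk⟩ : ∃ k : ℝ,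
      ExteriorAlgebra.map i (exteriorPower.ιMulti ℝ r e).1 * ExteriorAlgebra.ιMulti ℝ q w₀ =
        k • (ExteriorAlgebra.map (LinearMap.inl ℝ W T) (exteriorPower.ιMulti ℝ p c).1 *
          ExteriorAlgebra.ιMulti ℝ n (fun j ↦ LinearMap.inr ℝ W T (ξ j))) := by
    simp only [exteriorPower.ιMulti_apply_coe, ExteriorAlgebra.map_apply_ιMulti,
      ExteriorAlgebra.ιMulti_mul_ιMulti] at h3 ⊢
    generalize Fin.append (⇑i ∘ e) w₀ = u
    generalize Fin.append (⇑(LinearMap.inl ℝ W T) ∘ c) (fun j ↦ LinearMap.inr ℝ W T (ξ j)) = u'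
      at h3 ⊢
    -- The family is made a variable so that its index type `Fin (r + q)` can be rewritten as `Fin
    -- (p + n)`.
    revert u
    rw [hN]
    intro u
    have hU : finrank ℝ (W × T) = p + n := by rw [finrank_prod, hW, hT]
    obtain ⟨e', f', hf'⟩ := exists_alternating_eq_one hU
    have h5 := alternating_smul_comm hU f' (ExteriorAlgebra.ιMulti ℝ (p + n)) e' u
    have h6 := alternating_smul_comm hU f' (ExteriorAlgebra.ιMulti ℝ (p + n)) e' u'
    rw [hf', one_smul] at h5 h6
    have h7 : f' u' ≠ 0 := by
      intro h
      rw [h6, h, zero_smul] at h3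
      exact h3 rfl
    refine ⟨f' u / f' u', ?_⟩
    rw [h5, h6, smul_smul, div_mul_cancel₀ _ h7]
  refine ⟨k, w₀, ?_, hw₀, hk, ?_⟩
  · rintro rfl
    rw [zero_smul] at hk
    exact h1 hk
  · intro X w Z ξ' h
    rw [h2, h4, hk, smul_smul] at h
    have := smul_left_injective ℝ h3 h
    simp only [LinearMap.snd_apply, LinearMap.inr_apply] at this
    rw [mul_comm k]
    exact this

/-- Source and target are lines, so `ℓ` is fixed by sending one generator to `k` times another. The
requirement for arbitrary `X`, `w`, `Z`, `ξ` then amounts to the scalar identity of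
`exists_adapted`, multiplied by `μ ξ`. -/
theorem exists_isCanonicalIso [Module.Finite ℝ V] [Module.Finite ℝ W] [Module.Finite ℝ T]
    [Module.Finite ℝ Q] (hV : finrank ℝ V = r) (hW : finrank ℝ W = p) (hT : finrank ℝ T = n)
    (hQ : finrank ℝ Q = q)
    (hi : Function.Injective i) (hκ : Function.Surjective κ)
    (hex : LinearMap.ker κ = LinearMap.range i) :
    ∃ ℓ : (⋀[ℝ]^r V) ⊗[ℝ] (T [⋀^Fin n]→ₗ[ℝ] ℝ) →ₗ[ℝ] (⋀[ℝ]^p W) ⊗[ℝ] (Q [⋀^Fin q]→ₗ[ℝ] ℝ),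
      IsCanonicalIso i κ ℓ := by
  obtain ⟨e, f, he⟩ := exists_alternating_eq_one hV
  obtain ⟨c, g, hc⟩ := exists_alternating_eq_one hW
  obtain ⟨ξ, τ, hξ⟩ := exists_alternating_eq_one hT
  obtain ⟨Y, ν, hY⟩ := exists_alternating_eq_one hQ
  obtain ⟨k, w₀, -, -, -, hk⟩ := exists_adapted hV hW hT hQ hi hκ hex he hc hξ hY
  let ℓ : (⋀[ℝ]^r V) ⊗[ℝ] (T [⋀^Fin n]→ₗ[ℝ] ℝ) →ₗ[ℝ] (⋀[ℝ]^p W) ⊗[ℝ] (Q [⋀^Fin q]→ₗ[ℝ] ℝ) :=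
    k • (LinearMap.toSpanSingleton ℝ _ (exteriorPower.ιMulti ℝ p c ⊗ₜ[ℝ] ν)).comp
      ((wedgeLift f).comp (evalForm _ ξ))
  refine ⟨ℓ, fun X μ w Z ξ' h ↦ ?_⟩
  have h1 : ℓ (X ⊗ₜ[ℝ] μ) =
      (k * (μ ξ * wedgeLift f X)) • (exteriorPower.ιMulti ℝ p c ⊗ₜ[ℝ] ν) := by
    simp [ℓ, evalForm_tmul, smul_smul]
  have h2 := hk X w Z ξ' h
  have h3 := alternating_smul_comm hT τ μ ξ ξ'
  rw [hξ, one_smul, smul_eq_mul] at h3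
  conv_rhs => rw [wedge_eq_smul hW g hc Z]
  rw [h1, map_smul, evalForm_tmul, smul_smul, smul_smul, h3]
  congr 1
  linear_combination μ ξ * h2

/-- The characterizing property alone forces a generator to go to `k` times a generator, with `k ≠
0`; nothing about the construction of `ℓ` is used. -/
theorem IsCanonicalIso.bijective [Module.Finite ℝ V] [Module.Finite ℝ W] [Module.Finite ℝ T]
    [Module.Finite ℝ Q] (hV : finrank ℝ V = r) (hW : finrank ℝ W = p) (hT : finrank ℝ T = n)
    (hQ : finrank ℝ Q = q)
    (hi : Function.Injective i) (hκ : Function.Surjective κ)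
    (hex : LinearMap.ker κ = LinearMap.range i)
    {ℓ : (⋀[ℝ]^r V) ⊗[ℝ] (T [⋀^Fin n]→ₗ[ℝ] ℝ) →ₗ[ℝ] (⋀[ℝ]^p W) ⊗[ℝ] (Q [⋀^Fin q]→ₗ[ℝ] ℝ)}
    (hℓ : IsCanonicalIso i κ ℓ) : Function.Bijective ℓ := by
  obtain ⟨e, f, he⟩ := exists_alternating_eq_one hV
  obtain ⟨c, g, hc⟩ := exists_alternating_eq_one hW
  obtain ⟨ξ, τ, hξ⟩ := exists_alternating_eq_one hT
  obtain ⟨Y, ν, hY⟩ := exists_alternating_eq_one hQ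
  obtain ⟨k, w₀, hk0, hw₀, hk, -⟩ := exists_adapted hV hW hT hQ hi hκ hex he hc hξ hY
  have h1 := hℓ (exteriorPower.ιMulti ℝ r e) τ w₀ (k • exteriorPower.ιMulti ℝ p c) ξ (by
    rw [hk, Submodule.coe_smul, map_smul, smul_mul_assoc])
  rw [hξ, one_smul, funext hw₀] at h1
  have h2 : ℓ (exteriorPower.ιMulti ℝ r e ⊗ₜ[ℝ] τ) = k • (exteriorPower.ιMulti ℝ p c ⊗ₜ[ℝ] ν) := by
    rw [eq_evalForm_tmul hQ hY (ℓ _), h1, TensorProduct.smul_tmul']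
  have h3 : ∀ z : (⋀[ℝ]^r V) ⊗[ℝ] (T [⋀^Fin n]→ₗ[ℝ] ℝ),
      z = wedgeLift f (evalForm _ ξ z) • (exteriorPower.ιMulti ℝ r e ⊗ₜ[ℝ] τ) := fun z ↦ by
    conv_lhs => rw [eq_evalForm_tmul hT hξ z, wedge_eq_smul hV f he (evalForm _ ξ z)]
    rw [TensorProduct.smul_tmul']
  have h4 : ∀ z : (⋀[ℝ]^p W) ⊗[ℝ] (Q [⋀^Fin q]→ₗ[ℝ] ℝ),
      z = wedgeLift g (evalForm _ Y z) • (exteriorPower.ιMulti ℝ p c ⊗ₜ[ℝ] ν) := fun z ↦ by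
    conv_lhs => rw [eq_evalForm_tmul hQ hY z, wedge_eq_smul hW g hc (evalForm _ Y z)]
    rw [TensorProduct.smul_tmul']
  constructor
  · rw [injective_iff_map_eq_zero]
    intro z hz
    rw [h3 z] at hz ⊢
    rw [map_smul, h2, smul_smul] at hz
    have h5 := congrArg (fun z ↦ wedgeLift g (evalForm _ Y z)) hz
    simp only [map_smul, evalForm_tmul, hY, one_smul, wedgeLift_ιMulti, hc, map_zero, smul_eq_mul,
      mul_one] at h5
    rw [(mul_eq_zero.1 h5).resolve_right hk0, zero_smul]
  · intro z
    refine ⟨(wedgeLift g (evalForm _ Y z) / k) • (exteriorPower.ιMulti ℝ r e ⊗ₜ[ℝ] τ), ?_⟩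
    rw [map_smul, h2, smul_smul, div_mul_cancel₀ _ hk0, ← h4]

/-- The wedge products which compute the canonical isomorphism in a basis `b` of `V` adapted to
the projection onto `W`. -/
theorem wedge_adapted {d : ℕ} [Module.Finite ℝ T] (hT : finrank ℝ T = n) (hr : p + d = r)
    (hn : d + q = n) {b : Fin r → V} {c : Fin p → W} {ξ : Fin n → T}
    (hb₁ : ∀ j, (i (b (Fin.cast hr (Fin.castAdd d j)))).1 = c j)
    (hb₂ : ∀ k, i (b (Fin.cast hr (Fin.natAdd p k))) = (0, ξ (Fin.cast hn (Fin.castAdd q k)))) :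
    ExteriorAlgebra.map i (exteriorPower.ιMulti ℝ r b).1 *
        ExteriorAlgebra.ιMulti ℝ q (fun l ↦ ((0 : W), ξ (Fin.cast hn (Fin.natAdd d l)))) =
      ExteriorAlgebra.map (LinearMap.inl ℝ W T) (exteriorPower.ιMulti ℝ p c).1 *
        ExteriorAlgebra.ιMulti ℝ n (fun j ↦ LinearMap.inr ℝ W T (ξ j)) := by
  subst hr hn
  simp only [Fin.cast_refl, id_eq] at hb₁ hb₂ ⊢
  simp only [exteriorPower.ιMulti_apply_coe, ExteriorAlgebra.map_apply_ιMulti]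
  have h1 : ⇑i ∘ b = Fin.append (fun j ↦ i (b (Fin.castAdd d j)))
      (fun k ↦ LinearMap.inr ℝ W T (ξ (Fin.castAdd q k))) := by
    funext j
    refine Fin.addCases (fun j ↦ ?_) (fun k ↦ ?_) j
    · simp
    · simp [hb₂]
  have h2 : (fun j ↦ LinearMap.inr ℝ W T (ξ j)) =
      Fin.append (fun k ↦ LinearMap.inr ℝ W T (ξ (Fin.castAdd q k)))
        (fun l ↦ ((0 : W), ξ (Fin.natAdd d l))) := by
    funext j
    refine Fin.addCases (fun j ↦ ?_) (fun k ↦ ?_) j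
    · simp
    · simp
  rw [h1, ← ExteriorAlgebra.ιMulti_mul_ιMulti, mul_assoc, ExteriorAlgebra.ιMulti_mul_ιMulti, ← h2]
  -- If `ξ` is a basis, then after wedging with all of `T` only the `W`-components of the first `p`
  -- vectors matter. Otherwise both sides vanish. The degenerate case is allowed because `ξ` is
  -- later modified in one entry.
  by_cases hξ : LinearIndependent ℝ ξ
  · refine wedge_congr_of_sub_mem_span' _ _ _ fun j ↦ ?_
    have h3 : Submodule.span ℝ (Set.range fun j ↦ LinearMap.inr ℝ W T (ξ j)) =
        LinearMap.range (LinearMap.inr ℝ W T) := by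
      have : (fun j ↦ LinearMap.inr ℝ W T (ξ j)) = LinearMap.inr ℝ W T ∘ ξ := rfl
      rw [this, Set.range_comp, ← Submodule.map_span,
        hξ.span_eq_top_of_card_eq_finrank' (by simp [hT]), Submodule.map_top]
    rw [h3, LinearMap.range_inr, LinearMap.mem_ker]
    simp [hb₁]
  · have h4 : ExteriorAlgebra.ιMulti ℝ (d + q) (fun j ↦ LinearMap.inr ℝ W T (ξ j)) = 0 := by
      have := ((ExteriorAlgebra.ιMulti ℝ (d + q)).compLinearMap
        (LinearMap.inr ℝ W T)).map_linearDependent ξ hξ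
      exact this
    rw [h4, mul_zero, mul_zero]

/-- The value of the canonical isomorphism on a derivative of `(b₁ ∧ … ∧ b_r) ⊗ μ`, in adapted
bases: the contributions of the kernel of the projection onto `W` cancel. -/
theorem IsCanonicalIso.evalForm_derivative {d : ℕ} [Module.Finite ℝ T] (hT : finrank ℝ T = n)
    (hr : p + d = r) (hn : d + q = n)
    {ℓ : (⋀[ℝ]^r V) ⊗[ℝ] (T [⋀^Fin n]→ₗ[ℝ] ℝ) →ₗ[ℝ] (⋀[ℝ]^p W) ⊗[ℝ] (Q [⋀^Fin q]→ₗ[ℝ] ℝ)}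
    (hℓ : IsCanonicalIso i κ ℓ) {b b' : Fin r → V} {c c' : Fin p → W} {ξ ξ' : Fin n → T}
    (hb₁ : ∀ j, (i (b (Fin.cast hr (Fin.castAdd d j)))).1 = c j)
    (hb₂ : ∀ k, i (b (Fin.cast hr (Fin.natAdd p k))) = (0, ξ (Fin.cast hn (Fin.castAdd q k))))
    (hb'₁ : ∀ j, (i (b' (Fin.cast hr (Fin.castAdd d j)))).1 = c' j)
    (hb'₂ : ∀ k, i (b' (Fin.cast hr (Fin.natAdd p k))) = (0, ξ' (Fin.cast hn (Fin.castAdd q k))))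
    {μ μ' : T [⋀^Fin n]→ₗ[ℝ] ℝ} {δ : ℝ}
    (hμ' : μ' ξ = δ - ∑ j, μ (Function.update ξ j (ξ' j))) :
    evalForm (⋀[ℝ]^p W) (fun l ↦ κ ((0 : W), ξ (Fin.cast hn (Fin.natAdd d l))))
      (ℓ (∑ j, exteriorPower.ιMulti ℝ r (Function.update b j (b' j)) ⊗ₜ[ℝ] μ +
        exteriorPower.ιMulti ℝ r b ⊗ₜ[ℝ] μ')) =
      μ ξ • ∑ j, exteriorPower.ιMulti ℝ p (Function.update c j (c' j)) +
        (δ - ∑ l, μ (Function.update ξ (Fin.cast hn (Fin.natAdd d l))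
          (ξ' (Fin.cast hn (Fin.natAdd d l))))) • exteriorPower.ιMulti ℝ p c := by
  subst hr hn
  simp only [Fin.cast_refl, id_eq] at hb₁ hb₂ hb'₁ hb'₂ ⊢
  -- Changing one of the first `p` vectors keeps the data adapted, with `c` changed in the same
  -- entry.
  have h1 : ∀ j, evalForm (⋀[ℝ]^p W) (fun l ↦ κ ((0 : W), ξ (Fin.natAdd d l)))
      (ℓ (exteriorPower.ιMulti ℝ (p + d) (Function.update b (Fin.castAdd d j)
        (b' (Fin.castAdd d j))) ⊗ₜ[ℝ] μ)) =
      μ ξ • exteriorPower.ιMulti ℝ p (Function.update c j (c' j)) := by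
    intro j
    refine hℓ _ μ _ _ ξ (wedge_adapted (d := d) hT rfl rfl ?_ ?_)
    · intro j'
      by_cases h : j' = j
      · subst h; simp [hb'₁]
      · have h' : Fin.castAdd d j' ≠ Fin.castAdd d j := fun e ↦ h (Fin.castAdd_injective _ _ e)
        simp [h, h', hb₁]
    · intro k
      have h' : Fin.natAdd p k ≠ Fin.castAdd d j := by
        intro e
        have := congrArg Fin.val e
        simp at this
        omega
      simp [h', hb₂]
  -- Changing a vertical vector keeps the data adapted, with `ξ` changed among its first `d`
  -- entries; the `w` vectors, which are the last `q` entries of `ξ`, are untouched.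
  have h2 : ∀ k, evalForm (⋀[ℝ]^p W) (fun l ↦ κ ((0 : W), ξ (Fin.natAdd d l)))
      (ℓ (exteriorPower.ιMulti ℝ (p + d) (Function.update b (Fin.natAdd p k)
        (b' (Fin.natAdd p k))) ⊗ₜ[ℝ] μ)) =
      μ (Function.update ξ (Fin.castAdd q k) (ξ' (Fin.castAdd q k))) •
        exteriorPower.ιMulti ℝ p c := by
    intro k
    have h3 : (fun l ↦ ((0 : W), ξ (Fin.natAdd d l))) = fun l ↦ ((0 : W),
        Function.update ξ (Fin.castAdd q k) (ξ' (Fin.castAdd q k)) (Fin.natAdd d l)) := by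
      funext l
      have h' : Fin.natAdd d l ≠ Fin.castAdd q k := by
        intro e
        have := congrArg Fin.val e
        simp at this
        omega
      simp [h']
    have h4 := hℓ (exteriorPower.ιMulti ℝ (p + d) (Function.update b (Fin.natAdd p k)
        (b' (Fin.natAdd p k)))) μ _ (exteriorPower.ιMulti ℝ p c)
        (Function.update ξ (Fin.castAdd q k) (ξ' (Fin.castAdd q k)))
        (wedge_adapted (d := d) hT rfl rfl ?_ ?_)
    · rw [← h4]
      congr 1
      exact congrArg (fun w : Fin q → W × T ↦ evalForm (⋀[ℝ]^p W) fun l ↦ κ (w l)) h3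
    · intro j
      have h' : Fin.castAdd d j ≠ Fin.natAdd p k := by
        intro e
        have := congrArg Fin.val e
        simp at this
        omega
      simp [h', hb₁]
    · intro k'
      by_cases h : k' = k
      · subst h; simp [hb'₂]
      · have h' : Fin.natAdd p k' ≠ Fin.natAdd p k := fun e ↦ h (Fin.natAdd_injective _ _ e)
        have h'' : Fin.castAdd q k' ≠ Fin.castAdd q k := fun e ↦ h (Fin.castAdd_injective _ _ e)
        simp [h', h'', hb₂]
  have h5 : evalForm (⋀[ℝ]^p W) (fun l ↦ κ ((0 : W), ξ (Fin.natAdd d l)))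
      (ℓ (exteriorPower.ιMulti ℝ (p + d) b ⊗ₜ[ℝ] μ')) = μ' ξ • exteriorPower.ιMulti ℝ p c :=
    hℓ _ μ' _ _ ξ (wedge_adapted (d := d) hT rfl rfl hb₁ hb₂)
  -- Both sums are split into their two blocks: the vertical terms `h2` cancel the first `d` terms
  -- of the sum in `hμ'`.
  rw [map_add, map_add, map_sum, map_sum, Fin.sum_univ_add, Finset.sum_congr rfl fun j _ ↦ h1 j,
    Finset.sum_congr rfl fun k _ ↦ h2 k, h5, hμ', Fin.sum_univ_add, Finset.smul_sum,
    ← Finset.sum_smul, add_assoc, ← add_smul]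
  congr 2
  ring

/-- The value of the canonical isomorphism on `(b₁ ∧ … ∧ b_r) ⊗ μ` in adapted bases. -/
theorem IsCanonicalIso.evalForm_adapted {d : ℕ} [Module.Finite ℝ T] (hT : finrank ℝ T = n)
    (hr : p + d = r) (hn : d + q = n)
    {ℓ : (⋀[ℝ]^r V) ⊗[ℝ] (T [⋀^Fin n]→ₗ[ℝ] ℝ) →ₗ[ℝ] (⋀[ℝ]^p W) ⊗[ℝ] (Q [⋀^Fin q]→ₗ[ℝ] ℝ)}
    (hℓ : IsCanonicalIso i κ ℓ) {b : Fin r → V} {c : Fin p → W} {ξ : Fin n → T}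
    (hb₁ : ∀ j, (i (b (Fin.cast hr (Fin.castAdd d j)))).1 = c j)
    (hb₂ : ∀ k, i (b (Fin.cast hr (Fin.natAdd p k))) = (0, ξ (Fin.cast hn (Fin.castAdd q k))))
    (μ : T [⋀^Fin n]→ₗ[ℝ] ℝ) :
    evalForm (⋀[ℝ]^p W) (fun l ↦ κ ((0 : W), ξ (Fin.cast hn (Fin.natAdd d l))))
      (ℓ (exteriorPower.ιMulti ℝ r b ⊗ₜ[ℝ] μ)) = μ ξ • exteriorPower.ιMulti ℝ p c :=
  hℓ _ μ _ _ ξ (wedge_adapted hT hr hn hb₁ hb₂)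

/-- Both sides are linear in `x`. The left one vanishes on the first `d` vectors, hence on `ker κ`;
modulo `ker κ`, `x` is a combination of the last `q` vectors, with coefficients given by Cramer's
rule for `κ x`, and only the `l`-th one contributes. -/
theorem alternating_update_of_surjective {d : ℕ} [Module.Finite ℝ Q] (hQ : finrank ℝ Q = q)
    (hn : d + q = n) (κ : T →ₗ[ℝ] Q)
    {ξ : Fin n → T}
    (hker : LinearMap.ker κ ≤
      Submodule.span ℝ (Set.range fun k ↦ ξ (Fin.cast hn (Fin.castAdd q k))))
    {Y : Fin q → Q} (hξY : ∀ l, κ (ξ (Fin.cast hn (Fin.natAdd d l))) = Y l)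
    {ν : Q [⋀^Fin q]→ₗ[ℝ] ℝ} (hY : ν Y = 1) (μ : T [⋀^Fin n]→ₗ[ℝ] ℝ) (l : Fin q) (x : T) :
    μ (Function.update ξ (Fin.cast hn (Fin.natAdd d l)) x) =
      μ ξ * ν (Function.update Y l (κ x)) := by
  subst hn
  simp only [Fin.cast_refl, id_eq] at hker hξY ⊢
  let L : T →ₗ[ℝ] ℝ := μ.toMultilinearMap.toLinearMap ξ (Fin.natAdd d l)
  have hL : ∀ x, μ (Function.update ξ (Fin.natAdd d l) x) = L x := fun _ ↦ rfl
  have hspan : Submodule.span ℝ (Set.range fun k ↦ ξ (Fin.castAdd q k)) ≤ LinearMap.ker L := by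
    rw [Submodule.span_le]
    rintro _ ⟨k, rfl⟩
    refine μ.map_update_self ξ ?_
    intro e
    have := congrArg Fin.val e
    simp at this
    omega
  have h1 : x - ∑ k, ν (Function.update Y k (κ x)) • ξ (Fin.natAdd d k) ∈ LinearMap.ker κ := by
    have h := sum_alternating_update hQ ν Y (by simp [hY]) (κ x)
    simp only [hY, div_one] at h
    rw [LinearMap.mem_ker, map_sub, map_sum]
    simp only [map_smul, hξY]
    rw [← h, sub_self]
  have h2 := hspan (hker h1)
  rw [LinearMap.mem_ker, map_sub, sub_eq_zero, map_sum, Finset.sum_eq_single l] at h2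
  · rw [hL, h2, map_smul, ← hL, Function.update_eq_self, smul_eq_mul, mul_comm]
  · intro k _ hk
    rw [map_smul, ← hL, μ.map_update_self ξ, smul_zero]
    exact fun e ↦ hk (Fin.natAdd_injective _ _ e).symm
  · simp

end CanonicalLinear

/-! ### Derivatives of functions, bump functions and germs -/

section Functions

variable {E : Type*} [NormedAddCommGroup E] [NormedSpace ℝ E]
  {M : Type*} [TopologicalSpace M] [ChartedSpace E M]

theorem dirDeriv_congr {f g : M → ℝ} {x : M} (h : f =ᶠ[𝓝 x] g) (v : TangentSpace 𝓘(ℝ, E) x) :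
    dirDeriv f x v = dirDeriv g x v := by
  rw [dirDeriv, dirDeriv, h.mfderiv_eq]
  rfl

theorem dirDeriv_const (c : ℝ) (x : M) (v : TangentSpace 𝓘(ℝ, E) x) :
    dirDeriv (fun _ : M ↦ c) x v = 0 := by
  rw [dirDeriv, mfderiv_const]
  rfl

theorem dirDeriv_mul {f g : M → ℝ} {x : M} (hf : ContMDiffAt 𝓘(ℝ, E) 𝓘(ℝ, ℝ) ∞ f x)
    (hg : ContMDiffAt 𝓘(ℝ, E) 𝓘(ℝ, ℝ) ∞ g x) (v : TangentSpace 𝓘(ℝ, E) x) :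
    dirDeriv (fun y ↦ f y * g y) x v = f x * dirDeriv g x v + dirDeriv f x v * g x := by
  have h := (hf.mdifferentiableAt (by simp)).hasMFDerivAt.mul
    (hg.mdifferentiableAt (by simp)).hasMFDerivAt
  have h' := congrArg (fun T ↦ T v) h.mfderiv
  rw [mul_comm (dirDeriv f x v)]
  exact h'

theorem dirDeriv_sum {ι : Type*} (s : Finset ι) {f : ι → M → ℝ}
    (hf : ∀ i, ContMDiff 𝓘(ℝ, E) 𝓘(ℝ, ℝ) ∞ (f i)) (x : M) (v : TangentSpace 𝓘(ℝ, E) x) :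
    dirDeriv (fun y ↦ ∑ i ∈ s, f i y) x v = ∑ i ∈ s, dirDeriv (f i) x v := by
  classical
  induction s using Finset.induction_on with
  | empty => simp [dirDeriv_const]
  | insert a s ha ih =>
    simp only [Finset.sum_insert ha]
    rw [dirDeriv_add (hf a) (ContMDiff.sum fun i _ ↦ hf i), ih]

theorem dirDeriv_add_right (f : M → ℝ) (x : M) (v w : TangentSpace 𝓘(ℝ, E) x) :
    dirDeriv f x (v + w) = dirDeriv f x v + dirDeriv f x w := map_add _ _ _

theorem dirDeriv_smul_right (f : M → ℝ) (x : M) (c : ℝ) (v : TangentSpace 𝓘(ℝ, E) x) :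
    dirDeriv f x (c • v) = c * dirDeriv f x v := map_smul _ _ _

theorem dirDeriv_comp {E' : Type*} [NormedAddCommGroup E'] [NormedSpace ℝ E']
    {N : Type*} [TopologicalSpace N] [ChartedSpace E' N] {φ : M → N} {f : N → ℝ} {m : M}
    (hf : ContMDiff 𝓘(ℝ, E') 𝓘(ℝ, ℝ) ∞ f) (hφ : ContMDiff 𝓘(ℝ, E) 𝓘(ℝ, E') ∞ φ)
    (v : TangentSpace 𝓘(ℝ, E) m) :
    dirDeriv (fun y ↦ f (φ y)) m v = dirDeriv f (φ m) (mfderiv 𝓘(ℝ, E) 𝓘(ℝ, E') φ m v) := by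
  have h := mfderiv_comp m ((hf.mdifferentiable (by simp)) (φ m)) ((hφ.mdifferentiable (by simp)) m)
  exact congrArg (fun T ↦ T v) h

/-- `Real.log` is the logarithm of the absolute value, so `f` may be negative. This is what turns
logarithmic derivatives into coboundaries. -/
theorem dirDeriv_log {f : M → ℝ} {x : M} (hf : ContMDiff 𝓘(ℝ, E) 𝓘(ℝ, ℝ) ∞ f)
    (hx : f x ≠ 0) (v : TangentSpace 𝓘(ℝ, E) x) :
    dirDeriv (fun y ↦ Real.log (f y)) x v = dirDeriv f x v / f x := by
  have h1 : HasMFDerivAt 𝓘(ℝ, ℝ) 𝓘(ℝ, ℝ) Real.log (f x) _ :=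
    (Real.hasDerivAt_log hx).hasFDerivAt.hasMFDerivAt
  have h := h1.comp x ((hf.mdifferentiable (by simp)) x).hasMFDerivAt
  have h' := congrArg (fun T ↦ T v) h.mfderiv
  rw [div_eq_mul_inv]
  exact h'

theorem eventually_ne_zero {h : C^∞⟮𝓘(ℝ, E), M; ℝ⟯} {x : M} (hx : h x ≠ 0) :
    ∀ᶠ y in 𝓝 x, h y ≠ 0 :=
  h.contMDiff.continuous.continuousAt.eventually_ne hx

variable [FiniteDimensional ℝ E] [IsManifold 𝓘(ℝ, E) ∞ M] [T2Space M]

theorem exists_bump {x : M} {U : Set M} (hU : U ∈ 𝓝 x) :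
    ∃ χ : C^∞⟮𝓘(ℝ, E), M; ℝ⟯, (∀ᶠ y in 𝓝 x, χ y = 1) ∧ tsupport χ ⊆ U := by
  obtain ⟨χ, -, hχ⟩ := (SmoothBumpFunction.nhds_basis_tsupport (I := 𝓘(ℝ, E)) x).mem_iff.1 hU
  exact ⟨⟨χ, χ.contMDiff⟩, χ.eventuallyEq_one, hχ⟩

/-- Used for locality: an object vanishing on `U` is unchanged by multiplication by `ψ`, although
`ψ` vanishes near `x`. -/
theorem exists_cutoff {x : M} {U : Set M} (hU : U ∈ 𝓝 x) :
    ∃ ψ : C^∞⟮𝓘(ℝ, E), M; ℝ⟯, (∀ᶠ y in 𝓝 x, ψ y = 0) ∧ ∀ y ∉ U, ψ y = 1 := by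
  obtain ⟨χ, h1, h2⟩ := exists_bump (E := E) hU
  refine ⟨1 - χ, h1.mono fun y hy ↦ by simp [hy], fun y hy ↦ ?_⟩
  have : χ y = 0 := image_eq_zero_of_notMem_tsupport fun h ↦ hy (h2 h)
  simp [this]

/-- Sections may only be multiplied by global smooth functions, so a locally defined coefficient is
replaced by a global one with the same germ. -/
theorem exists_smooth_eventuallyEq {f : M → ℝ} {x : M}
    (hf : ∀ᶠ y in 𝓝 x, ContMDiffAt 𝓘(ℝ, E) 𝓘(ℝ, ℝ) ∞ f y) :
    ∃ g : C^∞⟮𝓘(ℝ, E), M; ℝ⟯, ∀ᶠ y in 𝓝 x, g y = f y := by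
  obtain ⟨χ, h1, h2⟩ := exists_bump (E := E) hf
  refine ⟨⟨fun y ↦ χ y * f y, contMDiff_of_tsupport fun y hy ↦ ?_⟩, h1.mono fun y hy ↦ ?_⟩
  · exact χ.contMDiff.contMDiffAt.mul (h2 (closure_mono (Function.support_mul_subset_left _ _) hy))
  · change χ y * f y = f y
    rw [hy, one_mul]

theorem exists_local_inverse {h : C^∞⟮𝓘(ℝ, E), M; ℝ⟯} {x : M} (hx : h x ≠ 0) :
    ∃ g : C^∞⟮𝓘(ℝ, E), M; ℝ⟯, ∀ᶠ y in 𝓝 x, h y * g y = 1 := by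
  obtain ⟨g, hg⟩ := exists_smooth_eventuallyEq (E := E) (f := fun y ↦ (h y)⁻¹) (x := x)
    ((eventually_ne_zero hx).mono fun y hy ↦ h.contMDiff.contMDiffAt.inv₀ hy)
  refine ⟨g, ?_⟩
  filter_upwards [hg, eventually_ne_zero hx] with y hy hy'
  rw [hy, mul_inv_cancel₀ hy']

end Functions

/-! ### Local frames, tensoriality and forms -/

section Frames

variable {E : Type*} [NormedAddCommGroup E] [NormedSpace ℝ E]
  {M : Type*} [TopologicalSpace M] [ChartedSpace E M]
  {F : Type*} [NormedAddCommGroup F] [NormedSpace ℝ F]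
  {A : M → Type*} [TopologicalSpace (TotalSpace F A)] [∀ x, TopologicalSpace (A x)]
  [∀ x, AddCommGroup (A x)] [∀ x, Module ℝ (A x)] [FiberBundle F A] [VectorBundle ℝ F A]

variable (F A) in
theorem finrank_fiber (x : M) : finrank ℝ (A x) = finrank ℝ F :=
  ((trivializationAt F A x).linearEquivAt ℝ x
    (FiberBundle.mem_baseSet_trivializationAt' x)).finrank_eq

variable (F A) in
theorem finite_fiber [FiniteDimensional ℝ F] (x : M) : Module.Finite ℝ (A x) :=
  Module.Finite.equiv ((trivializationAt F A x).linearEquivAt ℝ x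
    (FiberBundle.mem_baseSet_trivializationAt' x)).symm

/-- Evaluation of sections at a point. -/
def evalSec (x : M) : Cₛ^∞⟮𝓘(ℝ, E); F, A⟯ →ₗ[ℝ] A x where
  toFun a := a x
  map_add' _ _ := rfl
  map_smul' _ _ := rfl

@[simp] theorem evalSec_apply (x : M) (a : Cₛ^∞⟮𝓘(ℝ, E); F, A⟯) : evalSec x a = a x := rfl

@[simp] theorem funSMul_apply (f : C^∞⟮𝓘(ℝ, E), M; ℝ⟯) (a : Cₛ^∞⟮𝓘(ℝ, E); F, A⟯) (x : M) :
    funSMul f a x = f x • a x := rfl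

theorem sum_sec_apply {ι : Type*} (s : Finset ι) (a : ι → Cₛ^∞⟮𝓘(ℝ, E); F, A⟯) (x : M) :
    (∑ i ∈ s, a i) x = ∑ i ∈ s, a i x := map_sum (evalSec x) a s

/-- The function `θ(a₁, …, a_k)`. -/
def Form.eval {k : ℕ} (θ : Form E F A k) (a : Fin k → Cₛ^∞⟮𝓘(ℝ, E); F, A⟯) :
    C^∞⟮𝓘(ℝ, E), M; ℝ⟯ := ⟨fun x ↦ θ.1 x (fun i ↦ a i x), θ.2 a⟩

theorem update_sec_apply {k : ℕ} (a : Fin k → Cₛ^∞⟮𝓘(ℝ, E); F, A⟯) (i : Fin k)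
    (c : Cₛ^∞⟮𝓘(ℝ, E); F, A⟯) (x : M) :
    (fun j ↦ Function.update a i c j x) = Function.update (fun j ↦ a j x) i (c x) := by
  funext j
  by_cases h : j = i
  · subst h; simp
  · simp [h]

variable [FiniteDimensional ℝ E] [IsManifold 𝓘(ℝ, E) ∞ M] [T2Space M]
  [FiniteDimensional ℝ F] [ContMDiffVectorBundle ∞ F A 𝓘(ℝ, E)]

variable (E F A) in
/-- Local frames, with a top-degree form taking the value `1` on them. -/
theorem exists_frame (x : M) : ∃ (t : Fin (finrank ℝ F) → Cₛ^∞⟮𝓘(ℝ, E); F, A⟯)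
    (vol : Form E F A (finrank ℝ F)), ∀ᶠ y in 𝓝 x, vol.1 y (fun i ↦ t i y) = 1 := by
  have : ContMDiffVectorBundle 1 F A 𝓘(ℝ, E) := ContMDiffVectorBundle.of_le (n := ∞) (by simp)
  let e := trivializationAt F A x
  let b := Module.finBasis ℝ F
  have hmem : x ∈ e.baseSet := FiberBundle.mem_baseSet_trivializationAt' x
  obtain ⟨χ, hχ1, hχ⟩ := exists_bump (E := E) (e.open_baseSet.mem_nhds hmem)
  let t : Fin (finrank ℝ F) → Cₛ^∞⟮𝓘(ℝ, E); F, A⟯ := fun j ↦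
    ⟨fun y ↦ χ y • e.localFrame b j y,
      ContMDiffOn.smul_section_of_tsupport (u := e.baseSet) χ.contMDiff.contMDiffOn
        e.open_baseSet hχ (e.contMDiffOn_localFrame_baseSet ∞ b j)⟩
  -- The determinant in the trivialization, cut off by `χ`. On the support of `χ` it is a polynomial
  -- in the coordinates of the sections; elsewhere there is nothing to check.
  let vol : Form E F A (finrank ℝ F) := ⟨fun y ↦ χ y • b.det.compLinearMap (e.linearMapAt ℝ y), by
    intro a
    refine contMDiff_of_tsupport fun y hy ↦ ?_
    have hsupp : (Function.support fun z ↦ (χ z • b.det.compLinearMap (e.linearMapAt ℝ z))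
        fun i ↦ a i z) ⊆ Function.support χ := fun z hz h0 ↦ hz (by simp [h0])
    have hyU : y ∈ e.baseSet := hχ (closure_mono hsupp hy)
    have h1 : ∀ i, ContMDiffAt 𝓘(ℝ, E) 𝓘(ℝ, F) ∞ (fun z ↦ (e ⟨z, a i z⟩).2) y := fun i ↦
      ((e.contMDiffAt_iff (IB := 𝓘(ℝ, E)) (f := fun m ↦ (⟨m, a i m⟩ : TotalSpace F A))
        (x₀ := y) (e.mem_source.2 hyU)).1 (a i).contMDiff.contMDiffAt).2
    have h2 : (fun z ↦ (χ z • b.det.compLinearMap (e.linearMapAt ℝ z)) fun i ↦ a i z) =ᶠ[𝓝 y]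
        fun z ↦ χ z * ∑ σ : Equiv.Perm (Fin (finrank ℝ F)),
          ((σ.sign : ℤ) : ℝ) * ∏ i, b.repr (e ⟨z, a i z⟩).2 (σ i) := by
      filter_upwards [e.open_baseSet.mem_nhds hyU] with z hz
      have h3 : ∀ i, e.linearMapAt ℝ z (a i z) = (e ⟨z, a i z⟩).2 := fun i ↦ by
        rw [e.coe_linearMapAt_of_mem hz]
      simp [AlternatingMap.smul_apply, Basis.det_apply, Matrix.det_apply', h3, Basis.toMatrix_apply]
    refine ContMDiffAt.congr_of_eventuallyEq ?_ h2
    refine χ.contMDiff.contMDiffAt.mul (ContMDiffAt.sum fun σ _ ↦ contMDiffAt_const.mul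
      (ContMDiffAt.prod fun i _ ↦ ?_))
    let l : F →L[ℝ] ℝ := (b.coord (σ i)).toContinuousLinearMap
    exact (l.contMDiff.contMDiffAt (x := (e ⟨y, a i y⟩).2)).comp y (h1 i)⟩
  refine ⟨t, vol, ?_⟩
  filter_upwards [hχ1, e.open_baseSet.mem_nhds hmem] with y hy hyU
  change χ y • b.det (fun i ↦ e.linearMapAt ℝ y (χ y • e.localFrame b i y)) = 1
  have h4 : ∀ i, e.linearMapAt ℝ y (e.localFrame b i y) = b i := by
    intro i
    rw [e.localFrame_apply_of_mem_baseSet b hyU, e.linearMapAt_def_of_mem hyU]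
    exact (e.linearEquivAt ℝ y hyU).apply_symm_apply (b i)
  simp only [hy, one_smul, h4]
  exact b.det_self

/-- Writing the coordinates of `v` through `vol` makes them visibly smooth when `v` varies smoothly.
-/
theorem frame_expansion {t : Fin (finrank ℝ F) → Cₛ^∞⟮𝓘(ℝ, E); F, A⟯}
    {vol : Form E F A (finrank ℝ F)} {y : M} (h : vol.1 y (fun i ↦ t i y) = 1) (v : A y) :
    v = ∑ j, vol.1 y (Function.update (fun i ↦ t i y) j v) • t j y := by
  have := finite_fiber F A y
  have h' := sum_alternating_update (finrank_fiber F A y) (vol.1 y) (fun i ↦ t i y)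
    (by rw [h]; exact one_ne_zero) v
  simpa only [h, div_one] using h'

variable (E F A) in
-- Linearity of the extension is the point: composing with `L` turns multilinear operations on
-- sections into multilinear forms on the fibre.
theorem exists_linear_extension (x : M) :
    ∃ L : A x →ₗ[ℝ] Cₛ^∞⟮𝓘(ℝ, E); F, A⟯, ∀ v, L v x = v := by
  obtain ⟨t, vol, h⟩ := exists_frame E F A x
  refine ⟨∑ j, (LinearMap.toSpanSingleton ℝ _ (t j)).comp
    ((vol.1 x).toMultilinearMap.toLinearMap (fun i ↦ t i x) j), fun v ↦ ?_⟩
  conv_rhs => rw [frame_expansion h.self_of_nhds v]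
  rw [LinearMap.sum_apply, sum_sec_apply]
  rfl

theorem exists_section_eq {x : M} (v : A x) : ∃ a : Cₛ^∞⟮𝓘(ℝ, E); F, A⟯, a x = v :=
  let ⟨L, hL⟩ := exists_linear_extension E F A x
  ⟨L v, hL v⟩

/-- A section vanishing at `x` is a combination of sections whose coefficients vanish at `x`. -/
theorem exists_eq_sum_funSMul {x : M} {a : Cₛ^∞⟮𝓘(ℝ, E); F, A⟯} (ha : a x = 0) :
    ∃ (f : Fin (finrank ℝ F + 1) → C^∞⟮𝓘(ℝ, E), M; ℝ⟯)
      (t : Fin (finrank ℝ F + 1) → Cₛ^∞⟮𝓘(ℝ, E); F, A⟯),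
      (∀ j, f j x = 0) ∧ a = ∑ j, funSMul (f j) (t j) := by
  obtain ⟨t, vol, h⟩ := exists_frame E F A x
  obtain ⟨ψ, hψ0, hψ1⟩ := exists_cutoff (E := E) h
  -- The extra index `0` carries `ψ a`, which is all of `a` where the frame is not available; the
  -- other terms expand `(1 - ψ) a` in the frame, with coefficients vanishing at `x` because `a x =
  -- 0`.
  refine ⟨Fin.cons ψ fun j ↦ (1 - ψ) * vol.eval (Function.update t j a), Fin.cons a t,
    fun j ↦ ?_, ?_⟩
  · refine Fin.cases ?_ (fun j ↦ ?_) j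
    · exact hψ0.self_of_nhds
    · have h1 : (vol.eval (Function.update t j a)) x = 0 := by
        change vol.1 x (fun i ↦ Function.update t j a i x) = 0
        rw [update_sec_apply, ha]
        exact (vol.1 x).map_coord_zero j (by simp)
      simp [h1]
  · ext y
    rw [sum_sec_apply, Fin.sum_univ_succ]
    simp only [Fin.cons_zero, Fin.cons_succ, funSMul_apply]
    have h2 : ∀ j, (((1 - ψ) * vol.eval (Function.update t j a) :
        C^∞⟮𝓘(ℝ, E), M; ℝ⟯) y) • t j y =
        (1 - ψ y) • (vol.1 y (Function.update (fun i ↦ t i y) j (a y)) • t j y) := by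
      intro j
      rw [smul_smul, ← update_sec_apply]
      rfl
    simp only [h2, ← Finset.smul_sum]
    by_cases hy : vol.1 y (fun i ↦ t i y) = 1
    · rw [← frame_expansion hy, ← add_smul]
      simp
    · rw [hψ1 y hy]
      simp

theorem tensorial_eq_zero {x : M} {X : Type*} [AddCommGroup X] [Module ℝ X]
    (T : Cₛ^∞⟮𝓘(ℝ, E); F, A⟯ → X) (hadd : ∀ a b, T (a + b) = T a + T b)
    (hsmul : ∀ f a, T (funSMul f a) = f x • T a) {a : Cₛ^∞⟮𝓘(ℝ, E); F, A⟯} (ha : a x = 0) :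
    T a = 0 := by
  obtain ⟨f, t, hf, rfl⟩ := exists_eq_sum_funSMul ha
  let T' : Cₛ^∞⟮𝓘(ℝ, E); F, A⟯ →+ X := AddMonoidHom.mk' T hadd
  change T' _ = 0
  rw [map_sum]
  refine Finset.sum_eq_zero fun j _ ↦ ?_
  change T _ = 0
  rw [hsmul, hf, zero_smul]

theorem tensorial_congr {x : M} {X : Type*} [AddCommGroup X] [Module ℝ X]
    (T : Cₛ^∞⟮𝓘(ℝ, E); F, A⟯ → X) (hadd : ∀ a b, T (a + b) = T a + T b)
    (hsmul : ∀ f a, T (funSMul f a) = f x • T a) {a b : Cₛ^∞⟮𝓘(ℝ, E); F, A⟯} (hab : a x = b x) :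
    T a = T b := by
  have h := tensorial_eq_zero T hadd hsmul (a := a - b) (by
    change a x - b x = 0
    rw [hab, sub_self])
  have h' := hadd (a - b) b
  rwa [h, zero_add, sub_add_cancel] at h'

theorem Form.ext_sections {k : ℕ} {θ η : Form E F A k}
    (h : ∀ (a : Fin k → Cₛ^∞⟮𝓘(ℝ, E); F, A⟯) x, θ.1 x (fun i ↦ a i x) = η.1 x (fun i ↦ a i x)) :
    θ = η := by
  refine Subtype.ext (funext fun x ↦ AlternatingMap.ext fun v ↦ ?_)
  choose a ha using fun i ↦ exists_section_eq (E := E) (F := F) (v i)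
  have := h a x
  simpa only [ha] using this

/-- Alternating operations on sections which are linear over functions define forms. -/
theorem exists_form_of_tensorial {k : ℕ}
    (T : M → Cₛ^∞⟮𝓘(ℝ, E); F, A⟯ [⋀^Fin k]→ₗ[ℝ] ℝ)
    (hT : ∀ a, ContMDiff 𝓘(ℝ, E) 𝓘(ℝ, ℝ) ∞ (fun x ↦ T x a))
    (htens : ∀ x a i f b, T x (Function.update a i (funSMul f b)) =
      f x * T x (Function.update a i b)) :
    ∃ θ : Form E F A k, ∀ a x, θ.1 x (fun i ↦ a i x) = T x a := by
  choose L hL using exists_linear_extension E F A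
  -- By tensoriality `T x` vanishes as soon as one entry vanishes at `x`, so each `a i` may be
  -- replaced by the extension of its value.
  have key : ∀ a x, T x (fun i ↦ L x (a i x)) = T x a := by
    intro a x
    refine multilinear_eq_of_sub_mem (T x).toMultilinearMap (LinearMap.ker (evalSec x)) ?_ _ _ ?_
    · intro w j hw
      have := tensorial_eq_zero (x := x) (fun b ↦ T x (Function.update w j b))
        (fun b c ↦ (T x).map_update_add w j b c) (fun f b ↦ htens x w j f b) (a := w j) hw
      rwa [Function.update_eq_self] at this
    · intro j
      rw [LinearMap.mem_ker, map_sub, evalSec_apply, hL]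
      exact sub_self _
  exact ⟨⟨fun x ↦ (T x).compLinearMap (L x), fun a ↦ by
    convert hT a using 2 with x
    exact key a x⟩, key⟩

end Frames

/-! ### Smooth vector fields and their bracket -/

section VectorFields

/-- Smooth vector fields on `M`. -/
abbrev VectorFields (E : Type*) [NormedAddCommGroup E] [NormedSpace ℝ E]
    (M : Type*) [TopologicalSpace M] [ChartedSpace E M] [IsManifold 𝓘(ℝ, E) ∞ M] : Type _ :=
  Cₛ^∞⟮𝓘(ℝ, E); E, fun x : M ↦ TangentSpace 𝓘(ℝ, E) x⟯

variable {E : Type*} [NormedAddCommGroup E] [NormedSpace ℝ E]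
  {M : Type*} [TopologicalSpace M] [ChartedSpace E M] [IsManifold 𝓘(ℝ, E) ∞ M]
  {E' : Type*} [NormedAddCommGroup E'] [NormedSpace ℝ E']
  {N : Type*} [TopologicalSpace N] [ChartedSpace E' N] [IsManifold 𝓘(ℝ, E') ∞ N]

/-- The image of a smooth vector field by the differential of a smooth map is smooth. -/
theorem contMDiff_mfderiv {φ : M → N} (hφ : ContMDiff 𝓘(ℝ, E) 𝓘(ℝ, E') ∞ φ)
    (u : VectorFields E M) : ContMDiff 𝓘(ℝ, E) (𝓘(ℝ, E').prod 𝓘(ℝ, E')) ∞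
      (fun m ↦ (⟨φ m, mfderiv 𝓘(ℝ, E) 𝓘(ℝ, E') φ m (u m)⟩ : TangentBundle 𝓘(ℝ, E') N)) := by
  have h := (hφ.contMDiff_tangentMap (m := ∞) (by simp)).comp u.contMDiff
  exact h

/-- The derivative of a smooth function along a smooth vector field. -/
def der (u : VectorFields E M) (f : C^∞⟮𝓘(ℝ, E), M; ℝ⟯) : C^∞⟮𝓘(ℝ, E), M; ℝ⟯ :=
  ⟨fun x ↦ dirDeriv f x (u x),
    (contMDiff_snd_tangentBundle_modelSpace ℝ 𝓘(ℝ, ℝ)).comp (contMDiff_mfderiv f.contMDiff u)⟩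

theorem der_apply (u : VectorFields E M) (f : C^∞⟮𝓘(ℝ, E), M; ℝ⟯) (x : M) :
    der u f x = dirDeriv f x (u x) := rfl

variable [FiniteDimensional ℝ E]

theorem VectorFields.mdifferentiableAt (u : VectorFields E M) (x : M) :
    MDifferentiableAt 𝓘(ℝ, E) (𝓘(ℝ, E).prod 𝓘(ℝ, E))
      (fun x ↦ (⟨x, u x⟩ : TangentBundle 𝓘(ℝ, E) M)) x :=
  (u.contMDiff x).mdifferentiableAt (by simp)

/-- The Lie bracket of vector fields. -/
def lieBr : VectorFields E M →ₗ[ℝ] VectorFields E M →ₗ[ℝ] VectorFields E M :=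
  have : CompleteSpace E := FiniteDimensional.complete ℝ E
  LinearMap.mk₂ ℝ
    (fun u v ↦ ⟨VectorField.mlieBracket 𝓘(ℝ, E) u v, by
      have : IsManifold 𝓘(ℝ, E) ((⊤ : ℕ∞) + 1 : WithTop ℕ∞) M :=
        inferInstanceAs (IsManifold 𝓘(ℝ, E) ∞ M)
      have : IsManifold 𝓘(ℝ, E) (minSmoothness ℝ 2) M := by
        rw [minSmoothness_of_isRCLikeNormedField]; infer_instance
      exact ContDiff.mlieBracket_vectorField (m := ⊤) (n := ⊤) u.contMDiff v.contMDiff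
        (by simp)⟩)
    (fun u u' v ↦ by
      ext x
      exact VectorField.mlieBracket_add_left (u.mdifferentiableAt x) (u'.mdifferentiableAt x))
    (fun c u v ↦ by
      ext x
      exact VectorField.mlieBracket_const_smul_left (u.mdifferentiableAt x))
    (fun u v v' ↦ by
      ext x
      exact VectorField.mlieBracket_add_right (v.mdifferentiableAt x) (v'.mdifferentiableAt x))
    (fun c u v ↦ by
      ext x
      exact VectorField.mlieBracket_const_smul_right (v.mdifferentiableAt x))

theorem lieBr_jacobi (u v w : VectorFields E M) :
    lieBr u (lieBr v w) = lieBr (lieBr u v) w + lieBr v (lieBr u w) := by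
  have : CompleteSpace E := FiniteDimensional.complete ℝ E
  have : IsManifold 𝓘(ℝ, E) (minSmoothness ℝ 3) M := by
    rw [minSmoothness_of_isRCLikeNormedField]; infer_instance
  have h2 : minSmoothness ℝ 2 ≤ (∞ : WithTop ℕ∞) := by
    rw [minSmoothness_of_isRCLikeNormedField]; exact ENat.LEInfty.out
  ext x
  exact VectorField.leibniz_identity_mlieBracket_apply
    ((u.contMDiff x).of_le h2) ((v.contMDiff x).of_le h2) ((w.contMDiff x).of_le h2)

theorem lieBr_funSMul (u v : VectorFields E M) (f : C^∞⟮𝓘(ℝ, E), M; ℝ⟯) :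
    lieBr u (funSMul f v) = funSMul f (lieBr u v) + funSMul (der u f) v := by
  have : CompleteSpace E := FiniteDimensional.complete ℝ E
  ext x
  have h := VectorField.mlieBracket_smul_right (V := u) (W := v) (f := f) (x := x)
    (f.contMDiff.mdifferentiableAt (by simp)) (v.mdifferentiableAt x)
  rw [add_comm] at h
  exact h

end VectorFields

/-! ### Brackets of related vector fields -/

section Related

variable {E : Type*} [NormedAddCommGroup E] [NormedSpace ℝ E] [FiniteDimensional ℝ E]
  {M : Type*} [TopologicalSpace M] [ChartedSpace E M] [IsManifold 𝓘(ℝ, E) ∞ M] [T2Space M]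
  {E' : Type*} [NormedAddCommGroup E'] [NormedSpace ℝ E'] [FiniteDimensional ℝ E']
  {N : Type*} [TopologicalSpace N] [ChartedSpace E' N] [IsManifold 𝓘(ℝ, E') ∞ N] [T2Space N]

/-- The bracket of vector fields is the commutator of derivations. -/
theorem dirDeriv_lieBr (u v : VectorFields E M) (f : C^∞⟮𝓘(ℝ, E), M; ℝ⟯) (x : M) :
    dirDeriv f x (lieBr u v x) = dirDeriv (der v f) x (u x) - dirDeriv (der u f) x (v x) := by
  -- The Jacobi identity for `u`, `v`, `f w`, minus `f` times the one for `w`, is the desired scalar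
  -- identity multiplied by `w x`. A nonzero `w x` exists unless the tangent space is zero, when
  -- both sides vanish.
  by_cases hx : ∃ w : TangentSpace 𝓘(ℝ, E) x, w ≠ 0
  · obtain ⟨w₀, hw₀⟩ := hx
    obtain ⟨w, rfl⟩ := exists_section_eq (E := E) (F := E) w₀
    have h := congrArg (fun s ↦ s x) (lieBr_jacobi u v (funSMul f w))
    have h' := congrArg (fun s ↦ s x) (lieBr_jacobi u v w)
    simp only [lieBr_funSMul, map_add, ContMDiffSection.coe_add, Pi.add_apply, funSMul_apply] at h h'
    rw [h', smul_add] at h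
    have h2 : (dirDeriv f x (lieBr u v x) - (dirDeriv (der v f) x (u x) -
        dirDeriv (der u f) x (v x))) • w x = 0 := by
      rw [← der_apply, ← der_apply, ← der_apply, sub_smul, sub_smul]
      rw [← sub_eq_zero] at h
      rw [← neg_eq_zero, ← h]
      abel
    exact sub_eq_zero.1 ((smul_eq_zero.1 h2).resolve_right hw₀)
  · push Not at hx
    rw [hx (lieBr u v x), hx (u x), hx (v x)]
    simp only [dirDeriv, map_zero]
    exact (sub_self (0 : ℝ)).symm

/-- Chart coordinates agree near `x` with global smooth functions, and the differential of the chart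
is injective. -/
theorem tangentVector_ext {x : M} {v w : TangentSpace 𝓘(ℝ, E) x}
    (h : ∀ f : C^∞⟮𝓘(ℝ, E), M; ℝ⟯, dirDeriv f x v = dirDeriv f x w) : v = w := by
  have hinv := isInvertible_mfderiv_extChartAt (I := 𝓘(ℝ, E)) (mem_extChartAt_source (I := 𝓘(ℝ, E)) x)
  refine hinv.injective ?_
  let b := Module.finBasis ℝ E
  refine b.ext_elem fun j ↦ ?_
  let l : E →L[ℝ] ℝ := (b.coord j).toContinuousLinearMap
  have hs : ∀ᶠ y in 𝓝 x, ContMDiffAt 𝓘(ℝ, E) 𝓘(ℝ, ℝ) ∞ (fun y ↦ l (extChartAt 𝓘(ℝ, E) x y)) y := by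
    filter_upwards [(chartAt E x).open_source.mem_nhds (mem_chart_source E x)] with y hy
    exact l.contMDiff.contMDiffAt.comp y (contMDiffAt_extChartAt' hy)
  obtain ⟨g, hg⟩ := exists_smooth_eventuallyEq hs
  have h1 : ∀ v, dirDeriv g x v =
      b.repr (mfderiv 𝓘(ℝ, E) 𝓘(ℝ, E) (extChartAt 𝓘(ℝ, E) x) x v) j := by
    intro v
    rw [dirDeriv_congr hg]
    have h2 := mfderiv_comp x (I := 𝓘(ℝ, E)) (g := l) (f := extChartAt 𝓘(ℝ, E) x)
      l.mdifferentiableAt ((contMDiffAt_extChartAt (n := ∞)).mdifferentiableAt (by simp))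
    rw [l.mfderiv_eq] at h2
    exact congrArg (fun T ↦ T v) h2
  rw [← h1, ← h1]
  exact h g

/-- The brackets of `φ`-related vector fields are `φ`-related. -/
theorem mfderiv_lieBr {φ : M → N} (hφ : ContMDiff 𝓘(ℝ, E) 𝓘(ℝ, E') ∞ φ) {u v : VectorFields E M}
    {Y Z : VectorFields E' N} {m : M}
    (hu : ∀ᶠ y in 𝓝 m, mfderiv 𝓘(ℝ, E) 𝓘(ℝ, E') φ y (u y) = Y (φ y))
    (hv : ∀ᶠ y in 𝓝 m, mfderiv 𝓘(ℝ, E) 𝓘(ℝ, E') φ y (v y) = Z (φ y)) :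
    mfderiv 𝓘(ℝ, E) 𝓘(ℝ, E') φ m (lieBr u v m) = lieBr Y Z (φ m) := by
  refine tangentVector_ext fun f ↦ ?_
  let fφ : C^∞⟮𝓘(ℝ, E), M; ℝ⟯ := ⟨fun y ↦ f (φ y), f.contMDiff.comp hφ⟩
  -- Relatedness as an identity of derivations: `w (f ∘ φ) = (W f) ∘ φ` near `m`. It holds for
  -- germs, so it can be differentiated once more.
  have h1 : ∀ {w : VectorFields E M} {W : VectorFields E' N},
      (∀ᶠ y in 𝓝 m, mfderiv 𝓘(ℝ, E) 𝓘(ℝ, E') φ y (w y) = W (φ y)) →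
      der w fφ =ᶠ[𝓝 m] fun y ↦ der W f (φ y) := by
    intro w W h
    filter_upwards [h] with y hy
    rw [der_apply, der_apply, ← hy]
    exact dirDeriv_comp f.contMDiff hφ _
  rw [← dirDeriv_comp f.contMDiff hφ]
  change dirDeriv fφ m _ = _
  rw [dirDeriv_lieBr, dirDeriv_lieBr, dirDeriv_congr (h1 hu), dirDeriv_congr (h1 hv),
    dirDeriv_comp (der Z f).contMDiff hφ, dirDeriv_comp (der Y f).contMDiff hφ, hu.self_of_nhds,
    hv.self_of_nhds]

end Related

/-! ### Commutators of derivations of multilinear maps -/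

section Commutators

variable {R V W : Type*} [CommRing R] [AddCommGroup V] [Module R V] [AddCommGroup W] [Module R W]

/-- The commutator of the actions of two endomorphisms on a multilinear map. -/
theorem sum_update_commutator {k : ℕ} (f : MultilinearMap R (fun _ : Fin k ↦ V) W) (d d' : V → V)
    (b : Fin k → V) :
    (∑ i, ∑ j, f (Function.update (Function.update b i (d' (b i))) j
        (d (Function.update b i (d' (b i)) j)))) -
      (∑ i, ∑ j, f (Function.update (Function.update b i (d (b i))) j
        (d' (Function.update b i (d (b i)) j)))) =
      ∑ i, f (Function.update b i (d (d' (b i)) - d' (d (b i)))) := by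
  -- Diagonal terms, where both endomorphisms act on the same entry, are separated from the
  -- off-diagonal ones; the latter are symmetric under exchange of `d` and `d'` and drop out.
  have h : ∀ (d d' : V → V) (i j : Fin k), f (Function.update (Function.update b i (d' (b i))) j
        (d (Function.update b i (d' (b i)) j))) =
      (if i = j then f (Function.update b i (d (d' (b i)))) else 0) +
      (if i = j then 0 else
        f (Function.update (Function.update b i (d' (b i))) j (d (b j)))) := by
    intro d d' i j
    by_cases hij : i = j
    · subst hij; simp
    · simp [hij, Function.update_of_ne (Ne.symm hij)]
  simp only [h d d', h d' d, Finset.sum_add_distrib, Finset.sum_ite_eq, Finset.mem_univ, if_true]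
  rw [Finset.sum_comm (f := fun i j ↦ if i = j then 0 else
        f (Function.update (Function.update b i (d (b i))) j (d' (b j))))]
  have h' : ∀ i j, (if j = i then 0 else
        f (Function.update (Function.update b j (d (b j))) i (d' (b i)))) =
      (if i = j then 0 else
        f (Function.update (Function.update b i (d' (b i))) j (d (b j)))) := by
    intro i j
    by_cases hij : i = j
    · subst hij; simp
    · rw [if_neg hij, if_neg (Ne.symm hij), Function.update_comm hij]
  simp only [h', f.map_update_sub, Finset.sum_sub_distrib]
  abel

end Commutators

/-! ### Lie derivatives of forms, and brackets of sections -/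

section LieDerivatives

variable {E : Type*} [NormedAddCommGroup E] [NormedSpace ℝ E] [FiniteDimensional ℝ E]
  {M : Type*} [TopologicalSpace M] [ChartedSpace E M] [IsManifold 𝓘(ℝ, E) ∞ M] [T2Space M]
  {F : Type*} [NormedAddCommGroup F] [NormedSpace ℝ F] [FiniteDimensional ℝ F]
  {A : M → Type*} [TopologicalSpace (TotalSpace F A)] [∀ x, TopologicalSpace (A x)]
  [∀ x, AddCommGroup (A x)] [∀ x, Module ℝ (A x)] [FiberBundle F A] [VectorBundle ℝ F A]
  [ContMDiffVectorBundle ∞ F A 𝓘(ℝ, E)]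

/-- `d` is a derivation of the module of sections of `A`, over the derivation `u` of functions. -/
def IsDerivation (u : VectorFields E M)
    (d : Cₛ^∞⟮𝓘(ℝ, E); F, A⟯ →ₗ[ℝ] Cₛ^∞⟮𝓘(ℝ, E); F, A⟯) : Prop :=
  ∀ f a, d (funSMul f a) = funSMul f (d a) + funSMul (der u f) a

theorem Form.map_update_add {k : ℕ} (θ : Form E F A k) (a : Fin k → Cₛ^∞⟮𝓘(ℝ, E); F, A⟯) (i : Fin k)
    (b c : Cₛ^∞⟮𝓘(ℝ, E); F, A⟯) (x : M) :
    θ.1 x (fun j ↦ Function.update a i (b + c) j x) =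
      θ.1 x (fun j ↦ Function.update a i b j x) + θ.1 x (fun j ↦ Function.update a i c j x) := by
  simp only [update_sec_apply]
  exact (θ.1 x).map_update_add _ _ _ _

theorem Form.map_update_smul {k : ℕ} (θ : Form E F A k) (a : Fin k → Cₛ^∞⟮𝓘(ℝ, E); F, A⟯) (i : Fin k)
    (c : ℝ) (b : Cₛ^∞⟮𝓘(ℝ, E); F, A⟯) (x : M) :
    θ.1 x (fun j ↦ Function.update a i (c • b) j x) =
      c * θ.1 x (fun j ↦ Function.update a i b j x) := by
  simp only [update_sec_apply]
  exact (θ.1 x).map_update_smul _ _ _ _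

theorem Form.map_update_funSMul {k : ℕ} (θ : Form E F A k) (a : Fin k → Cₛ^∞⟮𝓘(ℝ, E); F, A⟯)
    (i : Fin k) (f : C^∞⟮𝓘(ℝ, E), M; ℝ⟯) (b : Cₛ^∞⟮𝓘(ℝ, E); F, A⟯) (x : M) :
    θ.1 x (fun j ↦ Function.update a i (funSMul f b) j x) =
      f x * θ.1 x (fun j ↦ Function.update a i b j x) := by
  simp only [update_sec_apply]
  exact (θ.1 x).map_update_smul _ _ _ _

/-- The derivative at `x` along `v` of `θ(a₁, …, a_k)`, as a multilinear map. -/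
def Form.dirDerivMultilinear {k : ℕ} (θ : Form E F A k) (x : M) (v : TangentSpace 𝓘(ℝ, E) x) :
    MultilinearMap ℝ (fun _ : Fin k ↦ Cₛ^∞⟮𝓘(ℝ, E); F, A⟯) ℝ :=
  MultilinearMap.mk' (fun a ↦ dirDeriv (fun y ↦ θ.1 y (fun i ↦ a i y)) x v)
    (fun a i b c ↦ by
      simp only [θ.map_update_add]
      exact dirDeriv_add (θ.2 _) (θ.2 _) x v)
    (fun a i c b ↦ by
      simp only [θ.map_update_smul]
      exact dirDeriv_const_mul c (θ.2 _) x v)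

/-- Lie derivatives of forms. -/
theorem exists_lieDeriv {u : VectorFields E M}
    {d : Cₛ^∞⟮𝓘(ℝ, E); F, A⟯ →ₗ[ℝ] Cₛ^∞⟮𝓘(ℝ, E); F, A⟯} (hd : IsDerivation u d) {k : ℕ}
    (θ : Form E F A k) :
    ∃ θ' : Form E F A k, ∀ (a : Fin k → Cₛ^∞⟮𝓘(ℝ, E); F, A⟯) x, θ'.1 x (fun i ↦ a i x) =
      dirDeriv (fun y ↦ θ.1 y (fun i ↦ a i y)) x (u x) -
        ∑ i, θ.1 x (Function.update (fun j ↦ a j x) i (d (a i) x)) := by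
  let S : M → MultilinearMap ℝ (fun _ : Fin k ↦ Cₛ^∞⟮𝓘(ℝ, E); F, A⟯) ℝ := fun x ↦
    θ.dirDerivMultilinear x (u x) - ∑ i, (θ.1 x).toMultilinearMap.compLinearMap
      (Function.update (fun _ ↦ evalSec x) i ((evalSec x).comp d))
  have hS : ∀ a x, S x a = dirDeriv (fun y ↦ θ.1 y (fun i ↦ a i y)) x (u x) -
      ∑ i, θ.1 x (fun j ↦ Function.update a i (d (a i)) j x) := by
    intro a x
    simp only [S, sub_apply, sum_apply,
      MultilinearMap.compLinearMap_apply]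
    congr 1
    refine Finset.sum_congr rfl fun i _ ↦ ?_
    refine congrArg (θ.1 x) (funext fun j ↦ ?_)
    by_cases h : j = i
    · subst h; simp
    · simp [h]
  let T : M → Cₛ^∞⟮𝓘(ℝ, E); F, A⟯ [⋀^Fin k]→ₗ[ℝ] ℝ := fun x ↦
    { S x with
      map_eq_zero_of_eq' := by
        intro a i j hij hne
        change S x a = 0
        have h0 : ∀ y, θ.1 y (fun i ↦ a i y) = 0 := fun y ↦
          (θ.1 y).map_eq_zero_of_eq _ (congrArg (fun s ↦ s y) hij) hne
        rw [hS]
        simp only [h0, dirDeriv_const, zero_sub, neg_eq_zero]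
        -- When entries `i` and `j` coincide, only the terms acting on one of them survive, and
        -- these two differ by a transposition.
        rw [Finset.sum_eq_add i j hne]
        · have h1 : Function.update a j (d (a j)) =
              Function.update a i (d (a i)) ∘ Equiv.swap i j := by
            funext l
            simp only [Function.comp_apply]
            by_cases hlj : l = j
            · subst hlj; simp [hij]
            · by_cases hli : l = i
              · subst hli
                rw [Equiv.swap_apply_left, Function.update_of_ne hlj,
                  Function.update_of_ne hne.symm, hij]
              · rw [Equiv.swap_apply_of_ne_of_ne hli hlj, Function.update_of_ne hlj,
                  Function.update_of_ne hli]
          have h2 := (θ.1 x).map_swap (fun l ↦ Function.update a i (d (a i)) l x) hne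
          rw [h1]
          exact (congrArg (_ + ·) h2).trans (add_neg_cancel _)
        · intro l _ hl
          refine (θ.1 x).map_eq_zero_of_eq _ (i := i) (j := j) ?_ hne
          rw [Function.update_of_ne hl.1.symm, Function.update_of_ne hl.2.symm, hij]
        · simp
        · simp }
  obtain ⟨θ', hθ'⟩ := exists_form_of_tensorial T (fun a ↦ by
      change ContMDiff 𝓘(ℝ, E) 𝓘(ℝ, ℝ) ∞ fun x ↦ S x a
      simp only [hS]
      exact (der u (θ.eval a)).contMDiff.sub (ContMDiff.sum fun i _ ↦ θ.2 _)) (by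
    intro x a i f b
    change S x _ = f x * S x _
    rw [hS, hS]
    -- Tensoriality: the derivative of `f` appears once from differentiating the function and once
    -- from the derivation `d`, with opposite signs.
    have h1 : dirDeriv (fun y ↦ θ.1 y (fun j ↦ Function.update a i (funSMul f b) j y)) x (u x) =
        f x * dirDeriv (fun y ↦ θ.1 y (fun j ↦ Function.update a i b j y)) x (u x) +
          dirDeriv f x (u x) * θ.1 x (fun j ↦ Function.update a i b j x) := by
      simp only [θ.map_update_funSMul]
      exact dirDeriv_mul f.contMDiff.contMDiffAt (θ.2 _).contMDiffAt _
    have h2 : ∀ l, θ.1 x (fun j ↦ Function.update (Function.update a i (funSMul f b)) l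
          (d (Function.update a i (funSMul f b) l)) j x) =
        f x * θ.1 x (fun j ↦ Function.update (Function.update a i b) l
          (d (Function.update a i b l)) j x) +
        if l = i then dirDeriv f x (u x) * θ.1 x (fun j ↦ Function.update a i b j x) else 0 := by
      intro l
      by_cases h : l = i
      · subst h
        simp only [Function.update_self, Function.update_idem, if_true]
        rw [hd, θ.map_update_add, θ.map_update_funSMul, θ.map_update_funSMul]
        rfl
      · simp only [if_neg h, Function.update_of_ne h, add_zero]
        rw [Function.update_comm (Ne.symm h), θ.map_update_funSMul, Function.update_comm h]
    simp only [h1, h2, Finset.sum_add_distrib, ← Finset.mul_sum, Finset.sum_ite_eq',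
      Finset.mem_univ, if_true]
    ring)
  refine ⟨θ', fun a x ↦ ?_⟩
  rw [hθ']
  simp only [← update_sec_apply]
  exact hS a x

theorem isDerivation_lieBr (u : VectorFields E M) :
    IsDerivation (A := fun x : M ↦ TangentSpace 𝓘(ℝ, E) x) u (lieBr u) :=
  fun f a ↦ lieBr_funSMul u a f

theorem exists_isLieDerivative (u : VectorFields E M) (μ : TopForm E M) :
    ∃ μ' : TopForm E M, IsLieDerivative u μ μ' := exists_lieDeriv (isDerivation_lieBr u) μ

theorem IsLieDerivative.unique {u : VectorFields E M} {μ μ' μ'' : TopForm E M}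
    (h : IsLieDerivative u μ μ') (h' : IsLieDerivative u μ μ'') : μ' = μ'' :=
  Form.ext_sections fun a x ↦ (h a x).trans (h' a x).symm

/-- Second derivatives of `μ(X)` give the commutator of derivations, the mixed terms are symmetric
in `u` and `v`, and the double sums combine by the Jacobi identity. -/
theorem IsLieDerivative.commutator {u v : VectorFields E M}
    {μ μu μv μuv μvu μc : TopForm E M} (hu : IsLieDerivative u μ μu) (hv : IsLieDerivative v μ μv)
    (huv : IsLieDerivative u μv μuv) (hvu : IsLieDerivative v μu μvu)
    (hc : IsLieDerivative (lieBr u v) μ μc) : μuv - μvu = μc := by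
  refine Form.ext_sections fun X x ↦ ?_
  change μuv.1 x _ - μvu.1 x _ = μc.1 x _
  have key : ∀ {u v : VectorFields E M} {μv μuv : TopForm E M}, IsLieDerivative v μ μv →
      IsLieDerivative u μv μuv → μuv.1 x (fun i ↦ X i x) = dirDeriv (der v (μ.eval X)) x (u x) -
        ∑ i, dirDeriv (fun y ↦ μ.1 y (fun j ↦ Function.update X i (lieBr v (X i)) j y)) x (u x) -
        (∑ i, dirDeriv (fun y ↦ μ.1 y (fun j ↦ Function.update X i (lieBr u (X i)) j y)) x (v x) -
        ∑ i, ∑ j, μ.1 x (fun l ↦ Function.update (Function.update X i (lieBr u (X i))) j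
          (lieBr v (Function.update X i (lieBr u (X i)) j)) l x)) := by
    intro u v μv μuv hv huv
    rw [huv X x]
    let G : Fin (finrank ℝ E) → C^∞⟮𝓘(ℝ, E), M; ℝ⟯ := fun i ↦
      μ.eval (Function.update X i (lieBr v (X i)))
    have h0 : (fun y ↦ μv.1 y (fun i ↦ X i y)) = fun y ↦ der v (μ.eval X) y +
        ∑ i, -1 * G i y := by
      funext y
      rw [hv X y, sub_eq_add_neg, ← Finset.sum_neg_distrib]
      simp only [neg_one_mul, G, Form.eval]
      refine congrArg₂ (· + ·) rfl (Finset.sum_congr rfl fun i _ ↦ congrArg Neg.neg ?_)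
      exact congrArg (μ.1 y) (update_sec_apply X i (lieBr v (X i)) y).symm
    have h1 : dirDeriv (fun y ↦ μv.1 y (fun i ↦ X i y)) x (u x) =
        dirDeriv (der v (μ.eval X)) x (u x) + ∑ i, -1 * dirDeriv (G i) x (u x) := by
      rw [h0]
      refine (dirDeriv_add (der v (μ.eval X)).contMDiff
        (ContMDiff.sum fun i _ ↦ contMDiff_const.mul (G i).contMDiff) x _).trans ?_
      congr 1
      exact (dirDeriv_sum _ (fun i ↦ contMDiff_const.mul (G i).contMDiff) x _).trans
        (Finset.sum_congr rfl fun i _ ↦ dirDeriv_const_mul _ (G i).contMDiff x _)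
    have h2 : ∀ i, (Function.update (fun j ↦ X j x) i
        (VectorField.mlieBracket 𝓘(ℝ, E) u (fun y ↦ X i y) x)) =
        fun j ↦ Function.update X i (lieBr u (X i)) j x := fun i ↦ by
      rw [update_sec_apply]; rfl
    have h3 : ∀ i, μv.1 x (fun j ↦ Function.update X i (lieBr u (X i)) j x) =
        dirDeriv (fun y ↦ μ.1 y (fun j ↦ Function.update X i (lieBr u (X i)) j y)) x (v x) -
        ∑ j, μ.1 x (fun l ↦ Function.update (Function.update X i (lieBr u (X i))) j
          (lieBr v (Function.update X i (lieBr u (X i)) j)) l x) := by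
      intro i
      rw [hv _ x]
      simp only [update_sec_apply]
      rfl
    rw [h1]
    simp only [h2, h3, Finset.sum_sub_distrib, neg_one_mul, Finset.sum_neg_distrib,
      ← sub_eq_add_neg]
    rfl
  rw [key hv huv, key hu hvu, hc X x]
  have h4 := sum_update_commutator ((μ.1 x).toMultilinearMap.compLinearMap fun _ ↦ evalSec x)
    (lieBr v) (lieBr u) X
  -- In the expansion of `μuv` the bracket with `u` is taken first, hence the reversed order and the
  -- sign.
  have h5 : ∀ i, lieBr v (lieBr u (X i)) - lieBr u (lieBr v (X i)) = -lieBr (lieBr u v) (X i) := by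
    intro i
    rw [lieBr_jacobi u v]
    abel
  simp only [h5] at h4
  have h6 : ∀ i, ((μ.1 x).toMultilinearMap.compLinearMap fun _ ↦ evalSec x)
      (Function.update X i (-lieBr (lieBr u v) (X i))) = -μ.1 x (Function.update (fun j ↦ X j x) i
        (VectorField.mlieBracket 𝓘(ℝ, E) (lieBr u v) (fun y ↦ X i y) x)) := by
    intro i
    rw [MultilinearMap.map_update_neg]
    congr 1
    exact congrArg (μ.1 x) (update_sec_apply X i (lieBr (lieBr u v) (X i)) x)
  simp only [h6, Finset.sum_neg_distrib] at h4
  have h7 := dirDeriv_lieBr u v (μ.eval X) x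
  have h8 : dirDeriv (fun y ↦ μ.1 y (fun i ↦ X i y)) x (lieBr u v x) =
    dirDeriv (μ.eval X) x (lieBr u v x) := rfl
  rw [h8, h7]
  have h9 : ∀ Z : Fin (finrank ℝ E) → VectorFields E M,
    ((μ.1 x).toMultilinearMap.compLinearMap fun _ ↦ evalSec x) Z = μ.1 x (fun l ↦ Z l x) :=
    fun _ ↦ rfl
  simp only [h9] at h4
  linear_combination h4

/-- The anchor of a section. -/
def LieAlgebroid.anchorSec (𝒜 : LieAlgebroid E F A) (a : Cₛ^∞⟮𝓘(ℝ, E); F, A⟯) :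
    VectorFields E M :=
  ⟨fun x ↦ 𝒜.anchor x (a x), 𝒜.contMDiff_anchor.comp a.contMDiff⟩

theorem LieAlgebroid.anchorSec_apply (𝒜 : LieAlgebroid E F A) (a : Cₛ^∞⟮𝓘(ℝ, E); F, A⟯) (x : M) :
    𝒜.anchorSec a x = 𝒜.anchor x (a x) := rfl

theorem LieAlgebroid.anchorSec_bracket (𝒜 : LieAlgebroid E F A) (a b : Cₛ^∞⟮𝓘(ℝ, E); F, A⟯) :
    𝒜.anchorSec (𝒜.bracket a b) = lieBr (𝒜.anchorSec a) (𝒜.anchorSec b) := by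
  ext x
  exact 𝒜.anchor_bracket a b x

theorem LieAlgebroid.isDerivation_bracket (𝒜 : LieAlgebroid E F A) (a : Cₛ^∞⟮𝓘(ℝ, E); F, A⟯) :
    IsDerivation (𝒜.anchorSec a) (𝒜.bracket a) := by
  intro f b
  ext x
  exact 𝒜.leibniz a f b x

theorem LieAlgebroid.bracket_swap (𝒜 : LieAlgebroid E F A) (a b : Cₛ^∞⟮𝓘(ℝ, E); F, A⟯) :
    𝒜.bracket a b = -𝒜.bracket b a := by
  have h := 𝒜.bracket_self (a + b)
  simp only [map_add, LinearMap.add_apply, 𝒜.bracket_self, zero_add, add_zero] at h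
  exact eq_neg_of_add_eq_zero_right h

theorem LieAlgebroid.bracket_funSMul_left (𝒜 : LieAlgebroid E F A) (a b : Cₛ^∞⟮𝓘(ℝ, E); F, A⟯)
    (f : C^∞⟮𝓘(ℝ, E), M; ℝ⟯) :
    𝒜.bracket (funSMul f a) b =
      funSMul f (𝒜.bracket a b) - funSMul (der (𝒜.anchorSec b) f) a := by
  rw [𝒜.bracket_swap, 𝒜.isDerivation_bracket b f a, 𝒜.bracket_swap b a]
  ext x
  change -(f x • -(𝒜.bracket a b x) + _) = _ - _
  rw [smul_neg, neg_add, neg_neg, sub_eq_add_neg]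
  rfl

end LieDerivatives

/-! ### Line bundles presented by their sections -/

section Lines

variable {E : Type*} [NormedAddCommGroup E] [NormedSpace ℝ E]
  {M : Type*} [TopologicalSpace M] [ChartedSpace E M]
  {L : M → Type*} [∀ x, AddCommGroup (L x)] [∀ x, Module ℝ (L x)]
  {L' : M → Type*} [∀ x, AddCommGroup (L' x)] [∀ x, Module ℝ (L' x)]

/-- A section space which is the space of sections of a line bundle. -/
structure IsLine (S : SectionSpace E L) : Prop where
  frame : ∀ x, ∃ s ∈ S.carrier, (∀ᶠ y in 𝓝 x, s y ≠ 0) ∧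
    ∀ t ∈ S.carrier, ∃ f : C^∞⟮𝓘(ℝ, E), M; ℝ⟯, ∀ᶠ y in 𝓝 x, t y = f y • s y
  mem_of_local : ∀ s : ∀ x, L x, (∀ x, ∃ t ∈ S.carrier, ∀ᶠ y in 𝓝 x, s y = t y) → s ∈ S.carrier

/-- Being a multiple of one fixed generator near `x` passes to combinations and depends only on
germs, so it is enough to check it on generators. -/
theorem SectionSpace.isLine_generate {G : Set (∀ x : M, L x)}
    (hG : ∀ x, ∃ g ∈ G, (∀ᶠ y in 𝓝 x, g y ≠ 0) ∧
      ∀ g' ∈ G, ∃ f : C^∞⟮𝓘(ℝ, E), M; ℝ⟯, ∀ᶠ y in 𝓝 x, g' y = f y • g y) :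
    IsLine (SectionSpace.generate E G) where
  frame x := by
    obtain ⟨g, hg, hne, hr⟩ := hG x
    refine ⟨g, SectionSpace.generate_mem hg, hne, fun t ht ↦ ?_⟩
    obtain ⟨c, hc, htc⟩ := ht x
    suffices h : ∃ f : C^∞⟮𝓘(ℝ, E), M; ℝ⟯, ∀ᶠ y in 𝓝 x, c y = f y • g y by
      obtain ⟨f, hf⟩ := h
      refine ⟨f, ?_⟩
      filter_upwards [htc, hf] with y h1 h2
      rw [h1, h2]
    induction hc using Submodule.span_induction generalizing t with
    | mem c hc =>
      obtain ⟨f, g', hg', rfl⟩ := hc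
      obtain ⟨k, hk⟩ := hr g' hg'
      exact ⟨f * k, hk.mono fun y hy ↦ by simp [hy, mul_smul]⟩
    | zero => exact ⟨0, Eventually.of_forall fun y ↦ by simp⟩
    | add c c' hc hc' h h' =>
      obtain ⟨f, hf⟩ := h c (fun y ↦ ⟨c, hc, Eventually.of_forall fun _ ↦ rfl⟩)
        (Eventually.of_forall fun _ ↦ rfl)
      obtain ⟨f', hf'⟩ := h' c' (fun y ↦ ⟨c', hc', Eventually.of_forall fun _ ↦ rfl⟩)
        (Eventually.of_forall fun _ ↦ rfl)
      refine ⟨f + f', ?_⟩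
      filter_upwards [hf, hf'] with y h1 h2
      simp [h1, h2, add_smul]
    | smul r c hc h =>
      obtain ⟨f, hf⟩ := h c (fun y ↦ ⟨c, hc, Eventually.of_forall fun _ ↦ rfl⟩)
        (Eventually.of_forall fun _ ↦ rfl)
      exact ⟨r • f, hf.mono fun y hy ↦ by simp [hy, mul_smul]⟩
  mem_of_local s hs x := by
    obtain ⟨t, ht, hst⟩ := hs x
    obtain ⟨c, hc, htc⟩ := ht x
    exact ⟨c, hc, by filter_upwards [hst, htc] with y h1 h2; rw [h1, h2]⟩

theorem IsLine.pullback {E' : Type*} [NormedAddCommGroup E'] [NormedSpace ℝ E']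
    {N : Type*} [TopologicalSpace N] [ChartedSpace E' N]
    {K : N → Type*} [∀ x, AddCommGroup (K x)] [∀ x, Module ℝ (K x)]
    {S : SectionSpace E' K} (hS : IsLine S) {φ : M → N} (hφ : ContMDiff 𝓘(ℝ, E) 𝓘(ℝ, E') ∞ φ) :
    IsLine (S.pullback E φ) := by
  refine SectionSpace.isLine_generate fun x ↦ ?_
  obtain ⟨s, hs, hne, hr⟩ := hS.frame (φ x)
  have hc := hφ.continuous.continuousAt (x := x)
  refine ⟨_, ⟨s, hs, rfl⟩, hc.eventually hne, ?_⟩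
  rintro _ ⟨t, ht, rfl⟩
  obtain ⟨f, hf⟩ := hr t ht
  exact ⟨⟨fun m ↦ f (φ m), f.contMDiff.comp hφ⟩, hc.eventually hf⟩

theorem tmul_ne_zero_of_ne_zero {X Y : Type*} [AddCommGroup X] [Module ℝ X] [AddCommGroup Y] [Module ℝ Y]
    {x : X} {y : Y} (hx : x ≠ 0) (hy : y ≠ 0) : x ⊗ₜ[ℝ] y ≠ 0 := by
  intro h
  refine hx ((Module.forall_dual_apply_eq_zero_iff ℝ x).1 fun l ↦ ?_)
  have h' := congrArg ((TensorProduct.lid ℝ Y).toLinearMap.comp (LinearMap.rTensor Y l)) h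
  have h'' : l x • y = 0 := by simpa using h'
  exact (smul_eq_zero.1 h'').resolve_right hy

theorem IsLine.tensor {S : SectionSpace E L} {S' : SectionSpace E L'} (hS : IsLine S)
    (hS' : IsLine S') : IsLine (S.tensor S') := by
  refine SectionSpace.isLine_generate fun x ↦ ?_
  obtain ⟨s, hs, hne, hr⟩ := hS.frame x
  obtain ⟨s', hs', hne', hr'⟩ := hS'.frame x
  refine ⟨_, ⟨s, hs, s', hs', rfl⟩, ?_, ?_⟩
  · filter_upwards [hne, hne'] with y h h'
    exact tmul_ne_zero_of_ne_zero h h'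
  · rintro _ ⟨t, ht, t', ht', rfl⟩
    obtain ⟨f, hf⟩ := hr t ht
    obtain ⟨f', hf'⟩ := hr' t' ht'
    refine ⟨f * f', ?_⟩
    filter_upwards [hf, hf'] with y h h'
    change t y ⊗ₜ[ℝ] t' y = (f y * f' y) • (s y ⊗ₜ[ℝ] s' y)
    rw [h, h', TensorProduct.smul_tmul_smul]

theorem SectionSpace.coe_funSMul (S : SectionSpace E L) (f : C^∞⟮𝓘(ℝ, E), M; ℝ⟯) (s : S.carrier)
    (x : M) : (S.funSMul f s).1 x = f x • s.1 x := rfl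

theorem SectionSpace.coe_add (S : SectionSpace E L) (s t : S.carrier)
    (x : M) : (s + t).1 x = s.1 x + t.1 x := rfl

theorem SectionSpace.coe_sub (S : SectionSpace E L) (s t : S.carrier)
    (x : M) : (s - t).1 x = s.1 x - t.1 x := rfl

variable [FiniteDimensional ℝ E] [IsManifold 𝓘(ℝ, E) ∞ M] [T2Space M]

/-- A section which does not vanish at `x` is a local frame. -/
theorem IsLine.ratio {S : SectionSpace E L} (hS : IsLine S) {s : S.carrier} {x : M}
    (hs : s.1 x ≠ 0) : (∀ᶠ y in 𝓝 x, s.1 y ≠ 0) ∧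
      ∀ t : S.carrier, ∃ f : C^∞⟮𝓘(ℝ, E), M; ℝ⟯, ∀ᶠ y in 𝓝 x, t.1 y = f y • s.1 y := by
  obtain ⟨s₀, -, hne, hr⟩ := hS.frame x
  obtain ⟨h, hh⟩ := hr s.1 s.2
  have hx : h x ≠ 0 := by
    intro h0
    apply hs
    rw [hh.self_of_nhds, h0, zero_smul]
  constructor
  · filter_upwards [hh, hne, eventually_ne_zero hx] with y h1 h2 h3
    rw [h1]
    exact smul_ne_zero h3 h2
  · intro t
    obtain ⟨k, hk⟩ := hr t.1 t.2
    obtain ⟨h', hh'⟩ := exists_local_inverse hx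
    refine ⟨k * h', ?_⟩
    filter_upwards [hh, hk, hh'] with y h1 h2 h3
    rw [h1, h2, smul_smul]
    congr 1
    change k y = k y * h' y * h y
    rw [mul_assoc, mul_comm (h' y), h3, mul_one]

theorem IsLine.exists_ne_zero {S : SectionSpace E L} (hS : IsLine S) (x : M) :
    ∃ s : S.carrier, s.1 x ≠ 0 :=
  let ⟨s, hs, hne, _⟩ := hS.frame x
  ⟨⟨s, hs⟩, hne.self_of_nhds⟩

end Lines

/-! ### Connections on line bundles -/

section Connections

variable {E : Type*} [NormedAddCommGroup E] [NormedSpace ℝ E] [FiniteDimensional ℝ E]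
  {M : Type*} [TopologicalSpace M] [ChartedSpace E M] [IsManifold 𝓘(ℝ, E) ∞ M] [T2Space M]
  {F : Type*} [NormedAddCommGroup F] [NormedSpace ℝ F] [FiniteDimensional ℝ F]
  {A : M → Type*} [TopologicalSpace (TotalSpace F A)] [∀ x, TopologicalSpace (A x)]
  [∀ x, AddCommGroup (A x)] [∀ x, Module ℝ (A x)] [FiberBundle F A] [VectorBundle ℝ F A]
  [ContMDiffVectorBundle ∞ F A 𝓘(ℝ, E)]
  {L : M → Type*} [∀ x, AddCommGroup (L x)] [∀ x, Module ℝ (L x)]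
  {L' : M → Type*} [∀ x, AddCommGroup (L' x)] [∀ x, Module ℝ (L' x)]

/-- A (not necessarily flat) `A`-connection on `L`. -/
structure IsConnection (𝒜 : LieAlgebroid E F A) (S : SectionSpace E L)
    (D : Cₛ^∞⟮𝓘(ℝ, E); F, A⟯ → S.carrier → S.carrier) : Prop where
  add_left : ∀ a a' s, D (a + a') s = D a s + D a' s
  add_right : ∀ a s s', D a (s + s') = D a s + D a s'
  smul_right : ∀ a (c : ℝ) s, D a (c • s) = c • D a s
  fun_smul_left : ∀ (f : C^∞⟮𝓘(ℝ, E), M; ℝ⟯) a s, D (funSMul f a) s = S.funSMul f (D a s)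
  leibniz : ∀ a (f : C^∞⟮𝓘(ℝ, E), M; ℝ⟯) s x,
    (D a (S.funSMul f s)).1 x = f x • (D a s).1 x + dirDeriv f x (𝒜.anchor x (a x)) • s.1 x

variable {𝒜 : LieAlgebroid E F A} {S : SectionSpace E L}
  {D : Cₛ^∞⟮𝓘(ℝ, E); F, A⟯ → S.carrier → S.carrier}

theorem IsRepresentation.isConnection (hD : IsRepresentation 𝒜 S D) : IsConnection 𝒜 S D :=
  ⟨hD.add_left, hD.add_right, hD.smul_right, hD.fun_smul_left, hD.leibniz⟩

theorem IsConnection.congr_left (hD : IsConnection 𝒜 S D) {a a' : Cₛ^∞⟮𝓘(ℝ, E); F, A⟯} {x : M}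
    (h : a x = a' x) (s : S.carrier) : (D a s).1 x = (D a' s).1 x :=
  tensorial_congr (fun a ↦ (D a s).1 x) (fun a b ↦ by rw [hD.add_left]; rfl)
    (fun f a ↦ by rw [hD.fun_smul_left]; rfl) h

/-- With `ψ` vanishing near `x` and `ψ (s - s') = s - s'`, the Leibniz rule gives `0` for the
derivative of `s - s'` at `x`. -/
theorem IsConnection.congr_right (hD : IsConnection 𝒜 S D) (a : Cₛ^∞⟮𝓘(ℝ, E); F, A⟯) {x : M}
    {s s' : S.carrier} (h : ∀ᶠ y in 𝓝 x, s.1 y = s'.1 y) : (D a s).1 x = (D a s').1 x := by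
  obtain ⟨ψ, h0, h1⟩ := exists_cutoff (E := E) h
  have h2 : S.funSMul ψ (s - s') = s - s' := by
    refine Subtype.ext (funext fun y ↦ ?_)
    change ψ y • (s.1 y - s'.1 y) = s.1 y - s'.1 y
    by_cases hy : s.1 y = s'.1 y
    · rw [hy, sub_self, smul_zero]
    · rw [h1 y hy, one_smul]
  have h3 := hD.leibniz a ψ (s - s') x
  rw [h2, h0.self_of_nhds, dirDeriv_congr (g := fun _ ↦ 0) h0, dirDeriv_const, zero_smul, zero_smul,
    add_zero] at h3
  have h4 := congrArg (fun t : S.carrier ↦ t.1 x) (hD.add_right a (s - s') s')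
  simp only [sub_add_cancel] at h4
  rw [h4, SectionSpace.coe_add, h3, zero_add]

theorem IsConnection.apply_of_eq_smul (hD : IsConnection 𝒜 S D) (a : Cₛ^∞⟮𝓘(ℝ, E); F, A⟯) {x : M}
    {s t : S.carrier} {f : C^∞⟮𝓘(ℝ, E), M; ℝ⟯} (h : ∀ᶠ y in 𝓝 x, s.1 y = f y • t.1 y) :
    (D a s).1 x = f x • (D a t).1 x + dirDeriv f x (𝒜.anchor x (a x)) • t.1 x := by
  rw [← hD.leibniz]
  exact hD.congr_right a h

/-- Flatness can be checked on local frames. -/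
theorem IsConnection.isRepresentation (hD : IsConnection 𝒜 S D) (hS : IsLine S)
    (h : ∀ a a' x, ∃ s : S.carrier, s.1 x ≠ 0 ∧
      (D a (D a' s)).1 x - (D a' (D a s)).1 x = (D (𝒜.bracket a a') s).1 x) :
    IsRepresentation 𝒜 S D := by
  refine ⟨hD.add_left, hD.add_right, hD.smul_right, hD.fun_smul_left, hD.leibniz,
    fun a a' t ↦ Subtype.ext (funext fun x ↦ ?_)⟩
  obtain ⟨s, hs, hflat⟩ := h a a' x
  obtain ⟨f, hf⟩ := (hS.ratio hs).2 t
  -- In the second derivative of `f s` the cross terms are symmetric in `a`, `a'`; the commutator of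
  -- the second derivatives of `f` is the derivative along `ρ [a, a']`.
  have key : ∀ a a', (D a (D a' t)).1 x = f x • (D a (D a' s)).1 x +
      dirDeriv f x (𝒜.anchor x (a x)) • (D a' s).1 x +
      (dirDeriv f x (𝒜.anchor x (a' x)) • (D a s).1 x +
      dirDeriv (der (𝒜.anchorSec a') f) x (𝒜.anchor x (a x)) • s.1 x) := by
    intro a a'
    have h1 : ∀ᶠ y in 𝓝 x, (D a' t).1 y =
        (S.funSMul f (D a' s) + S.funSMul (der (𝒜.anchorSec a') f) s).1 y :=
      hf.eventually_nhds.mono fun y hy ↦ hD.apply_of_eq_smul a' hy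
    rw [hD.congr_right a h1, hD.add_right, SectionSpace.coe_add, hD.leibniz, hD.leibniz]
    rfl
  rw [SectionSpace.coe_sub, key a a', key a' a, hD.apply_of_eq_smul _ hf, ← hflat]
  have h2 := dirDeriv_lieBr (𝒜.anchorSec a) (𝒜.anchorSec a') f x
  rw [← 𝒜.anchorSec_bracket] at h2
  simp only [𝒜.anchorSec_apply] at h2
  rw [h2]
  module

/-- Construction of a connection from its values on a family of sections containing local frames. -/
theorem exists_connection (𝒜 : LieAlgebroid E F A) (hS : IsLine S) {ι : Type*} (g : ι → S.carrier)
    (δ : Cₛ^∞⟮𝓘(ℝ, E); F, A⟯ → ι → S.carrier) (hg : ∀ x, ∃ i, (g i).1 x ≠ 0)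
    (hδ : ∀ a i j x (f : C^∞⟮𝓘(ℝ, E), M; ℝ⟯), (g j).1 x ≠ 0 →
      (∀ᶠ y in 𝓝 x, (g i).1 y = f y • (g j).1 y) →
      (δ a i).1 x = f x • (δ a j).1 x + dirDeriv f x (𝒜.anchor x (a x)) • (g j).1 x)
    (hadd : ∀ a a' i, δ (a + a') i = δ a i + δ a' i)
    (hsmul : ∀ f a i, δ (funSMul f a) i = S.funSMul f (δ a i)) :
    ∃ D, IsConnection 𝒜 S D ∧ ∀ a i, D a (g i) = δ a i := by
  choose i hi using hg
  choose f hf using fun x (s : S.carrier) ↦ (hS.ratio (hi x)).2 s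
  let D₀ : Cₛ^∞⟮𝓘(ℝ, E); F, A⟯ → S.carrier → ∀ x, L x := fun a s x ↦
    f x s x • (δ a (i x)).1 x + dirDeriv (f x s) x (𝒜.anchor x (a x)) • (g (i x)).1 x
  -- The value does not depend on the member of the family used as a frame, which is what `hδ`
  -- ensures. In particular one frame can be kept on a neighbourhood, whence smoothness.
  have key : ∀ a s x j (h : C^∞⟮𝓘(ℝ, E), M; ℝ⟯), (g j).1 x ≠ 0 →
      (∀ᶠ y in 𝓝 x, s.1 y = h y • (g j).1 y) →
      D₀ a s x = h x • (δ a j).1 x + dirDeriv h x (𝒜.anchor x (a x)) • (g j).1 x := by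
    intro a s x j h hj hh
    obtain ⟨hne, hr⟩ := hS.ratio hj
    obtain ⟨k, hk⟩ := hr (g (i x))
    have h1 : (h : M → ℝ) =ᶠ[𝓝 x] fun y ↦ f x s y * k y := by
      filter_upwards [hne, hk, hh, hf x s] with y h1 h2 h3 h4
      rw [h3, h2, smul_smul] at h4
      exact smul_left_injective ℝ h1 h4
    simp only [D₀]
    rw [hδ a (i x) j x k hj hk, dirDeriv_congr h1,
      dirDeriv_mul (f x s).contMDiff.contMDiffAt k.contMDiff.contMDiffAt, h1.self_of_nhds,
      hk.self_of_nhds]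
    module
  have hmem : ∀ a s, D₀ a s ∈ S.carrier := by
    intro a s
    refine hS.mem_of_local _ fun x ↦ ?_
    refine ⟨(S.funSMul (f x s) (δ a (i x)) +
      S.funSMul (der (𝒜.anchorSec a) (f x s)) (g (i x))).1, Subtype.property _, ?_⟩
    filter_upwards [(hS.ratio (hi x)).1, (hf x s).eventually_nhds] with y h1 h2
    exact key a s y (i x) (f x s) h1 h2
  refine ⟨fun a s ↦ ⟨D₀ a s, hmem a s⟩, ⟨?_, ?_, ?_, ?_, ?_⟩, ?_⟩
  · intro a a' s
    refine Subtype.ext (funext fun x ↦ ?_)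
    change D₀ _ _ x = D₀ _ _ x + D₀ _ _ x
    simp only [D₀]
    rw [hadd, SectionSpace.coe_add, ContMDiffSection.coe_add, Pi.add_apply, map_add,
      dirDeriv_add_right]
    module
  · intro a s s'
    refine Subtype.ext (funext fun x ↦ ?_)
    change D₀ _ _ x = D₀ _ _ x + D₀ _ _ x
    rw [key a (s + s') x (i x) (f x s + f x s') (hi x)]
    · simp only [D₀]
      have := dirDeriv_add (f x s).contMDiff (f x s').contMDiff x (𝒜.anchor x (a x))
      change (f x s x + f x s' x) • _ + dirDeriv (fun y ↦ f x s y + f x s' y) x _ • _ = _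
      rw [this]
      module
    · filter_upwards [hf x s, hf x s'] with y h1 h2
      rw [SectionSpace.coe_add, h1, h2]
      exact (add_smul _ _ _).symm
  · intro a c s
    refine Subtype.ext (funext fun x ↦ ?_)
    change D₀ _ _ x = c • D₀ _ _ x
    rw [key a (c • s) x (i x) (c • f x s) (hi x)]
    · simp only [D₀]
      have := dirDeriv_const_mul c (f x s).contMDiff x (𝒜.anchor x (a x))
      change (c * f x s x) • _ + dirDeriv (fun y ↦ c * f x s y) x _ • _ = _
      rw [this]
      module
    · filter_upwards [hf x s] with y h1
      change c • s.1 y = (c * f x s y) • _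
      rw [h1, mul_smul]
  · intro h a s
    refine Subtype.ext (funext fun x ↦ ?_)
    change D₀ _ _ x = h x • D₀ _ _ x
    simp only [D₀]
    rw [hsmul, SectionSpace.coe_funSMul, funSMul_apply, map_smul, dirDeriv_smul_right]
    module
  · intro a h s x
    change D₀ _ _ x = h x • D₀ _ _ x + _
    rw [key a (S.funSMul h s) x (i x) (h * f x s) (hi x)]
    · simp only [D₀]
      have := dirDeriv_mul (h.contMDiff.contMDiffAt (x := x)) (f x s).contMDiff.contMDiffAt
        (𝒜.anchor x (a x))
      change (h x * f x s x) • _ + dirDeriv (fun y ↦ h y * f x s y) x _ • _ = _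
      rw [this, (hf x s).self_of_nhds]
      module
    · filter_upwards [hf x s] with y h1
      change h y • s.1 y = (h y * f x s y) • _
      rw [h1, mul_smul]
  · intro a j
    refine Subtype.ext (funext fun x ↦ ?_)
    exact (hδ a j (i x) x (f x (g j)) (hi x) (hf x (g j))).symm

theorem SectionSpace.coe_tmul (S : SectionSpace E L) (S' : SectionSpace E L') (y : S.carrier)
    (z : S'.carrier) (x : M) : (S.tmul S' y z).1 x = y.1 x ⊗ₜ[ℝ] z.1 x := rfl

/-- The product rule prescribes the connection on decomposable sections, which contain local frames.
In the curvature, the terms where `D` and `D'` act on different factors cancel. -/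
theorem exists_isTensorRep {S' : SectionSpace E L'} (hS : IsLine S) (hS' : IsLine S')
    {D' : Cₛ^∞⟮𝓘(ℝ, E); F, A⟯ → S'.carrier → S'.carrier} (hD : IsRepresentation 𝒜 S D)
    (hD' : IsRepresentation 𝒜 S' D') : ∃ D'', IsTensorRep 𝒜 S S' D D' D'' := by
  have hne : ∀ {y : S.carrier} {z : S'.carrier} {x}, (S.tmul S' y z).1 x ≠ 0 →
      y.1 x ≠ 0 ∧ z.1 x ≠ 0 := by
    intro y z x h
    constructor <;> intro h0 <;> apply h <;> rw [SectionSpace.coe_tmul, h0]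
    · exact TensorProduct.zero_tmul _ _
    · exact TensorProduct.tmul_zero _ _
  have hex : ∃ D'', IsConnection 𝒜 (S.tensor S') D'' ∧ ∀ a (i : S.carrier × S'.carrier),
      D'' a (S.tmul S' i.1 i.2) = S.tmul S' (D a i.1) i.2 + S.tmul S' i.1 (D' a i.2) := by
    refine exists_connection 𝒜 (hS.tensor hS')
      (fun i : S.carrier × S'.carrier ↦ S.tmul S' i.1 i.2)
      (fun a i ↦ S.tmul S' (D a i.1) i.2 + S.tmul S' i.1 (D' a i.2)) ?_ ?_ ?_ ?_
    · intro x
      obtain ⟨y, hy⟩ := hS.exists_ne_zero x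
      obtain ⟨z, hz⟩ := hS'.exists_ne_zero x
      exact ⟨(y, z), tmul_ne_zero_of_ne_zero hy hz⟩
    · rintro a ⟨y', z'⟩ ⟨y, z⟩ x f h hf
      obtain ⟨hy, hz⟩ := hne h
      obtain ⟨hy1, hy2⟩ := hS.ratio hy
      obtain ⟨hz1, hz2⟩ := hS'.ratio hz
      obtain ⟨p, hp⟩ := hy2 y'
      obtain ⟨q, hq⟩ := hz2 z'
      -- The ratio of two decomposable sections is the product of the ratios of their factors, so
      -- compatibility is the product rule for functions.
      have h1 : (f : M → ℝ) =ᶠ[𝓝 x] fun w ↦ p w * q w := by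
        filter_upwards [hy1, hz1, hp, hq, hf] with w h1 h2 h3 h4 h5
        simp only [SectionSpace.coe_tmul, h3, h4, TensorProduct.smul_tmul_smul] at h5
        exact (smul_left_injective ℝ (tmul_ne_zero_of_ne_zero h1 h2) h5).symm
      simp only [SectionSpace.coe_add, SectionSpace.coe_tmul]
      rw [hD.isConnection.apply_of_eq_smul a hp, hD'.isConnection.apply_of_eq_smul a hq,
        hp.self_of_nhds, hq.self_of_nhds, dirDeriv_congr h1, dirDeriv_mul
        p.contMDiff.contMDiffAt q.contMDiff.contMDiffAt, h1.self_of_nhds]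
      simp only [TensorProduct.add_tmul, TensorProduct.tmul_add,
        ← TensorProduct.smul_tmul', TensorProduct.tmul_smul]
      module
    · intro a a' i
      refine Subtype.ext (funext fun x ↦ ?_)
      simp only [SectionSpace.coe_add, SectionSpace.coe_tmul, hD.add_left, hD'.add_left,
        TensorProduct.add_tmul, TensorProduct.tmul_add]
      abel
    · intro f a i
      refine Subtype.ext (funext fun x ↦ ?_)
      simp only [SectionSpace.coe_add, SectionSpace.coe_tmul, hD.fun_smul_left, hD'.fun_smul_left,
        SectionSpace.coe_funSMul, TensorProduct.smul_tmul', TensorProduct.tmul_smul, smul_add]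
  obtain ⟨D'', hc, hD''⟩ := hex
  have hD''' : ∀ a y z, D'' a (S.tmul S' y z) =
    S.tmul S' (D a y) z + S.tmul S' y (D' a z) := fun a y z ↦ hD'' a (y, z)
  refine ⟨D'', hc.isRepresentation (hS.tensor hS') ?_, hD'''⟩
  intro a a' x
  obtain ⟨y, hy⟩ := hS.exists_ne_zero x
  obtain ⟨z, hz⟩ := hS'.exists_ne_zero x
  refine ⟨S.tmul S' y z, tmul_ne_zero_of_ne_zero hy hz, ?_⟩
  simp only [hD''', hc.add_right, SectionSpace.coe_add, SectionSpace.coe_tmul]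
  rw [← hD.flat, ← hD'.flat, SectionSpace.coe_sub, SectionSpace.coe_sub, TensorProduct.sub_tmul,
    TensorProduct.tmul_sub]
  abel

end Connections

/-! ### Finite sums of sections -/

section SectionSums

variable {E : Type*} [NormedAddCommGroup E] [NormedSpace ℝ E]
  {M : Type*} [TopologicalSpace M] [ChartedSpace E M]
  {L : M → Type*} [∀ x, AddCommGroup (L x)] [∀ x, Module ℝ (L x)]

theorem smul_cancel_right {X : Type*} [AddCommGroup X] [Module ℝ X] {a b : ℝ} {z : X} (hz : z ≠ 0)
    (h : a • z = b • z) : a = b := smul_left_injective ℝ hz h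

theorem SectionSpace.sum_apply (S : SectionSpace E L) {ι : Type*} (t : Finset ι)
    (s : ι → S.carrier) (x : M) : (∑ i ∈ t, s i).1 x = ∑ i ∈ t, (s i).1 x := by
  rw [Submodule.coe_sum, Finset.sum_apply]

theorem map_sum_of_add {X Y ι : Type*} [AddCommGroup X] [AddCommGroup Y] {f : X → Y}
    (hf : ∀ x y, f (x + y) = f x + f y) (t : Finset ι) (x : ι → X) :
    f (∑ i ∈ t, x i) = ∑ i ∈ t, f (x i) := map_sum (AddMonoidHom.mk' f hf) x t

theorem SectionSpace.map_sum {S : SectionSpace E L} {f : S.carrier → S.carrier}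
    (hf : ∀ s t, f (s + t) = f s + f t) {ι : Type*} (t : Finset ι) (s : ι → S.carrier) :
    f (∑ i ∈ t, s i) = ∑ i ∈ t, f (s i) := map_sum_of_add hf t s

end SectionSums

/-! ### Existence of the canonical representation -/

section CanonicalRep

variable {E : Type*} [NormedAddCommGroup E] [NormedSpace ℝ E] [FiniteDimensional ℝ E]
  {M : Type*} [TopologicalSpace M] [ChartedSpace E M] [IsManifold 𝓘(ℝ, E) ∞ M] [T2Space M]
  {F : Type*} [NormedAddCommGroup F] [NormedSpace ℝ F] [FiniteDimensional ℝ F]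
  {A : M → Type*} [TopologicalSpace (TotalSpace F A)] [∀ x, TopologicalSpace (A x)]
  [∀ x, AddCommGroup (A x)] [∀ x, Module ℝ (A x)] [FiberBundle F A] [VectorBundle ℝ F A]
  [ContMDiffVectorBundle ∞ F A 𝓘(ℝ, E)]

instance finite_tangentSpace (x : M) : Module.Finite ℝ (TangentSpace 𝓘(ℝ, E) x) :=
  inferInstanceAs (Module.Finite ℝ E)

theorem finrank_tangentSpace (x : M) : finrank ℝ (TangentSpace 𝓘(ℝ, E) x) = finrank ℝ E := rfl

/-- The value at `x` of `(a₁ ∧ … ∧ a_p) ⊗ μ`, as a multilinear map. -/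
def wedgeTmulMultilinear (μ : TopForm E M) (x : M) :
    MultilinearMap ℝ (fun _ : Fin (finrank ℝ F) ↦ Cₛ^∞⟮𝓘(ℝ, E); F, A⟯) (CanonicalFiber E F A x) :=
  ((TensorProduct.mk ℝ _ _).flip (μ.1 x)).compMultilinearMap
    ((exteriorPower.ιMulti ℝ (finrank ℝ F)).toMultilinearMap.compLinearMap fun _ ↦ evalSec x)

/-- This is the trace of the rank-one correction in `[f a, t_i] = f [a, t_i] - (ρ(t_i) f) a`. -/
theorem sum_anchor_update {𝒜 : LieAlgebroid E F A} {t : Fin (finrank ℝ F) → Cₛ^∞⟮𝓘(ℝ, E); F, A⟯}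
    {vol : Form E F A (finrank ℝ F)} {x : M} (h : vol.1 x (fun i ↦ t i x) = 1) (v : A x)
    (f : M → ℝ) :
    ∑ i, dirDeriv f x (𝒜.anchor x (t i x)) * vol.1 x (Function.update (fun i ↦ t i x) i v) =
      dirDeriv f x (𝒜.anchor x v) := by
  conv_rhs => rw [frame_expansion h v]
  rw [map_sum]
  simp only [map_smul]
  rw [show ∀ w, dirDeriv f x w = mfderiv 𝓘(ℝ, E) 𝓘(ℝ, ℝ) f x w from fun _ ↦ rfl, map_sum]
  refine Finset.sum_congr rfl fun i _ ↦ ?_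
  rw [mul_comm]
  exact (dirDeriv_smul_right f x _ _).symm

theorem sum_dirDeriv_update {X : Fin (finrank ℝ E) → VectorFields E M}
    {μ : TopForm E M} {x : M} (h : μ.1 x (fun i ↦ X i x) = 1) (v : TangentSpace 𝓘(ℝ, E) x)
    (f : M → ℝ) :
    ∑ i, dirDeriv f x (X i x) * μ.1 x (Function.update (fun i ↦ X i x) i v) =
      dirDeriv f x v := by
  conv_rhs => rw [frame_expansion h v]
  rw [show ∀ w, dirDeriv f x w = mfderiv 𝓘(ℝ, E) 𝓘(ℝ, ℝ) f x w from fun _ ↦ rfl, map_sum]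
  refine Finset.sum_congr rfl fun i _ ↦ ?_
  rw [mul_comm]
  exact (dirDeriv_smul_right f x _ _).symm

theorem lieBr_swap (u v : VectorFields E M) : lieBr u v = -lieBr v u := by
  ext x
  exact VectorField.mlieBracket_swap_apply

/-- Coordinates on the canonical line bundle near a point. -/
theorem exists_canonical_coord (𝒜 : LieAlgebroid E F A) (x : M) :
    ∃ (P : CanonicalFiber E F A x →ₗ[ℝ] ℝ) (s₀ : (canonicalLine E F A).carrier)
      (G : (Fin (finrank ℝ F) → Cₛ^∞⟮𝓘(ℝ, E); F, A⟯) → TopForm E M → C^∞⟮𝓘(ℝ, E), M; ℝ⟯)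
      (k : Cₛ^∞⟮𝓘(ℝ, E); F, A⟯ → ℝ),
      Function.Injective P ∧ P (s₀.1 x) = 1 ∧ (∀ᶠ y in 𝓝 x, s₀.1 y ≠ 0) ∧
      (∃ t μ, s₀ = wedgeTmulSec t μ) ∧
      (∀ b μ, ∀ᶠ y in 𝓝 x, wedgeTmul b μ y = G b μ y • s₀.1 y) ∧
      (∀ a a', k (a + a') = k a + k a') ∧ (∀ f a, k (funSMul f a) = f x * k a) ∧
      ∀ a b μ μ', IsLieDerivative (𝒜.anchorSec a) μ μ' →
        P (∑ i, wedgeTmul (Function.update b i (𝒜.bracket a (b i))) μ x + wedgeTmul b μ' x) =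
          dirDeriv (G b μ) x (𝒜.anchor x (a x)) - k a * G b μ x := by
  obtain ⟨t, vol, ht⟩ := exists_frame E F A x
  obtain ⟨X, τ, hX⟩ := exists_frame E E (fun x : M ↦ TangentSpace 𝓘(ℝ, E) x) x
  have hx := ht.self_of_nhds
  have hXx := hX.self_of_nhds
  -- The coordinate dual to `s₀`: evaluate the form on `X`, then the multivector with `vol`.
  let P : ∀ y, CanonicalFiber E F A y →ₗ[ℝ] ℝ := fun y ↦
    (wedgeLift (vol.1 y)).comp (evalForm _ (fun i ↦ X i y))
  have hP : ∀ b (μ : TopForm E M) y, P y (wedgeTmul b μ y) =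
      vol.1 y (fun i ↦ b i y) * μ.1 y (fun i ↦ X i y) := by
    intro b μ y
    simp only [P, wedgeTmul, LinearMap.comp_apply, evalForm_tmul, map_smul, wedgeLift_ιMulti,
      smul_eq_mul]
    rw [mul_comm]
  let s₀ := wedgeTmulSec t τ
  have hcoord : ∀ y, vol.1 y (fun i ↦ t i y) = 1 → τ.1 y (fun i ↦ X i y) = 1 →
      ∀ z : CanonicalFiber E F A y, z = P y z • s₀.1 y := by
    intro y h1 h2 z
    have := finite_fiber F A y
    conv_lhs => rw [eq_evalForm_tmul (finrank_tangentSpace y) h2 z,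
      wedge_eq_smul (finrank_fiber F A y) (vol.1 y) h1 (evalForm _ _ z)]
    exact (TensorProduct.smul_tmul' _ _ _).symm
  let u := 𝒜.anchorSec
  -- The traces at `x`, in the frames `t` and `X`, of `[a, ·]` and (in `kM`) of the bracket with `ρ
  -- a`. Neither is linear over functions in `a`, but both have the same defect `-ρ(a) f`, so `kM -
  -- kA` is: the canonical connection is tensorial only on the tensor product of the two factors.
  let kA : Cₛ^∞⟮𝓘(ℝ, E); F, A⟯ → ℝ := fun a ↦
    ∑ i, vol.1 x (Function.update (fun j ↦ t j x) i (𝒜.bracket a (t i) x))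
  let kM : VectorFields E M → ℝ := fun u ↦
    ∑ i, τ.1 x (Function.update (fun j ↦ X j x) i (lieBr u (X i) x))
  refine ⟨P x, s₀, fun b μ ↦ vol.eval b * μ.eval X, fun a ↦ kM (u a) - kA a,
    ?_, ?_, ?_, ⟨t, τ, rfl⟩, ?_, ?_, ?_, ?_⟩
  · intro z z' h
    rw [hcoord x hx hXx z, hcoord x hx hXx z', h]
  · exact (hP t τ x).trans (by rw [hx, hXx, mul_one])
  · filter_upwards [ht, hX] with y h1 h2 h0
    have h3 := hP t τ y
    rw [h1, h2, mul_one, show wedgeTmul t τ y = 0 from h0, map_zero] at h3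
    exact zero_ne_one h3
  · intro b μ
    filter_upwards [ht, hX] with y h1 h2
    rw [hcoord y h1 h2 (wedgeTmul b μ y), hP]
    rfl
  · intro a a'
    have h1 : kA (a + a') = kA a + kA a' := by
      simp only [kA, ← Finset.sum_add_distrib]
      refine Finset.sum_congr rfl fun i _ ↦ ?_
      rw [map_add]
      exact (vol.1 x).map_update_add _ _ _ _
    have h2 : kM (u (a + a')) = kM (u a) + kM (u a') := by
      have h3 : u (a + a') = u a + u a' := by
        ext y
        exact (𝒜.anchor y).map_add _ _
      simp only [kM, ← Finset.sum_add_distrib, h3]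
      refine Finset.sum_congr rfl fun i _ ↦ ?_
      rw [map_add]
      exact (τ.1 x).map_update_add _ _ _ _
    change kM (u (a + a')) - kA (a + a') = kM (u a) - kA a + (kM (u a') - kA a')
    rw [h1, h2]
    ring
  · intro f a
    have h1 : kA (funSMul f a) = f x * kA a - dirDeriv f x (𝒜.anchor x (a x)) := by
      rw [← sum_anchor_update (𝒜 := 𝒜) hx (a x) f]
      simp only [kA, Finset.mul_sum, ← Finset.sum_sub_distrib]
      refine Finset.sum_congr rfl fun i _ ↦ ?_
      rw [𝒜.bracket_funSMul_left]
      change vol.1 x (Function.update _ i (f x • 𝒜.bracket a (t i) x -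
        dirDeriv f x (𝒜.anchor x (t i x)) • a x)) = _
      rw [(vol.1 x).map_update_sub, (vol.1 x).map_update_smul, (vol.1 x).map_update_smul]
      rfl
    have h2 : kM (u (funSMul f a)) = f x * kM (u a) - dirDeriv f x (𝒜.anchor x (a x)) := by
      have h3 : u (funSMul f a) = funSMul f (u a) := by
        ext y
        exact (𝒜.anchor y).map_smul _ _
      rw [← sum_dirDeriv_update hXx (𝒜.anchor x (a x)) f, h3]
      simp only [kM, Finset.mul_sum, ← Finset.sum_sub_distrib]
      refine Finset.sum_congr rfl fun i _ ↦ ?_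
      have h4 : lieBr (funSMul f (u a)) (X i) x =
          f x • lieBr (u a) (X i) x - dirDeriv f x (X i x) • u a x := by
        rw [lieBr_swap, lieBr_funSMul, lieBr_swap (X i)]
        change -(f x • -(lieBr (u a) (X i) x) + dirDeriv f x (X i x) • u a x) = _
        rw [smul_neg, neg_add, neg_neg, sub_eq_add_neg]
      rw [h4, (τ.1 x).map_update_sub, (τ.1 x).map_update_smul, (τ.1 x).map_update_smul]
      rfl
    change kM (u (funSMul f a)) - kA (funSMul f a) = f x * (kM (u a) - kA a)
    rw [h1, h2]
    ring
  · intro a b μ μ' hμ'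
    have := finite_fiber F A x
    -- The Lie derivative of `vol` is a multiple of `vol`, with factor `-kA a` at `x` since `vol` is
    -- constant on the frame. Evaluated on `b`, this computes the sum over the brackets `[a, b_i]`.
    obtain ⟨vol', hvol'⟩ := exists_lieDeriv (𝒜.isDerivation_bracket a) vol
    have h1 : dirDeriv (fun y ↦ vol.1 y (fun i ↦ t i y)) x (u a x) = 0 := by
      rw [dirDeriv_congr (g := fun _ ↦ 1) ht, dirDeriv_const]
    have h2 := hvol' t x
    rw [h1, zero_sub] at h2
    have h3 := alternating_smul_comm (finrank_fiber F A x) (vol.1 x) (vol'.1 x)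
      (fun i ↦ t i x) (fun i ↦ b i x)
    rw [hx, one_smul, hvol' b x, h2, smul_eq_mul] at h3
    have h4 := hμ' X x
    have h5 : ∀ v, μ.1 x v = τ.1 x v * μ.1 x (fun i ↦ X i x) := by
      intro v
      have := alternating_smul_comm (finrank_tangentSpace x) (τ.1 x) (μ.1 x) (fun i ↦ X i x) v
      rwa [hXx, one_smul, smul_eq_mul] at this
    have h6 : ∑ i, μ.1 x (Function.update (fun j ↦ X j x) i
        (VectorField.mlieBracket 𝓘(ℝ, E) (u a) (fun y ↦ X i y) x)) =
        kM (u a) * μ.1 x (fun i ↦ X i x) := by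
      simp only [kM, Finset.sum_mul]
      exact Finset.sum_congr rfl fun i _ ↦ h5 _
    rw [h6] at h4
    simp only [map_add, map_sum, hP, h4, update_sec_apply, ← Finset.sum_mul]
    have h7 := dirDeriv_mul ((vol.eval b).contMDiff.contMDiffAt (x := x))
      ((μ.eval X).contMDiff.contMDiffAt) (𝒜.anchor x (a x))
    change _ = dirDeriv (fun y ↦ vol.eval b y * μ.eval X y) x (𝒜.anchor x (a x)) -
      (kM (u a) - kA a) * (vol.eval b x * μ.eval X x)
    rw [h7]
    change _ = vol.1 x (fun i ↦ b i x) * dirDeriv (fun y ↦ μ.1 y (fun i ↦ X i y)) x (u a x) +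
      dirDeriv (fun y ↦ vol.1 y (fun i ↦ b i y)) x (u a x) * μ.1 x (fun i ↦ X i x) -
      (kM (u a) - kA a) * (vol.1 x (fun i ↦ b i x) * μ.1 x (fun i ↦ X i x))
    have h8 : dirDeriv (fun y ↦ vol.1 y (fun i ↦ b i y)) x (u a x) -
        ∑ i, vol.1 x (Function.update (fun j ↦ b j x) i (𝒜.bracket a (b i) x)) =
        vol.1 x (fun i ↦ b i x) * -kA a := h3
    linear_combination -μ.1 x (fun i ↦ X i x) * h8

variable (E F A) in
theorem isLine_canonicalLine (𝒜 : LieAlgebroid E F A) : IsLine (canonicalLine E F A) := by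
  refine SectionSpace.isLine_generate fun x ↦ ?_
  obtain ⟨P, s₀, G, k, -, -, hs₀, ⟨t, μ, rfl⟩, hG, -⟩ := exists_canonical_coord 𝒜 x
  refine ⟨wedgeTmul t μ, ⟨t, μ, rfl⟩, hs₀, ?_⟩
  rintro _ ⟨b, η, rfl⟩
  exact ⟨G b η, hG b η⟩

/-- In the coordinate of `exists_canonical_coord`, the prescribed derivative is `ρ(a) G - k(a) G`.
Compatibility with the Leibniz rule and linearity over functions in `a` can be read off; flatness
comes from the Jacobi identity and the commutator of Lie derivatives. -/
theorem exists_isCanonicalRep (𝒜 : LieAlgebroid E F A) : ∃ D, IsCanonicalRep 𝒜 D := by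
  have hline := isLine_canonicalLine E F A 𝒜
  choose Lie hLie using fun (u : VectorFields E M) (μ : TopForm E M) ↦ exists_isLieDerivative u μ
  let δ : Cₛ^∞⟮𝓘(ℝ, E); F, A⟯ → (Fin (finrank ℝ F) → Cₛ^∞⟮𝓘(ℝ, E); F, A⟯) × TopForm E M →
      (canonicalLine E F A).carrier := fun a i ↦
    ∑ j, wedgeTmulSec (Function.update i.1 j (𝒜.bracket a (i.1 j))) i.2 +
      wedgeTmulSec i.1 (Lie (𝒜.anchorSec a) i.2)
  have hδ : ∀ a i x, (δ a i).1 x =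
      ∑ j, wedgeTmul (Function.update i.1 j (𝒜.bracket a (i.1 j))) i.2 x +
        wedgeTmul i.1 (Lie (𝒜.anchorSec a) i.2) x := by
    intro a i x
    rw [SectionSpace.coe_add, SectionSpace.sum_apply]
    rfl
  have hcon : ∃ D, IsConnection 𝒜 (canonicalLine E F A) D ∧
      ∀ a i, D a (wedgeTmulSec i.1 i.2) = δ a i := by
    refine exists_connection 𝒜 hline (fun i ↦ wedgeTmulSec i.1 i.2) δ ?_ ?_ ?_ ?_
    · intro x
      obtain ⟨P, s₀, G, k, -, -, hs₀, ⟨t, μ, rfl⟩, -⟩ := exists_canonical_coord 𝒜 x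
      exact ⟨(t, μ), hs₀.self_of_nhds⟩
    · rintro a ⟨b', μ'⟩ ⟨b, μ⟩ x f hne hf
      obtain ⟨P, s₀, G, k, hP, hP1, hs₀, -, hG, -, -, hk⟩ := exists_canonical_coord 𝒜 x
      refine hP ?_
      rw [map_add, map_smul, map_smul, hδ, hδ, hk a b' μ' _ (hLie _ _), hk a b μ _ (hLie _ _)]
      have h1 : (G b' μ' : M → ℝ) =ᶠ[𝓝 x] fun y ↦ f y * G b μ y := by
        filter_upwards [hf, hs₀, hG b' μ', hG b μ] with y h1 h2 h3 h4
        change wedgeTmul b' μ' y = f y • wedgeTmul b μ y at h1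
        rw [h3, h4, smul_smul] at h1
        exact smul_cancel_right (X := CanonicalFiber E F A y) h2 h1
      have h2 : P ((wedgeTmulSec b μ).1 x) = G b μ x := by
        change P (wedgeTmul b μ x) = _
        rw [(hG b μ).self_of_nhds, map_smul, hP1, smul_eq_mul, mul_one]
      rw [h2, dirDeriv_congr h1, dirDeriv_mul f.contMDiff.contMDiffAt
        (G b μ).contMDiff.contMDiffAt, h1.self_of_nhds]
      simp only [smul_eq_mul]
      ring
    · rintro a a' ⟨b, μ⟩
      refine Subtype.ext (funext fun x ↦ ?_)
      obtain ⟨P, s₀, G, k, hP, hP1, hs₀, -, hG, hkadd, -, hk⟩ := exists_canonical_coord 𝒜 x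
      refine hP ?_
      change P ((δ (a + a') (b, μ)).1 x) = P ((δ a (b, μ)).1 x + (δ a' (b, μ)).1 x)
      rw [map_add, hδ, hδ, hδ, hk _ b μ _ (hLie _ _),
        hk _ b μ _ (hLie _ _), hk _ b μ _ (hLie _ _), hkadd, ContMDiffSection.coe_add,
        Pi.add_apply, map_add, dirDeriv_add_right]
      ring
    · rintro f a ⟨b, μ⟩
      refine Subtype.ext (funext fun x ↦ ?_)
      obtain ⟨P, s₀, G, k, hP, hP1, hs₀, -, hG, -, hksmul, hk⟩ := exists_canonical_coord 𝒜 x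
      refine hP ?_
      change P ((δ (funSMul f a) (b, μ)).1 x) = P (f x • (δ a (b, μ)).1 x)
      rw [map_smul, hδ, hδ, hk _ b μ _ (hLie _ _),
        hk _ b μ _ (hLie _ _), hksmul, funSMul_apply, map_smul, dirDeriv_smul_right, smul_eq_mul]
      ring
  obtain ⟨D, hD, hDδ⟩ := hcon
  have hDδ' : ∀ a b μ, D a (wedgeTmulSec b μ) = δ a (b, μ) := fun a b μ ↦ hDδ a (b, μ)
  refine ⟨D, hD.isRepresentation hline ?_, ?_⟩
  · intro a a' x
    obtain ⟨P, s₀, G, k, -, -, hs₀, ⟨b, μ, rfl⟩, -⟩ := exists_canonical_coord 𝒜 x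
    refine ⟨wedgeTmulSec b μ, hs₀.self_of_nhds, ?_⟩
    -- The two mixed sums, with one derivative on each factor, are exchanged by swapping `a` and
    -- `a'`, so they disappear from the commutator.
    have h1 : ∀ a a', (D a (D a' (wedgeTmulSec b μ))).1 x =
        ∑ i, ∑ j, wedgeTmulMultilinear μ x
          (Function.update (Function.update b i (𝒜.bracket a' (b i))) j
            (𝒜.bracket a (Function.update b i (𝒜.bracket a' (b i)) j))) +
        ∑ i, wedgeTmul (Function.update b i (𝒜.bracket a' (b i))) (Lie (𝒜.anchorSec a) μ) x +
        (∑ i, wedgeTmul (Function.update b i (𝒜.bracket a (b i))) (Lie (𝒜.anchorSec a') μ) x +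
          wedgeTmul b (Lie (𝒜.anchorSec a) (Lie (𝒜.anchorSec a') μ)) x) := by
      intro a a'
      have h2 : D a (D a' (wedgeTmulSec b μ)) =
          ∑ i, δ a (Function.update b i (𝒜.bracket a' (b i)), μ) +
            δ a (b, Lie (𝒜.anchorSec a') μ) := by
        rw [hDδ' a' b μ]
        change D a (∑ i, wedgeTmulSec _ _ + wedgeTmulSec _ _) = _
        rw [hD.add_right, SectionSpace.map_sum (hD.add_right a)]
        simp only [hDδ']
      rw [h2, SectionSpace.coe_add, SectionSpace.sum_apply]
      simp only [hδ, Finset.sum_add_distrib]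
      rfl
    have h3 := sum_update_commutator (R := ℝ) (W := CanonicalFiber E F A x) (wedgeTmulMultilinear (F := F) (A := A) μ x) (𝒜.bracket a) (𝒜.bracket a') b
    have h4 : ∀ i, 𝒜.bracket a (𝒜.bracket a' (b i)) - 𝒜.bracket a' (𝒜.bracket a (b i)) =
        𝒜.bracket (𝒜.bracket a a') (b i) := by
      intro i
      rw [𝒜.jacobi a a' (b i)]
      abel
    have hc := hLie (𝒜.anchorSec (𝒜.bracket a a')) μ
    rw [𝒜.anchorSec_bracket] at hc
    have h5 := (hLie (𝒜.anchorSec a) μ).commutator (hLie (𝒜.anchorSec a') μ)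
      (hLie (𝒜.anchorSec a) (Lie (𝒜.anchorSec a') μ))
      (hLie (𝒜.anchorSec a') (Lie (𝒜.anchorSec a) μ)) hc
    have h6 : wedgeTmul b (Lie (𝒜.anchorSec a) (Lie (𝒜.anchorSec a') μ)) x -
        wedgeTmul b (Lie (𝒜.anchorSec a') (Lie (𝒜.anchorSec a) μ)) x =
        wedgeTmul b (Lie (𝒜.anchorSec (𝒜.bracket a a')) μ) x := by
      rw [𝒜.anchorSec_bracket, ← h5]
      exact (TensorProduct.tmul_sub _ _ _).symm
    rw [h1 a a', h1 a' a, hDδ' _ b μ, hδ]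
    simp only [h4] at h3
    change _ = ∑ i, wedgeTmulMultilinear μ x _ + _
    rw [← h6, ← h3]
    abel
  · intro a b μ μ' hμ'
    rw [hDδ' a b μ, ← (hLie (𝒜.anchorSec a) μ).unique (μ'' := μ') hμ']

end CanonicalRep

/-! ### Tensoriality of the curvature -/

section Curvature

variable {E : Type*} [NormedAddCommGroup E] [NormedSpace ℝ E] [FiniteDimensional ℝ E]
  {M : Type*} [TopologicalSpace M] [ChartedSpace E M] [IsManifold 𝓘(ℝ, E) ∞ M] [T2Space M]
  {F : Type*} [NormedAddCommGroup F] [NormedSpace ℝ F] [FiniteDimensional ℝ F]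
  {A : M → Type*} [TopologicalSpace (TotalSpace F A)] [∀ x, TopologicalSpace (A x)]
  [∀ x, AddCommGroup (A x)] [∀ x, Module ℝ (A x)] [FiberBundle F A] [VectorBundle ℝ F A]
  [ContMDiffVectorBundle ∞ F A 𝓘(ℝ, E)]
  {L : M → Type*} [∀ x, AddCommGroup (L x)] [∀ x, Module ℝ (L x)]
  {𝒜 : LieAlgebroid E F A} {S : SectionSpace E L}
  {D : Cₛ^∞⟮𝓘(ℝ, E); F, A⟯ → S.carrier → S.carrier}

/-- The cutoffs have value `1` and derivative `0` at `x`, so both Leibniz corrections vanish there.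
-/
theorem LieAlgebroid.bracket_congr (𝒜 : LieAlgebroid E F A) {a b a' b' : Cₛ^∞⟮𝓘(ℝ, E); F, A⟯}
    {x : M} {χ χ' : C^∞⟮𝓘(ℝ, E), M; ℝ⟯} (hχ : ∀ᶠ y in 𝓝 x, χ y = 1) (hχ' : ∀ᶠ y in 𝓝 x, χ' y = 1)
    (hb : b = funSMul χ a) (hb' : b' = funSMul χ' a') :
    𝒜.bracket b b' x = 𝒜.bracket a a' x := by
  have h0 : ∀ {χ : C^∞⟮𝓘(ℝ, E), M; ℝ⟯}, (∀ᶠ y in 𝓝 x, χ y = 1) →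
      ∀ v : TangentSpace 𝓘(ℝ, E) x, dirDeriv χ x v = 0 :=
    fun h v ↦ by rw [dirDeriv_congr (g := fun _ ↦ 1) h, dirDeriv_const]
  rw [hb', 𝒜.leibniz, h0 hχ', hχ'.self_of_nhds, one_smul, zero_smul, add_zero, hb,
    𝒜.bracket_funSMul_left]
  change χ x • 𝒜.bracket a a' x - dirDeriv χ x _ • a x = _
  rw [h0 hχ, hχ.self_of_nhds, one_smul, zero_smul, sub_zero]

theorem IsConnection.apply_of_eq_sum (hD : IsConnection 𝒜 S D) {ι : Type*} (J : Finset ι)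
    {a : Cₛ^∞⟮𝓘(ℝ, E); F, A⟯} {t : ι → Cₛ^∞⟮𝓘(ℝ, E); F, A⟯} {c : ι → ℝ} {x : M}
    (h : a x = ∑ j ∈ J, c j • t j x) (s : S.carrier) :
    (D a s).1 x = ∑ j ∈ J, c j • (D (t j) s).1 x := by
  let k : ι → C^∞⟮𝓘(ℝ, E), M; ℝ⟯ := fun j ↦ ⟨fun _ ↦ c j, contMDiff_const⟩
  have h1 : a x = (∑ j ∈ J, funSMul (k j) (t j)) x := by
    rw [h, sum_sec_apply]
    rfl
  rw [hD.congr_left h1, map_sum_of_add (f := fun a ↦ D a s) (fun a b ↦ hD.add_left a b s),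
    SectionSpace.sum_apply]
  simp only [hD.fun_smul_left]
  rfl

/-- Linear over functions in `a`: the derivative of `f` from `D_{a'} (f D_a s)` cancels the one from
`[f a, a']`. -/
theorem IsConnection.curvature_congr_left (hD : IsConnection 𝒜 S D)
    {a b : Cₛ^∞⟮𝓘(ℝ, E); F, A⟯} {x : M} (h : a x = b x) (a' : Cₛ^∞⟮𝓘(ℝ, E); F, A⟯)
    (s : S.carrier) :
    (D a (D a' s)).1 x - (D a' (D a s)).1 x - (D (𝒜.bracket a a') s).1 x =
      (D b (D a' s)).1 x - (D a' (D b s)).1 x - (D (𝒜.bracket b a') s).1 x := by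
  refine tensorial_congr (fun a ↦ (D a (D a' s)).1 x - (D a' (D a s)).1 x -
    (D (𝒜.bracket a a') s).1 x) (fun a b ↦ ?_) (fun f a ↦ ?_) h
  · simp only [hD.add_left, hD.add_right, map_add, LinearMap.add_apply, SectionSpace.coe_add]
    abel
  · simp only [hD.fun_smul_left, 𝒜.bracket_funSMul_left, hD.leibniz, SectionSpace.coe_funSMul]
    -- Additivity of `D` in the section of `A` is used in place of a rule for differences.
    have h1 := congrArg (fun t : S.carrier ↦ t.1 x)
      (hD.add_left (funSMul f (𝒜.bracket a a') - funSMul (der (𝒜.anchorSec a') f) a)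
        (funSMul (der (𝒜.anchorSec a') f) a) s)
    simp only [sub_add_cancel, hD.fun_smul_left, SectionSpace.coe_add,
      SectionSpace.coe_funSMul] at h1
    rw [eq_sub_of_add_eq h1.symm]
    change _ - (_ + dirDeriv f x (𝒜.anchor x (a' x)) • _) -
      (_ - dirDeriv f x (𝒜.anchor x (a' x)) • _) = _
    module

theorem IsConnection.curvature_congr (hD : IsConnection 𝒜 S D)
    {a b a' b' : Cₛ^∞⟮𝓘(ℝ, E); F, A⟯} {x : M} (h : a x = b x) (h' : a' x = b' x)
    (s : S.carrier) :
    (D a (D a' s)).1 x - (D a' (D a s)).1 x - (D (𝒜.bracket a a') s).1 x =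
      (D b (D b' s)).1 x - (D b' (D b s)).1 x - (D (𝒜.bracket b b') s).1 x := by
  have hneg : ∀ c c' : Cₛ^∞⟮𝓘(ℝ, E); F, A⟯,
      (D (𝒜.bracket c c') s).1 x = -(D (𝒜.bracket c' c) s).1 x := by
    intro c c'
    have h1 := hD.apply_of_eq_sum (x := x) (a := 𝒜.bracket c c') {()}
      (t := fun _ ↦ 𝒜.bracket c' c) (c := fun _ ↦ -1) (by
        rw [𝒜.bracket_swap c c', Finset.sum_singleton, neg_one_smul]; rfl) s
    rw [h1, Finset.sum_singleton, neg_one_smul]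
  have h1 := hD.curvature_congr_left h a' s
  have h2 := hD.curvature_congr_left h' b s
  rw [hneg a' b, hneg b' b] at h2
  rw [h1, ← neg_inj]
  simp only [neg_sub] at h2 ⊢
  rw [sub_neg_eq_add, sub_neg_eq_add] at h2
  calc _ = _ := by abel
    _ = _ := h2
    _ = _ := by abel

end Curvature

/-! ### Lifting vector fields through a submersion -/

section Lifts

variable {E : Type*} [NormedAddCommGroup E] [NormedSpace ℝ E] [FiniteDimensional ℝ E]
  {M : Type*} [TopologicalSpace M] [ChartedSpace E M] [IsManifold 𝓘(ℝ, E) ∞ M] [T2Space M]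
  {E' : Type*} [NormedAddCommGroup E'] [NormedSpace ℝ E'] [FiniteDimensional ℝ E']
  {N : Type*} [TopologicalSpace N] [ChartedSpace E' N] [IsManifold 𝓘(ℝ, E') ∞ N] [T2Space N]

/-- Local lifts of vector fields by a submersion, with a prescribed value at one point. -/
theorem exists_lift_vectorField {φ : M → N} (hφ : ContMDiff 𝓘(ℝ, E) 𝓘(ℝ, E') ∞ φ) {m₀ : M}
    (hsub : Function.Surjective (mfderiv 𝓘(ℝ, E) 𝓘(ℝ, E') φ m₀)) (W : VectorFields E' N)
    {u₀ : TangentSpace 𝓘(ℝ, E) m₀} (hu₀ : mfderiv 𝓘(ℝ, E) 𝓘(ℝ, E') φ m₀ u₀ = W (φ m₀)) :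
    ∃ u : VectorFields E M, u m₀ = u₀ ∧
      ∀ᶠ m in 𝓝 m₀, mfderiv 𝓘(ℝ, E) 𝓘(ℝ, E') φ m (u m) = W (φ m) := by
  obtain ⟨t, ν, hν⟩ := exists_frame E' E' (fun y : N ↦ TangentSpace 𝓘(ℝ, E') y) (φ m₀)
  obtain ⟨U₀, hU₀⟩ := exists_section_eq (E := E) (F := E) u₀
  -- Fields `U j` whose images form a frame at `m₀`, hence also nearby, where the determinant `h`
  -- stays nonzero.
  choose w hw using fun j ↦ hsub (t j (φ m₀))
  choose U hU using fun j ↦ exists_section_eq (E := E) (F := E) (w j)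
  let T : ∀ m, VectorFields E M → TangentSpace 𝓘(ℝ, E') (φ m) := fun m u ↦
    mfderiv 𝓘(ℝ, E) 𝓘(ℝ, E') φ m (u m)
  let h : C^∞⟮𝓘(ℝ, E), M; ℝ⟯ := ⟨fun m ↦ ν.1 (φ m) (fun j ↦ T m (U j)),
    ν.contMDiff_along _ hφ fun j ↦ contMDiff_mfderiv hφ (U j)⟩
  have hupd : ∀ (V : ∀ m, TangentSpace 𝓘(ℝ, E') (φ m)), ContMDiff 𝓘(ℝ, E)
      (𝓘(ℝ, E').prod 𝓘(ℝ, E')) ∞ (fun m ↦ (⟨φ m, V m⟩ : TangentBundle 𝓘(ℝ, E') N)) → ∀ j,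
      ContMDiff 𝓘(ℝ, E) 𝓘(ℝ, ℝ) ∞
        fun m ↦ ν.1 (φ m) (Function.update (fun j ↦ T m (U j)) j (V m)) := by
    intro V hV j
    have h1 := ν.contMDiff_along (fun i m ↦ if i = j then V m else T m (U i)) hφ (by
      intro i
      by_cases hij : i = j
      · simpa only [hij, if_true] using hV
      · simpa only [hij, if_false] using contMDiff_mfderiv hφ (U i))
    convert h1 using 4 with m i
    by_cases hij : i = j
    · subst hij; simp
    · simp [hij]
  let c : Fin (finrank ℝ E') → C^∞⟮𝓘(ℝ, E), M; ℝ⟯ := fun j ↦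
    ⟨_, (hupd (fun m ↦ W (φ m)) (W.contMDiff.comp hφ) j).sub
      (hupd (fun m ↦ T m U₀) (contMDiff_mfderiv hφ U₀) j)⟩
  have hc : ∀ j m, c j m = ν.1 (φ m) (Function.update (fun j ↦ T m (U j)) j
      (W (φ m) - T m U₀)) := fun j m ↦ ((ν.1 (φ m)).map_update_sub _ _ _ _).symm
  have hh₀ : h m₀ ≠ 0 := by
    have h1 : h m₀ = 1 := by
      rw [← hν.self_of_nhds]
      refine congrArg (ν.1 (φ m₀)) (funext fun j ↦ ?_)
      change mfderiv 𝓘(ℝ, E) 𝓘(ℝ, E') φ m₀ (U j m₀) = _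
      rw [hU, hw]
    rw [h1]
    exact one_ne_zero
  obtain ⟨k, hk⟩ := exists_local_inverse hh₀
  -- `U₀` has the right value at `m₀`; the error `W - Tφ(U₀)` is expanded in the frame `Tφ(U j)` by
  -- Cramer's rule and lifted. It vanishes at `m₀`, so the prescribed value is kept.
  refine ⟨U₀ + ∑ j, funSMul (c j * k) (U j), ?_, ?_⟩
  · have h1 : ∀ j, c j m₀ = 0 := by
      intro j
      rw [hc]
      refine (ν.1 (φ m₀)).map_coord_zero j ?_
      rw [Function.update_self, sub_eq_zero, ← hu₀, ← hU₀]
    rw [ContMDiffSection.coe_add, Pi.add_apply, sum_sec_apply, hU₀, Finset.sum_eq_zero, add_zero]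
    intro j _
    change (c j m₀ * k m₀) • U j m₀ = 0
    rw [h1, zero_mul, zero_smul]
  · filter_upwards [hk] with m hm
    rw [ContMDiffSection.coe_add, Pi.add_apply, sum_sec_apply, map_add, map_sum]
    have h1 := sum_alternating_update (finrank_tangentSpace (φ m)) (ν.1 (φ m)) (fun j ↦ T m (U j))
      (left_ne_zero_of_mul_eq_one hm) (W (φ m) - T m U₀)
    have h2 : ∀ j, mfderiv 𝓘(ℝ, E) 𝓘(ℝ, E') φ m (funSMul (c j * k) (U j) m) =
        (ν.1 (φ m) (Function.update (fun j ↦ T m (U j)) j (W (φ m) - T m U₀)) /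
          ν.1 (φ m) (fun j ↦ T m (U j))) • T m (U j) := by
      intro j
      rw [funSMul_apply, map_smul, ← hc, div_eq_mul_inv]
      congr 1
      change c j m * k m = _
      rw [eq_inv_of_mul_eq_one_right hm]
      rfl
    simp only [h2]
    rw [← h1]
    exact add_sub_cancel _ _

end Lifts

/-! ### Sections related by a pull-back morphism -/

section PullbackMorphisms

variable {E : Type*} [NormedAddCommGroup E] [NormedSpace ℝ E] [FiniteDimensional ℝ E]
  {M : Type*} [TopologicalSpace M] [ChartedSpace E M] [IsManifold 𝓘(ℝ, E) ∞ M] [T2Space M]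
  {F : Type*} [NormedAddCommGroup F] [NormedSpace ℝ F] [FiniteDimensional ℝ F]
  {A : M → Type*} [TopologicalSpace (TotalSpace F A)] [∀ x, TopologicalSpace (A x)]
  [∀ x, AddCommGroup (A x)] [∀ x, Module ℝ (A x)] [FiberBundle F A] [VectorBundle ℝ F A]
  [ContMDiffVectorBundle ∞ F A 𝓘(ℝ, E)]
  {E' : Type*} [NormedAddCommGroup E'] [NormedSpace ℝ E'] [FiniteDimensional ℝ E']
  {N : Type*} [TopologicalSpace N] [ChartedSpace E' N] [IsManifold 𝓘(ℝ, E') ∞ N] [T2Space N]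
  {F' : Type*} [NormedAddCommGroup F'] [NormedSpace ℝ F'] [FiniteDimensional ℝ F']
  {B : N → Type*} [TopologicalSpace (TotalSpace F' B)] [∀ x, TopologicalSpace (B x)]
  [∀ x, AddCommGroup (B x)] [∀ x, Module ℝ (B x)] [FiberBundle F' B] [VectorBundle ℝ F' B]
  [ContMDiffVectorBundle ∞ F' B 𝓘(ℝ, E')]
  {𝒜 : LieAlgebroid E F A} {ℬ : LieAlgebroid E' F' B} {Φ : BundleMap E F A E' F' B}

theorem IsPullbackMorphism.anchor_map (hΦ : IsPullbackMorphism 𝒜 ℬ Φ) (m : M) (a : A m) :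
    ℬ.anchor (Φ.base m) (Φ.map m a) =
      mfderiv 𝓘(ℝ, E) 𝓘(ℝ, E') Φ.base m (𝒜.anchor m a) := by
  obtain ⟨-, -, Ψ, hΨ⟩ := hΦ
  rw [hΨ, ← Ψ.anchor_eq]
  exact (Ψ.toEquiv m a).2

theorem IsPullbackMorphism.injective (hΦ : IsPullbackMorphism 𝒜 ℬ Φ) (m : M) :
    Function.Injective ((Φ.map m).prod (𝒜.anchor m)) := by
  obtain ⟨-, -, Ψ, hΨ⟩ := hΦ
  intro a a' h
  refine (Ψ.toEquiv m).injective (Subtype.ext (Prod.ext ?_ ?_))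
  · rw [← hΨ, ← hΨ]
    exact congrArg Prod.fst h
  · rw [Ψ.anchor_eq, Ψ.anchor_eq]
    exact congrArg Prod.snd h

theorem IsPullbackMorphism.exists_eq (hΦ : IsPullbackMorphism 𝒜 ℬ Φ) {m : M} {b : B (Φ.base m)}
    {u : TangentSpace 𝓘(ℝ, E) m}
    (h : ℬ.anchor (Φ.base m) b = mfderiv 𝓘(ℝ, E) 𝓘(ℝ, E') Φ.base m u) :
    ∃ a : A m, Φ.map m a = b ∧ 𝒜.anchor m a = u := by
  obtain ⟨-, -, Ψ, hΨ⟩ := hΦ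
  refine ⟨(Ψ.toEquiv m).symm ⟨(b, u), h⟩, ?_, ?_⟩
  · rw [hΨ, LinearEquiv.apply_symm_apply]
  · rw [← Ψ.anchor_eq, LinearEquiv.apply_symm_apply]

variable (Φ) in
/-- The sections `a` of `A` and `b` of `B` are related by `Φ` near `m`. -/
def Related (m : M) (a : Cₛ^∞⟮𝓘(ℝ, E); F, A⟯) (b : Cₛ^∞⟮𝓘(ℝ, E'); F', B⟯) : Prop :=
  ∀ᶠ y in 𝓝 m, Φ.map y (a y) = b (Φ.base y)

/-- The bracket formula requires a global expression `∑ f_i (b_i ∘ φ)`. Multiplying by a bump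
function gives one with a single term, and the derivative of the bump function vanishes at the point
considered. -/
theorem Related.bracket (hΦ : IsPullbackMorphism 𝒜 ℬ Φ) {m : M} {a a' : Cₛ^∞⟮𝓘(ℝ, E); F, A⟯}
    {b b' : Cₛ^∞⟮𝓘(ℝ, E'); F', B⟯} (h : Related Φ m a b) (h' : Related Φ m a' b') :
    Related Φ m (𝒜.bracket a a') (ℬ.bracket b b') := by
  obtain ⟨-, -, Ψ, hΨ⟩ := hΦ
  filter_upwards [h.eventually_nhds, h'.eventually_nhds] with m h h'
  obtain ⟨χ, h1, h2⟩ := exists_bump (E := E) (h.and h')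
  have h3 : ∀ y, χ y ≠ 0 → Φ.map y (a y) = b (Φ.base y) ∧ Φ.map y (a' y) = b' (Φ.base y) :=
    fun y hy ↦ h2 (subset_tsupport _ hy)
  have h4 : ∀ v : TangentSpace 𝓘(ℝ, E) m, dirDeriv χ m v = 0 := fun v ↦ by
    rw [dirDeriv_congr (g := fun _ ↦ 1) h1, dirDeriv_const]
  rw [← 𝒜.bracket_congr h1 h1 rfl rfl, hΨ,
    (Ψ.bracket_eq (funSMul χ a) (funSMul χ a')).1 1 1 (fun _ ↦ χ) (fun _ ↦ b) (fun _ ↦ χ)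
      (fun _ ↦ b')]
  · simp [h4, h1.self_of_nhds]
  all_goals
    intro y
    rw [← hΨ, funSMul_apply, map_smul, Fin.sum_univ_one]
    by_cases hy : χ y = 0
    · rw [hy, zero_smul, zero_smul]
  · rw [(h3 y hy).1]
  · rw [(h3 y hy).2]

theorem Related.anchor (hΦ : IsPullbackMorphism 𝒜 ℬ Φ) {m : M} {a : Cₛ^∞⟮𝓘(ℝ, E); F, A⟯}
    {b : Cₛ^∞⟮𝓘(ℝ, E'); F', B⟯} (h : Related Φ m a b) :
    ∀ᶠ y in 𝓝 m, mfderiv 𝓘(ℝ, E) 𝓘(ℝ, E') Φ.base y (𝒜.anchorSec a y) =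
      ℬ.anchorSec b (Φ.base y) := by
  filter_upwards [h] with y hy
  rw [𝒜.anchorSec_apply, ← hΦ.anchor_map, hy]
  rfl

theorem contMDiff_smul_along {φ : M → N} (hφ : ContMDiff 𝓘(ℝ, E) 𝓘(ℝ, E') ∞ φ)
    (χ : C^∞⟮𝓘(ℝ, E), M; ℝ⟯) (b : Cₛ^∞⟮𝓘(ℝ, E'); F', B⟯) :
    ContMDiff 𝓘(ℝ, E) (𝓘(ℝ, E').prod 𝓘(ℝ, F')) ∞
      (fun m ↦ (⟨φ m, χ m • b (φ m)⟩ : TotalSpace F' B)) := by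
  intro m
  let e := trivializationAt F' B (φ m)
  have hmem : φ m ∈ e.baseSet := FiberBundle.mem_baseSet_trivializationAt' (φ m)
  have h1 := (e.contMDiffAt_iff (IB := 𝓘(ℝ, E')) (IM := 𝓘(ℝ, E)) (n := ∞)
    (f := fun m ↦ (⟨φ m, b (φ m)⟩ : TotalSpace F' B)) (x₀ := m) (e.mem_source.2 hmem)).1
    (b.contMDiff.comp hφ m)
  refine (e.contMDiffAt_iff (IB := 𝓘(ℝ, E'))
    (f := fun m ↦ (⟨φ m, χ m • b (φ m)⟩ : TotalSpace F' B)) (x₀ := m) (e.mem_source.2 hmem)).2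
    ⟨hφ m, ?_⟩
  refine (χ.contMDiff.contMDiffAt.smul h1.2).congr_of_eventuallyEq ?_
  filter_upwards [hφ.continuous.continuousAt.eventually (e.open_baseSet.mem_nhds hmem)] with y hy
  exact (e.linear ℝ hy).map_smul (χ y) (b (φ y))

/-- Any section of `B` is related, near a given point, to a section of `A`, whose value at that
point can be prescribed. -/
theorem exists_related (hΦ : IsPullbackMorphism 𝒜 ℬ Φ) {m : M}
    (hsub : Function.Surjective (mfderiv 𝓘(ℝ, E) 𝓘(ℝ, E') Φ.base m)) {a₀ : A m}
    {b : Cₛ^∞⟮𝓘(ℝ, E'); F', B⟯} (h : Φ.map m a₀ = b (Φ.base m)) :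
    ∃ a : Cₛ^∞⟮𝓘(ℝ, E); F, A⟯, a m = a₀ ∧ Related Φ m a b := by
  have h0 := hΦ.anchor_map m a₀
  obtain ⟨-, -, Ψ, hΨ⟩ := hΦ
  rw [h] at h0
  obtain ⟨u, hu₀, hu⟩ := exists_lift_vectorField Φ.contMDiff_base hsub (ℬ.anchorSec b)
    (u₀ := 𝒜.anchor m a₀) h0.symm
  obtain ⟨χ, h1, h2⟩ := exists_bump (E := E) hu
  -- The pair `(b ∘ φ, u)` lies in the fibre product only where `u` lifts `ρ b`; the cutoff makes it
  -- a global section, which the isomorphism `Ψ` carries back to `A`.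
  let s : ∀ y, pullbackFiber (E := E) ℬ Φ.base y := fun y ↦
    ⟨(χ y • b (Φ.base y), χ y • u y), by
      change ℬ.anchor (Φ.base y) (χ y • b (Φ.base y)) =
        mfderiv 𝓘(ℝ, E) 𝓘(ℝ, E') Φ.base y (χ y • u y)
      rw [map_smul, map_smul]
      by_cases hy : χ y = 0
      · rw [hy, zero_smul, zero_smul]
      · have h3 := h2 (subset_tsupport _ hy)
        exact congrArg (χ y • ·) h3.symm⟩
  have hs : IsSmoothPullbackSection ℬ Φ.base
      (fun y ↦ Ψ.toEquiv y ((Ψ.toEquiv y).symm (s y))) := by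
    simp only [LinearEquiv.apply_symm_apply]
    exact ⟨contMDiff_smul_along Φ.contMDiff_base χ b, (funSMul χ u).contMDiff⟩
  refine ⟨⟨fun y ↦ (Ψ.toEquiv y).symm (s y), (Ψ.smooth_iff _).2 hs⟩, ?_, ?_⟩
  · change (Ψ.toEquiv m).symm (s m) = a₀
    rw [LinearEquiv.symm_apply_eq]
    refine Subtype.ext (Prod.ext ?_ ?_)
    · change χ m • b (Φ.base m) = _
      rw [h1.self_of_nhds, one_smul, ← hΨ, h]
    · change χ m • u m = _
      rw [h1.self_of_nhds, one_smul, Ψ.anchor_eq, hu₀]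
  · filter_upwards [h1] with y hy
    rw [hΨ]
    change (Ψ.toEquiv y ((Ψ.toEquiv y).symm (s y))).1.1 = _
    rw [LinearEquiv.apply_symm_apply]
    change χ y • b (Φ.base y) = _
    rw [hy, one_smul]

end PullbackMorphisms

/-! ### Existence of the pull-back representation -/

section PullbackRep

variable {E : Type*} [NormedAddCommGroup E] [NormedSpace ℝ E] [FiniteDimensional ℝ E]
  {M : Type*} [TopologicalSpace M] [ChartedSpace E M] [IsManifold 𝓘(ℝ, E) ∞ M] [T2Space M]
  {F : Type*} [NormedAddCommGroup F] [NormedSpace ℝ F] [FiniteDimensional ℝ F]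
  {A : M → Type*} [TopologicalSpace (TotalSpace F A)] [∀ x, TopologicalSpace (A x)]
  [∀ x, AddCommGroup (A x)] [∀ x, Module ℝ (A x)] [FiberBundle F A] [VectorBundle ℝ F A]
  [ContMDiffVectorBundle ∞ F A 𝓘(ℝ, E)]
  {E' : Type*} [NormedAddCommGroup E'] [NormedSpace ℝ E'] [FiniteDimensional ℝ E']
  {N : Type*} [TopologicalSpace N] [ChartedSpace E' N] [IsManifold 𝓘(ℝ, E') ∞ N] [T2Space N]
  {F' : Type*} [NormedAddCommGroup F'] [NormedSpace ℝ F'] [FiniteDimensional ℝ F']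
  {B : N → Type*} [TopologicalSpace (TotalSpace F' B)] [∀ x, TopologicalSpace (B x)]
  [∀ x, AddCommGroup (B x)] [∀ x, Module ℝ (B x)] [FiberBundle F' B] [VectorBundle ℝ F' B]
  [ContMDiffVectorBundle ∞ F' B 𝓘(ℝ, E')]
  {𝒜 : LieAlgebroid E F A} {ℬ : LieAlgebroid E' F' B} {Φ : BundleMap E F A E' F' B}
  {K : N → Type*} [∀ x, AddCommGroup (K x)] [∀ x, Module ℝ (K x)] {S : SectionSpace E' K}

/-- The values on pulled-back sections are prescribed, and these contain local frames. Compatibility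
with the Leibniz rule is `ρ_B Φ = Tφ ρ_A`, and flatness is inherited through related sections. -/
theorem exists_isPullbackRep (hΦ : IsPullbackMorphism 𝒜 ℬ Φ)
    (hsub : ∀ m, Function.Surjective (mfderiv 𝓘(ℝ, E) 𝓘(ℝ, E') Φ.base m)) (hS : IsLine S)
    {D : Cₛ^∞⟮𝓘(ℝ, E'); F', B⟯ → S.carrier → S.carrier} (hD : IsRepresentation ℬ S D) :
    ∃ D', IsPullbackRep 𝒜 Φ S D D' := by
  have hDc := hD.isConnection
  have hP : IsLine (S.pullback E Φ.base) := hS.pullback Φ.contMDiff_base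
  choose β hβ using fun (a : Cₛ^∞⟮𝓘(ℝ, E); F, A⟯) (m : M) ↦
    exists_section_eq (E := E') (F := F') (Φ.map m (a m))
  let δ₀ : Cₛ^∞⟮𝓘(ℝ, E); F, A⟯ → S.carrier → ∀ m, K (Φ.base m) := fun a y m ↦
    (D (β a m) y).1 (Φ.base m)
  have hδ₀ : ∀ a y m b, Φ.map m (a m) = b (Φ.base m) → δ₀ a y m = (D b y).1 (Φ.base m) :=
    fun a y m b h ↦ hDc.congr_left ((hβ a m).trans h) y
  have hmem : ∀ a y, δ₀ a y ∈ (S.pullback E Φ.base).carrier := by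
    intro a y
    refine hP.mem_of_local _ fun m ↦ ?_
    obtain ⟨t, vol, ht⟩ := exists_frame E' F' B (Φ.base m)
    -- The Cramer coordinates of `Φ(a)` in the frame `t` along `φ`; with them `δ₀ a y` becomes a
    -- combination of pulled-back sections near `m`.
    let f : Fin (finrank ℝ F') → C^∞⟮𝓘(ℝ, E), M; ℝ⟯ := fun j ↦
      ⟨fun y ↦ vol.1 (Φ.base y) (fun i ↦ if i = j then Φ.map y (a y) else t i (Φ.base y)),
        vol.contMDiff_along (fun i y ↦ if i = j then Φ.map y (a y) else t i (Φ.base y))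
          Φ.contMDiff_base fun i ↦ by
            by_cases hij : i = j
            · simp only [hij, if_true]
              exact Φ.contMDiff_map.comp a.contMDiff
            · simp only [hij, if_false]
              exact (t i).contMDiff.comp Φ.contMDiff_base⟩
    refine ⟨(∑ j, (S.pullback E Φ.base).funSMul (f j) (S.pullbackSec Φ.base (D (t j) y))).1,
      Subtype.property _, ?_⟩
    filter_upwards [Φ.contMDiff_base.continuous.continuousAt.eventually ht] with z hz
    rw [SectionSpace.sum_apply]
    refine hDc.apply_of_eq_sum (c := fun j ↦ f j z) Finset.univ ?_ y
    rw [hβ]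
    conv_lhs => rw [frame_expansion hz (Φ.map z (a z))]
    refine Finset.sum_congr rfl fun j _ ↦ ?_
    refine congrArg (· • t j (Φ.base z)) (congrArg (vol.1 (Φ.base z)) (funext fun i ↦ ?_))
    by_cases hij : i = j
    · subst hij; simp
    · simp [hij]
  have hcon : ∃ D', IsConnection 𝒜 (S.pullback E Φ.base) D' ∧ ∀ a y,
      D' a (S.pullbackSec Φ.base y) = ⟨δ₀ a y, hmem a y⟩ := by
    refine exists_connection 𝒜 hP (fun y ↦ S.pullbackSec Φ.base y)
      (fun a y ↦ ⟨δ₀ a y, hmem a y⟩) ?_ ?_ ?_ ?_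
    · intro m
      exact hS.exists_ne_zero (Φ.base m)
    · intro a y z m f hz hf
      obtain ⟨h, hh⟩ := (hS.ratio hz).2 y
      have hc := Φ.contMDiff_base.continuous.continuousAt (x := m)
      have h1 : (f : M → ℝ) =ᶠ[𝓝 m] fun p ↦ h (Φ.base p) := by
        filter_upwards [hf, hc.eventually hh, hc.eventually (hS.ratio hz).1] with p h2 h3 h4
        exact smul_cancel_right h4 (h2.symm.trans h3)
      change (D (β a m) y).1 (Φ.base m) = f m • (D (β a m) z).1 (Φ.base m) + _ • z.1 (Φ.base m)
      rw [hDc.apply_of_eq_smul _ hh, hβ, hΦ.anchor_map, dirDeriv_congr h1,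
        dirDeriv_comp h.contMDiff Φ.contMDiff_base, h1.self_of_nhds]
    · intro a a' y
      refine Subtype.ext (funext fun m ↦ ?_)
      change δ₀ (a + a') y m = δ₀ a y m + δ₀ a' y m
      rw [hδ₀ (a + a') y m (β a m + β a' m), hD.add_left]
      · rfl
      · change Φ.map m (a m + a' m) = β a m (Φ.base m) + β a' m (Φ.base m)
        rw [map_add, hβ, hβ]
    · intro f a y
      refine Subtype.ext (funext fun m ↦ ?_)
      change δ₀ (funSMul f a) y m = f m • δ₀ a y m
      have h1 := hDc.apply_of_eq_sum (x := Φ.base m) (a := β (funSMul f a) m) {()}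
        (t := fun _ ↦ β a m) (c := fun _ ↦ f m) (by
          rw [Finset.sum_singleton, hβ, hβ]
          exact map_smul _ _ _) y
      rwa [Finset.sum_singleton] at h1
  obtain ⟨D', hD', hDδ⟩ := hcon
  have hval : ∀ a b y m, Φ.map m (a m) = b (Φ.base m) →
      (D' a (S.pullbackSec Φ.base y)).1 m = (D b y).1 (Φ.base m) := by
    intro a b y m h
    rw [hDδ]
    exact hδ₀ a y m b h
  refine ⟨D', hD'.isRepresentation hP ?_, hval⟩
  intro a a' m
  obtain ⟨y, hy⟩ := hS.exists_ne_zero (Φ.base m)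
  refine ⟨S.pullbackSec Φ.base y, hy, ?_⟩
  -- Iterated derivatives involve `a'` near `m`, whereas `β a' m` matches it at `m` only. As the
  -- curvature is tensorial, `a` and `a'` may be replaced by sections related to `β a m` and `β a'
  -- m` near `m`.
  obtain ⟨c, hc, hcb⟩ := exists_related hΦ (hsub m) (hβ a m).symm
  obtain ⟨c', hc', hcb'⟩ := exists_related hΦ (hsub m) (hβ a' m).symm
  rw [← sub_eq_zero, hD'.curvature_congr hc.symm hc'.symm, sub_eq_zero]
  have key : ∀ {c c' b b'}, Related Φ m c b → Related Φ m c' b' →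
      (D' c (D' c' (S.pullbackSec Φ.base y))).1 m = (D b (D b' y)).1 (Φ.base m) := by
    intro c c' b b' h h'
    rw [hD'.congr_right c (s' := S.pullbackSec Φ.base (D b' y))]
    · exact hval _ _ _ _ h.self_of_nhds
    · filter_upwards [h'] with z hz
      exact hval _ _ _ _ hz
  rw [key hcb hcb', key hcb' hcb, hval _ _ _ _ (hcb.bracket hΦ hcb').self_of_nhds, ← hD.flat]
  rfl

end PullbackRep

/-! ### Adapted frames and the derivative of the canonical isomorphism -/

section CanonicalIso

variable {E : Type*} [NormedAddCommGroup E] [NormedSpace ℝ E] [FiniteDimensional ℝ E]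
  {M : Type*} [TopologicalSpace M] [ChartedSpace E M] [IsManifold 𝓘(ℝ, E) ∞ M] [T2Space M]
  {F : Type*} [NormedAddCommGroup F] [NormedSpace ℝ F] [FiniteDimensional ℝ F]
  {A : M → Type*} [TopologicalSpace (TotalSpace F A)] [∀ x, TopologicalSpace (A x)]
  [∀ x, AddCommGroup (A x)] [∀ x, Module ℝ (A x)] [FiberBundle F A] [VectorBundle ℝ F A]
  [ContMDiffVectorBundle ∞ F A 𝓘(ℝ, E)]
  {E' : Type*} [NormedAddCommGroup E'] [NormedSpace ℝ E'] [FiniteDimensional ℝ E']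
  {N : Type*} [TopologicalSpace N] [ChartedSpace E' N] [IsManifold 𝓘(ℝ, E') ∞ N] [T2Space N]
  {F' : Type*} [NormedAddCommGroup F'] [NormedSpace ℝ F'] [FiniteDimensional ℝ F']
  {B : N → Type*} [TopologicalSpace (TotalSpace F' B)] [∀ x, TopologicalSpace (B x)]
  [∀ x, AddCommGroup (B x)] [∀ x, Module ℝ (B x)] [FiberBundle F' B] [VectorBundle ℝ F' B]
  [ContMDiffVectorBundle ∞ F' B 𝓘(ℝ, E')]
  {𝒜 : LieAlgebroid E F A} {ℬ : LieAlgebroid E' F' B} {Φ : BundleMap E F A E' F' B}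

/-- The map `(b, u) ↦ (Tφ) u - ρ_B b`. -/
abbrev anchorDifference (ℬ : LieAlgebroid E' F' B) (Φ : BundleMap E F A E' F' B) (m : M) :
    B (Φ.base m) × TangentSpace 𝓘(ℝ, E) m →ₗ[ℝ] TangentSpace 𝓘(ℝ, E') (Φ.base m) :=
  (mfderiv 𝓘(ℝ, E) 𝓘(ℝ, E') Φ.base m).toLinearMap.comp (LinearMap.snd ℝ _ _) -
      (ℬ.anchor (Φ.base m)).comp (LinearMap.fst ℝ _ _)

theorem anchorDifference_apply (m : M) (b : B (Φ.base m)) (u : TangentSpace 𝓘(ℝ, E) m) :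
    anchorDifference ℬ Φ m (b, u) =
      mfderiv 𝓘(ℝ, E) 𝓘(ℝ, E') Φ.base m u - ℬ.anchor (Φ.base m) b := rfl

theorem anchorDifference_surjective {m : M}
    (hsub : Function.Surjective (mfderiv 𝓘(ℝ, E) 𝓘(ℝ, E') Φ.base m)) :
    Function.Surjective (anchorDifference ℬ Φ m) := by
  intro v
  obtain ⟨u, rfl⟩ := hsub v
  exact ⟨(0, u), by rw [anchorDifference_apply, map_zero, sub_zero]⟩

theorem ker_anchorDifference (hΦ : IsPullbackMorphism 𝒜 ℬ Φ) (m : M) :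
    LinearMap.ker (anchorDifference ℬ Φ m) =
      LinearMap.range ((Φ.map m).prod (𝒜.anchor m)) := by
  ext ⟨b, u⟩
  rw [LinearMap.mem_ker, anchorDifference_apply, sub_eq_zero]
  constructor
  · intro h
    obtain ⟨a, h1, h2⟩ := hΦ.exists_eq h.symm
    exact ⟨a, Prod.ext h1 h2⟩
  · rintro ⟨a, h⟩
    have h1 : Φ.map m a = b := congrArg Prod.fst h
    have h2 : 𝒜.anchor m a = u := congrArg Prod.snd h
    rw [← h1, ← h2, hΦ.anchor_map]

theorem canonicalIso_spec (hΦ : IsPullbackMorphism 𝒜 ℬ Φ) {m : M}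
    (hsub : Function.Surjective (mfderiv 𝓘(ℝ, E) 𝓘(ℝ, E') Φ.base m)) :
    IsCanonicalIso ((Φ.map m).prod (𝒜.anchor m)) (anchorDifference ℬ Φ m)
      (canonicalIso 𝒜 ℬ Φ m) := by
  have := finite_fiber F A m
  have := finite_fiber F' B (Φ.base m)
  exact Classical.epsilon_spec (exists_isCanonicalIso (finrank_fiber F A m)
    (finrank_fiber F' B (Φ.base m)) (finrank_tangentSpace m) (finrank_tangentSpace (Φ.base m))
    (hΦ.injective m) (anchorDifference_surjective hsub) (ker_anchorDifference hΦ m))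

theorem canonicalIso_bijective (hΦ : IsPullbackMorphism 𝒜 ℬ Φ) {m : M}
    (hsub : Function.Surjective (mfderiv 𝓘(ℝ, E) 𝓘(ℝ, E') Φ.base m)) :
    Function.Bijective (canonicalIso 𝒜 ℬ Φ m) := by
  have := finite_fiber F A m
  have := finite_fiber F' B (Φ.base m)
  exact (canonicalIso_spec hΦ hsub).bijective (finrank_fiber F A m)
    (finrank_fiber F' B (Φ.base m)) (finrank_tangentSpace m) (finrank_tangentSpace (Φ.base m))
    (hΦ.injective m) (anchorDifference_surjective hsub) (ker_anchorDifference hΦ m)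

theorem finrank_add_eq (hΦ : IsPullbackMorphism 𝒜 ℬ Φ) {m : M}
    (hsub : Function.Surjective (mfderiv 𝓘(ℝ, E) 𝓘(ℝ, E') Φ.base m)) :
    finrank ℝ F + finrank ℝ E' = finrank ℝ F' + finrank ℝ E := by
  have := finite_fiber F A m
  have := finite_fiber F' B (Φ.base m)
  have h1 := LinearMap.finrank_range_add_finrank_ker (anchorDifference ℬ Φ m)
  rw [LinearMap.range_eq_top.2 (anchorDifference_surjective hsub), finrank_top,
    ker_anchorDifference hΦ m, LinearMap.finrank_range_of_inj (hΦ.injective m),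
    finrank_prod, finrank_fiber F A m, finrank_fiber F' B (Φ.base m), finrank_tangentSpace m,
    finrank_tangentSpace (Φ.base m)] at h1
  rw [add_comm, h1]

variable (𝒜 Φ) in
/-- Sections of `A`, `TM`, `B` and `TN` near a point, which are adapted to `(Φ, φ)`. -/
structure AdaptedFrame (m : M) where
  /-- the dimension of the fibres of `φ` -/
  d : ℕ
  hr : finrank ℝ F' + d = finrank ℝ F
  hn : d + finrank ℝ E' = finrank ℝ E
  /-- sections of `A` -/
  b : Fin (finrank ℝ F) → Cₛ^∞⟮𝓘(ℝ, E); F, A⟯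
  /-- sections of `B` -/
  c : Fin (finrank ℝ F') → Cₛ^∞⟮𝓘(ℝ, E'); F', B⟯
  /-- vector fields on `M` -/
  ξ : Fin (finrank ℝ E) → VectorFields E M
  /-- vector fields on `N` -/
  Y : Fin (finrank ℝ E') → VectorFields E' N
  /-- a form on `M` -/
  μ : TopForm E M
  /-- a form on `N` -/
  ν : TopForm E' N
  /-- a form on `B` -/
  vol : Form E' F' B (finrank ℝ F')
  related_b : ∀ j, Related Φ m (b (Fin.cast hr (Fin.castAdd d j))) (c j)
  related_zero : ∀ k, Related Φ m (b (Fin.cast hr (Fin.natAdd _ k))) 0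
  anchor_b : ∀ k, 𝒜.anchorSec (b (Fin.cast hr (Fin.natAdd _ k))) =
    ξ (Fin.cast hn (Fin.castAdd _ k))
  lift_Y : ∀ l, ∀ᶠ y in 𝓝 m, mfderiv 𝓘(ℝ, E) 𝓘(ℝ, E') Φ.base y
    (ξ (Fin.cast hn (Fin.natAdd d l)) y) = Y l (Φ.base y)
  ker_le : LinearMap.ker (mfderiv 𝓘(ℝ, E) 𝓘(ℝ, E') Φ.base m).toLinearMap ≤
    Submodule.span ℝ (Set.range fun k ↦ ξ (Fin.cast hn (Fin.castAdd _ k)) m)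
  μ_ne_zero : μ.eval ξ m ≠ 0
  ν_Y : ∀ᶠ y in 𝓝 (Φ.base m), ν.1 y (fun l ↦ Y l y) = 1
  vol_c : ∀ᶠ y in 𝓝 (Φ.base m), vol.1 y (fun l ↦ c l y) = 1

/-- For `v` in the kernel of `Tφ`, the pair `(0, v)` lies in the fibre product, so a basis of the
kernel comes from sections of `A` related to `0`. Frames of `B` and `TN` are lifted by surjectivity
of `Tφ`. -/
theorem exists_adaptedFrame (hΦ : IsPullbackMorphism 𝒜 ℬ Φ) {m : M}
    (hsub : Function.Surjective (mfderiv 𝓘(ℝ, E) 𝓘(ℝ, E') Φ.base m)) :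
    Nonempty (AdaptedFrame 𝒜 Φ m) := by
  let T := (mfderiv 𝓘(ℝ, E) 𝓘(ℝ, E') Φ.base m).toLinearMap
  have hT : ∀ u, T u = mfderiv 𝓘(ℝ, E) 𝓘(ℝ, E') Φ.base m u := fun _ ↦ rfl
  let d := finrank ℝ (LinearMap.ker T)
  have hn : d + finrank ℝ E' = finrank ℝ E := by
    have h1 := LinearMap.finrank_range_add_finrank_ker T
    rw [LinearMap.range_eq_top.2 hsub, finrank_top, finrank_tangentSpace m,
      finrank_tangentSpace (Φ.base m)] at h1
    rw [add_comm, ← h1]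
  have hr : finrank ℝ F' + d = finrank ℝ F := by
    have h1 := finrank_add_eq hΦ hsub
    omega
  obtain ⟨c, vol, hc⟩ := exists_frame E' F' B (Φ.base m)
  obtain ⟨Y, ν, hν⟩ := exists_frame E' E' (fun y : N ↦ TangentSpace 𝓘(ℝ, E') y) (Φ.base m)
  obtain ⟨X, τ, hτ⟩ := exists_frame E E (fun y : M ↦ TangentSpace 𝓘(ℝ, E) y) m
  let v := Module.finBasis ℝ (LinearMap.ker T)
  have hv : ∀ k, ∃ a : Cₛ^∞⟮𝓘(ℝ, E); F, A⟯, 𝒜.anchorSec a m = (v k).1 ∧ Related Φ m a 0 := by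
    intro k
    have h0 : T (v k).1 = 0 := (v k).2
    obtain ⟨a₀, h1, h2⟩ := hΦ.exists_eq (m := m) (b := 0) (u := (v k).1) (by
      rw [map_zero]; exact h0.symm)
    obtain ⟨a, h3, h4⟩ := exists_related hΦ hsub (a₀ := a₀) (b := 0) h1
    exact ⟨a, by rw [𝒜.anchorSec_apply, h3, h2], h4⟩
  choose β₂ hβ₂ hβ₂' using hv
  have hcj : ∀ j, ∃ a : Cₛ^∞⟮𝓘(ℝ, E); F, A⟯, Related Φ m a (c j) := by
    intro j
    obtain ⟨u, hu⟩ := hsub (ℬ.anchor (Φ.base m) (c j (Φ.base m)))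
    obtain ⟨a₀, h1, -⟩ := hΦ.exists_eq hu.symm
    obtain ⟨a, -, h4⟩ := exists_related hΦ hsub h1
    exact ⟨a, h4⟩
  choose β₁ hβ₁ using hcj
  have hYl : ∀ l, ∃ u : VectorFields E M, ∀ᶠ y in 𝓝 m, mfderiv 𝓘(ℝ, E) 𝓘(ℝ, E') Φ.base y (u y) =
      Y l (Φ.base y) := by
    intro l
    obtain ⟨u₀, hu₀⟩ := hsub (Y l (Φ.base m))
    obtain ⟨u, -, hu⟩ := exists_lift_vectorField Φ.contMDiff_base hsub (Y l) hu₀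
    exact ⟨u, hu⟩
  choose U hU using hYl
  let b : Fin (finrank ℝ F) → Cₛ^∞⟮𝓘(ℝ, E); F, A⟯ := fun i ↦
    Fin.addCases β₁ β₂ (Fin.cast hr.symm i)
  let ξ : Fin (finrank ℝ E) → VectorFields E M := fun i ↦
    Fin.addCases (fun k ↦ 𝒜.anchorSec (β₂ k)) U (Fin.cast hn.symm i)
  have hb₁ : ∀ j, b (Fin.cast hr (Fin.castAdd d j)) = β₁ j := fun j ↦ by simp [b]
  have hb₂ : ∀ k, b (Fin.cast hr (Fin.natAdd _ k)) = β₂ k := fun k ↦ by simp [b]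
  have hξ₁ : ∀ k, ξ (Fin.cast hn (Fin.castAdd _ k)) = 𝒜.anchorSec (β₂ k) := fun k ↦ by simp [ξ]
  have hξ₂ : ∀ l, ξ (Fin.cast hn (Fin.natAdd d l)) = U l := fun l ↦ by simp [ξ]
  have hker : LinearMap.ker T ≤
      Submodule.span ℝ (Set.range fun k ↦ ξ (Fin.cast hn (Fin.castAdd _ k)) m) := by
    intro x hx
    have h1 := congrArg Subtype.val (v.sum_repr ⟨x, hx⟩)
    rw [Submodule.coe_sum] at h1
    change _ = x at h1
    rw [← h1]
    refine Submodule.sum_mem _ fun k _ ↦ Submodule.smul_mem _ _ (Submodule.subset_span ⟨k, ?_⟩)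
    change ξ _ m = _
    rw [hξ₁, hβ₂]
  have hspan : ⊤ ≤ Submodule.span ℝ (Set.range fun i ↦ ξ i m) := by
    intro x _
    have h1 := frame_expansion hν.self_of_nhds (T x)
    -- Subtracting from `x` the lifts of the components of `Tφ(x)` leaves a vertical vector.
    have h2 : x - ∑ l, ν.1 (Φ.base m) (Function.update (fun l ↦ Y l (Φ.base m)) l (T x)) • U l m ∈
        LinearMap.ker T := by
      rw [LinearMap.mem_ker, map_sub, map_sum, sub_eq_zero]
      conv_lhs => rw [h1]
      refine Finset.sum_congr rfl fun l _ ↦ ?_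
      rw [map_smul]
      exact congrArg _ (hU l).self_of_nhds.symm
    have h3 : ∀ i, ξ i m ∈ Submodule.span ℝ (Set.range fun i ↦ ξ i m) := fun i ↦
      Submodule.subset_span ⟨i, rfl⟩
    rw [← sub_add_cancel x
      (∑ l, ν.1 (Φ.base m) (Function.update (fun l ↦ Y l (Φ.base m)) l (T x)) • U l m)]
    refine Submodule.add_mem _ ?_ (Submodule.sum_mem _ fun l _ ↦ Submodule.smul_mem _ _ ?_)
    · refine Submodule.span_le.2 ?_ (hker h2)
      rintro _ ⟨k, rfl⟩
      exact h3 _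
    · rw [← hξ₂]
      exact h3 _
  have hμ : τ.eval ξ m ≠ 0 := by
    let e := basisOfTopLeSpanOfCardEqFinrank (fun i ↦ ξ i m) hspan
      ((Fintype.card_fin _).trans (finrank_tangentSpace m).symm)
    have he : ⇑e = fun i ↦ ξ i m := coe_basisOfTopLeSpanOfCardEqFinrank _ _ _
    have h1 : τ.1 m ≠ 0 := by
      intro h0
      have h2 := hτ.self_of_nhds
      rw [h0] at h2
      exact zero_ne_one h2
    have h2 := ((τ.1 m).map_basis_ne_zero_iff e).2 h1
    rwa [he] at h2
  exact ⟨{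
    d := d, hr := hr, hn := hn, b := b, c := c, ξ := ξ, Y := Y, μ := τ, ν := ν, vol := vol
    related_b := fun j ↦ by rw [hb₁]; exact hβ₁ j
    related_zero := fun k ↦ by rw [hb₂]; exact hβ₂' k
    anchor_b := fun k ↦ by rw [hb₂, hξ₁]
    lift_Y := fun l ↦ by rw [hξ₂]; exact hU l
    ker_le := hker
    μ_ne_zero := hμ
    ν_Y := hν
    vol_c := hc }⟩

namespace AdaptedFrame

variable {m : M} (fr : AdaptedFrame 𝒜 Φ m)

/-- The section of `L^A` defined by an adapted frame. -/
def source : (canonicalLine E F A).carrier := wedgeTmulSec fr.b fr.μ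

/-- The section of `L^B` defined by an adapted frame. -/
def target : (canonicalLine E' F' B).carrier := wedgeTmulSec fr.c fr.ν

theorem target_ne_zero : fr.target.1 (Φ.base m) ≠ 0 := by
  refine tmul_ne_zero_of_ne_zero ?_ ?_
  · intro h0
    have h1 := wedgeLift_ιMulti (fr.vol.1 (Φ.base m)) (fun l ↦ fr.c l (Φ.base m))
    rw [h0, map_zero, fr.vol_c.self_of_nhds] at h1
    exact zero_ne_one h1
  · intro h0
    have h1 := fr.ν_Y.self_of_nhds
    rw [h0] at h1
    exact zero_ne_one h1

/-- Near `m` the frame satisfies the hypotheses of `IsCanonicalIso.evalForm_adapted`, with the `(0,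
ξ_{d+l})` as lifts of the `Y l`; since `ν(Y) = 1`, evaluation on `Y` determines the image. -/
theorem canonicalIso_source (hΦ : IsPullbackMorphism 𝒜 ℬ Φ)
    (hsub : ∀ m, Function.Surjective (mfderiv 𝓘(ℝ, E) 𝓘(ℝ, E') Φ.base m)) :
    ∀ᶠ y in 𝓝 m, canonicalIso 𝒜 ℬ Φ y (fr.source.1 y) =
      fr.μ.eval fr.ξ y • fr.target.1 (Φ.base y) := by
  filter_upwards [eventually_all.2 fr.related_b, eventually_all.2 fr.related_zero,
    eventually_all.2 fr.lift_Y, Φ.contMDiff_base.continuous.continuousAt.eventually fr.ν_Y]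
    with y h1 h2 h3 h4
  have h5 := (canonicalIso_spec hΦ (hsub y)).evalForm_adapted (finrank_tangentSpace y) fr.hr fr.hn
    (b := fun i ↦ fr.b i y) (c := fun j ↦ fr.c j (Φ.base y)) (ξ := fun i ↦ fr.ξ i y) h1
    (fun k ↦ Prod.ext (h2 k) (congrArg (fun s ↦ s y) (fr.anchor_b k))) (fr.μ.1 y)
  have h6 : (fun l ↦ anchorDifference ℬ Φ y ((0 : B (Φ.base y)),
      fr.ξ (Fin.cast fr.hn (Fin.natAdd fr.d l)) y)) = fun l ↦ fr.Y l (Φ.base y) := by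
    funext l
    rw [anchorDifference_apply, map_zero, sub_zero, h3]
  rw [h6] at h5
  rw [eq_evalForm_tmul (finrank_tangentSpace (Φ.base y)) h4 (canonicalIso 𝒜 ℬ Φ y (fr.source.1 y))]
  refine (congrArg (· ⊗ₜ[ℝ] fr.ν.1 (Φ.base y)) h5).trans ?_
  exact (TensorProduct.smul_tmul' _ _ _).symm

theorem source_ne_zero (hΦ : IsPullbackMorphism 𝒜 ℬ Φ)
    (hsub : ∀ m, Function.Surjective (mfderiv 𝓘(ℝ, E) 𝓘(ℝ, E') Φ.base m)) :
    fr.source.1 m ≠ 0 := by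
  intro h0
  have h1 := (fr.canonicalIso_source hΦ hsub).self_of_nhds
  rw [h0, map_zero] at h1
  exact smul_ne_zero fr.μ_ne_zero fr.target_ne_zero h1.symm

/-- The decisive computation. The second term is the one which the Leibniz rule produces when
`Φ^!D^B` acts on `μ(ξ)` times the pulled-back target. -/
theorem canonicalIso_derivative (hΦ : IsPullbackMorphism 𝒜 ℬ Φ)
    (hsub : ∀ m, Function.Surjective (mfderiv 𝓘(ℝ, E) 𝓘(ℝ, E') Φ.base m))
    {a : Cₛ^∞⟮𝓘(ℝ, E); F, A⟯} {b₀ : Cₛ^∞⟮𝓘(ℝ, E'); F', B⟯} (hab : Related Φ m a b₀)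
    {D : Cₛ^∞⟮𝓘(ℝ, E); F, A⟯ → (canonicalLine E F A).carrier → (canonicalLine E F A).carrier}
    (hD : IsCanonicalRep 𝒜 D)
    {D' : Cₛ^∞⟮𝓘(ℝ, E'); F', B⟯ → (canonicalLine E' F' B).carrier →
      (canonicalLine E' F' B).carrier} (hD' : IsCanonicalRep ℬ D') :
    canonicalIso 𝒜 ℬ Φ m ((D a fr.source).1 m) =
      fr.μ.eval fr.ξ m • (D' b₀ fr.target).1 (Φ.base m) +
        dirDeriv (fr.μ.eval fr.ξ) m (𝒜.anchor m (a m)) • fr.target.1 (Φ.base m) := by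
  have h4 := fr.ν_Y.self_of_nhds
  obtain ⟨μ', hμ'⟩ := exists_isLieDerivative (𝒜.anchorSec a) fr.μ
  obtain ⟨ν', hν'⟩ := exists_isLieDerivative (ℬ.anchorSec b₀) fr.ν
  have h5 := (canonicalIso_spec hΦ (hsub m)).evalForm_derivative (finrank_tangentSpace m)
    fr.hr fr.hn (b := fun i ↦ fr.b i m) (b' := fun i ↦ 𝒜.bracket a (fr.b i) m)
    (c := fun j ↦ fr.c j (Φ.base m)) (c' := fun j ↦ ℬ.bracket b₀ (fr.c j) (Φ.base m))
    (ξ := fun i ↦ fr.ξ i m) (ξ' := fun i ↦ lieBr (𝒜.anchorSec a) (fr.ξ i) m)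
    (fun j ↦ (fr.related_b j).self_of_nhds)
    (fun k ↦ Prod.ext (fr.related_zero k).self_of_nhds (congrArg (fun s ↦ s m) (fr.anchor_b k)))
    (fun j ↦ (hab.bracket hΦ (fr.related_b j)).self_of_nhds)
    (fun k ↦ Prod.ext (((hab.bracket hΦ (fr.related_zero k)).self_of_nhds).trans (by
        rw [map_zero]; rfl)) (by
      rw [← fr.anchor_b k, ← 𝒜.anchorSec_bracket]; rfl))
    (hμ' fr.ξ m)
  have h6 : (fun l ↦ anchorDifference ℬ Φ m ((0 : B (Φ.base m)),
      fr.ξ (Fin.cast fr.hn (Fin.natAdd fr.d l)) m)) = fun l ↦ fr.Y l (Φ.base m) := by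
    funext l
    rw [anchorDifference_apply, map_zero, sub_zero, (fr.lift_Y l).self_of_nhds]
  rw [h6] at h5
  -- `[ρ a, ξ_{d+l}]` is a lift of `[ρ b₀, Y_l]`, and modulo vertical vectors only the lifted field
  -- matters.
  have h7 : ∀ l, fr.μ.1 m (Function.update (fun i ↦ fr.ξ i m) (Fin.cast fr.hn (Fin.natAdd fr.d l))
      (lieBr (𝒜.anchorSec a) (fr.ξ (Fin.cast fr.hn (Fin.natAdd fr.d l))) m)) =
      fr.μ.eval fr.ξ m * fr.ν.1 (Φ.base m) (Function.update (fun l ↦ fr.Y l (Φ.base m)) l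
        (lieBr (ℬ.anchorSec b₀) (fr.Y l) (Φ.base m))) := by
    intro l
    have h8 := alternating_update_of_surjective (finrank_tangentSpace (Φ.base m)) fr.hn
      (mfderiv 𝓘(ℝ, E) 𝓘(ℝ, E') Φ.base m).toLinearMap (ξ := fun i ↦ fr.ξ i m) fr.ker_le
      (fun l ↦ (fr.lift_Y l).self_of_nhds) h4 (fr.μ.1 m) l
      (lieBr (𝒜.anchorSec a) (fr.ξ (Fin.cast fr.hn (Fin.natAdd fr.d l))) m)
    rw [h8]
    have h9 := mfderiv_lieBr Φ.contMDiff_base (hab.anchor hΦ) (fr.lift_Y l)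
    exact congrArg (fun v ↦ fr.μ.eval fr.ξ m * fr.ν.1 (Φ.base m)
      (Function.update (fun l ↦ fr.Y l (Φ.base m)) l v)) h9
  simp only [h7, ← Finset.mul_sum] at h5
  have hs : (D a fr.source).1 m = ∑ j, exteriorPower.ιMulti ℝ (finrank ℝ F)
      (Function.update (fun i ↦ fr.b i m) j (𝒜.bracket a (fr.b j) m)) ⊗ₜ[ℝ] fr.μ.1 m +
        exteriorPower.ιMulti ℝ (finrank ℝ F) (fun i ↦ fr.b i m) ⊗ₜ[ℝ] μ'.1 m := by
    rw [source, hD.2 a fr.b fr.μ μ' hμ', SectionSpace.coe_add, SectionSpace.sum_apply]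
    simp only [← update_sec_apply]
    rfl
  have ht : (D' b₀ fr.target).1 (Φ.base m) = ∑ j, exteriorPower.ιMulti ℝ (finrank ℝ F')
      (Function.update (fun i ↦ fr.c i (Φ.base m)) j (ℬ.bracket b₀ (fr.c j) (Φ.base m)))
        ⊗ₜ[ℝ] fr.ν.1 (Φ.base m) +
        exteriorPower.ιMulti ℝ (finrank ℝ F') (fun i ↦ fr.c i (Φ.base m))
          ⊗ₜ[ℝ] ν'.1 (Φ.base m) := by
    rw [target, hD'.2 b₀ fr.c fr.ν ν' hν', SectionSpace.coe_add, SectionSpace.sum_apply]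
    simp only [← update_sec_apply]
    rfl
  have hν := hν' fr.Y (Φ.base m)
  -- As `ν(Y)` is constant near `φ(m)`, the Lie derivative of `ν` on `Y` consists of bracket terms
  -- only.
  rw [dirDeriv_congr (g := fun _ ↦ 1) fr.ν_Y, dirDeriv_const, zero_sub] at hν
  refine evalForm_injective (finrank_tangentSpace (Φ.base m)) h4 ?_
  rw [hs, ht]
  refine h5.trans ?_
  have htar : fr.target.1 (Φ.base m) = exteriorPower.ιMulti ℝ (finrank ℝ F')
      (fun i ↦ fr.c i (Φ.base m)) ⊗ₜ[ℝ] fr.ν.1 (Φ.base m) := rfl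
  rw [htar]
  simp only [map_add, map_smul, map_sum, evalForm_tmul, h4, one_smul, hν]
  have harith : ∀ (h δ k : ℝ) (Z z : ⋀[ℝ]^(finrank ℝ F') (B (Φ.base m))),
      h • Z + (δ - h * k) • z = h • (Z + (-k) • z) + δ • z := by
    intro h δ k Z z
    module
  exact harith _ _ _ _ _

end AdaptedFrame

end CanonicalIso

/-! ### The canonical isomorphism is equivariant -/

section ModuleIso

variable {E : Type*} [NormedAddCommGroup E] [NormedSpace ℝ E] [FiniteDimensional ℝ E]
  {M : Type*} [TopologicalSpace M] [ChartedSpace E M] [IsManifold 𝓘(ℝ, E) ∞ M] [T2Space M]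
  {F : Type*} [NormedAddCommGroup F] [NormedSpace ℝ F] [FiniteDimensional ℝ F]
  {A : M → Type*} [TopologicalSpace (TotalSpace F A)] [∀ x, TopologicalSpace (A x)]
  [∀ x, AddCommGroup (A x)] [∀ x, Module ℝ (A x)] [FiberBundle F A] [VectorBundle ℝ F A]
  [ContMDiffVectorBundle ∞ F A 𝓘(ℝ, E)]
  {E' : Type*} [NormedAddCommGroup E'] [NormedSpace ℝ E'] [FiniteDimensional ℝ E']
  {N : Type*} [TopologicalSpace N] [ChartedSpace E' N] [IsManifold 𝓘(ℝ, E') ∞ N] [T2Space N]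
  {F' : Type*} [NormedAddCommGroup F'] [NormedSpace ℝ F'] [FiniteDimensional ℝ F']
  {B : N → Type*} [TopologicalSpace (TotalSpace F' B)] [∀ x, TopologicalSpace (B x)]
  [∀ x, AddCommGroup (B x)] [∀ x, Module ℝ (B x)] [FiberBundle F' B] [VectorBundle ℝ F' B]
  [ContMDiffVectorBundle ∞ F' B 𝓘(ℝ, E')]
  {𝒜 : LieAlgebroid E F A} {ℬ : LieAlgebroid E' F' B} {Φ : BundleMap E F A E' F' B}

theorem canonicalRep_spec (𝒜 : LieAlgebroid E F A) : IsCanonicalRep 𝒜 (canonicalRep 𝒜) :=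
  Classical.epsilon_spec (exists_isCanonicalRep 𝒜)

theorem pullbackRep_spec (hΦ : IsPullbackMorphism 𝒜 ℬ Φ)
    (hsub : ∀ m, Function.Surjective (mfderiv 𝓘(ℝ, E) 𝓘(ℝ, E') Φ.base m)) :
    IsPullbackRep 𝒜 Φ (canonicalLine E' F' B) (canonicalRep ℬ)
      (pullbackRep 𝒜 Φ (canonicalLine E' F' B) (canonicalRep ℬ)) :=
  Classical.epsilon_spec (exists_isPullbackRep hΦ hsub (isLine_canonicalLine E' F' B ℬ)
    (canonicalRep_spec ℬ).1)

/-- The canonical isomorphism is an isomorphism of `A`-modules. -/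
theorem isModuleIso_canonicalIso (hΦ : IsPullbackMorphism 𝒜 ℬ Φ)
    (hsub : ∀ m, Function.Surjective (mfderiv 𝓘(ℝ, E) 𝓘(ℝ, E') Φ.base m)) :
    IsModuleIso 𝒜 (canonicalLine E F A) ((canonicalLine E' F' B).pullback E Φ.base)
      (canonicalRep 𝒜) (pullbackRep 𝒜 Φ (canonicalLine E' F' B) (canonicalRep ℬ))
      (canonicalIso 𝒜 ℬ Φ) := by
  have hA := isLine_canonicalLine E F A 𝒜
  have hB := isLine_canonicalLine E' F' B ℬ
  have hP : IsLine ((canonicalLine E' F' B).pullback E Φ.base) := hB.pullback Φ.contMDiff_base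
  have hD := canonicalRep_spec 𝒜
  have hD' := pullbackRep_spec hΦ hsub
  have hDc := hD.1.isConnection
  have hDc' := hD'.1.isConnection
  refine ⟨hD.1, hD'.1, fun m ↦ canonicalIso_bijective hΦ (hsub m), fun s ↦ ⟨?_, ?_⟩, ?_⟩
  · intro hs
    refine hP.mem_of_local _ fun m ↦ ?_
    obtain ⟨fr⟩ := exists_adaptedFrame hΦ (hsub m)
    obtain ⟨f, hf⟩ := (hA.ratio (fr.source_ne_zero hΦ hsub)).2 ⟨s, hs⟩
    refine ⟨(((canonicalLine E' F' B).pullback E Φ.base).funSMul (f * fr.μ.eval fr.ξ)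
      ((canonicalLine E' F' B).pullbackSec Φ.base fr.target)).1, Subtype.property _, ?_⟩
    filter_upwards [hf, fr.canonicalIso_source hΦ hsub] with y h1 h2
    change canonicalIso 𝒜 ℬ Φ y (s y) = (f y * fr.μ.eval fr.ξ y) • fr.target.1 (Φ.base y)
    change s y = _ at h1
    rw [h1, map_smul, h2, smul_smul]
  · intro hs
    refine hA.mem_of_local _ fun m ↦ ?_
    obtain ⟨fr⟩ := exists_adaptedFrame hΦ (hsub m)
    obtain ⟨f, hf⟩ := (hP.ratio (s := (canonicalLine E' F' B).pullbackSec Φ.base fr.target)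
      fr.target_ne_zero).2 ⟨_, hs⟩
    obtain ⟨k, hk⟩ := exists_local_inverse fr.μ_ne_zero
    refine ⟨((canonicalLine E F A).funSMul (f * k) fr.source).1, Subtype.property _, ?_⟩
    filter_upwards [hf, hk, fr.canonicalIso_source hΦ hsub] with y h1 h2 h3
    refine (canonicalIso_bijective hΦ (hsub y)).1 ?_
    change canonicalIso 𝒜 ℬ Φ y (s y) = f y • fr.target.1 (Φ.base y) at h1
    change _ = canonicalIso 𝒜 ℬ Φ y ((f y * k y) • fr.source.1 y)
    rw [h1, map_smul, h3, smul_smul, mul_assoc, mul_comm (k y), h2, mul_one]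
  · intro a s s' hs m
    obtain ⟨fr⟩ := exists_adaptedFrame hΦ (hsub m)
    obtain ⟨f, hf⟩ := (hA.ratio (fr.source_ne_zero hΦ hsub)).2 s
    let h : C^∞⟮𝓘(ℝ, E), M; ℝ⟯ := fr.μ.eval fr.ξ
    let t := (canonicalLine E' F' B).pullbackSec (E := E) Φ.base fr.target
    -- Both sections are expressed with the same coefficient `f` in frames matched by `ℓ^φ`; the
    -- Leibniz terms in `f` agree, so equivariance is needed only on the source frame.
    have hs' : ∀ᶠ y in 𝓝 m, s'.1 y =
        f y • (((canonicalLine E' F' B).pullback E Φ.base).funSMul h t).1 y := by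
      filter_upwards [hf, fr.canonicalIso_source hΦ hsub] with y h1 h2
      rw [hs, h1, map_smul, h2]
      rfl
    rw [hDc.apply_of_eq_smul a hf, hDc'.apply_of_eq_smul a hs', map_add, map_smul, map_smul,
      (fr.canonicalIso_source hΦ hsub).self_of_nhds, hDc'.leibniz]
    obtain ⟨b₀, hb₀⟩ := exists_section_eq (E := E') (F := F') (Φ.map m (a m))
    -- Derivatives at `m` depend only on `a(m)`, so `a` may be exchanged for a section related to
    -- some `b₀`.
    obtain ⟨a', ha', hab⟩ := exists_related hΦ (hsub m) hb₀.symm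
    rw [hDc.congr_left ha'.symm, fr.canonicalIso_derivative hΦ hsub hab hD (canonicalRep_spec ℬ),
      hD'.2 a b₀ fr.target m hb₀.symm, ha']
    rfl

end ModuleIso

/-! ### Characteristic cocycles and squares of line bundles -/

section CharacteristicClass

variable {E : Type*} [NormedAddCommGroup E] [NormedSpace ℝ E] [FiniteDimensional ℝ E]
  {M : Type*} [TopologicalSpace M] [ChartedSpace E M] [IsManifold 𝓘(ℝ, E) ∞ M] [T2Space M]
  {F : Type*} [NormedAddCommGroup F] [NormedSpace ℝ F] [FiniteDimensional ℝ F]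
  {A : M → Type*} [TopologicalSpace (TotalSpace F A)] [∀ x, TopologicalSpace (A x)]
  [∀ x, AddCommGroup (A x)] [∀ x, Module ℝ (A x)] [FiberBundle F A] [VectorBundle ℝ F A]
  [ContMDiffVectorBundle ∞ F A 𝓘(ℝ, E)]
  {L : M → Type*} [∀ x, AddCommGroup (L x)] [∀ x, Module ℝ (L x)]
  {𝒜 : LieAlgebroid E F A} {S : SectionSpace E L}
  {D : Cₛ^∞⟮𝓘(ℝ, E); F, A⟯ → S.carrier → S.carrier}

/-- The ratio of a section by a nowhere-vanishing section. -/
theorem IsLine.exists_global_ratio (hS : IsLine S) {s : S.carrier} (hs : ∀ x, s.1 x ≠ 0)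
    (t : S.carrier) : ∃ f : C^∞⟮𝓘(ℝ, E), M; ℝ⟯, ∀ x, t.1 x = f x • s.1 x := by
  choose f hf using fun x ↦ (hS.ratio (hs x)).2 t
  refine ⟨⟨fun x ↦ f x x, fun x ↦ ?_⟩, fun x ↦ (hf x).self_of_nhds⟩
  refine (f x).contMDiff.contMDiffAt.congr_of_eventuallyEq ?_
  filter_upwards [hf x] with y hy
  exact smul_cancel_right (hs y) ((hf y).self_of_nhds.symm.trans hy)

/-- The coefficient `g a` in `D_a s = g a · s` is linear over functions in `a`, hence a form; its
closedness is the flatness of `D`. -/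
theorem exists_characteristicCocycle (hS : IsLine S) (hD : IsRepresentation 𝒜 S D) {s : S.carrier}
    (hs : ∀ x, s.1 x ≠ 0) : ∃ α : cocycles 𝒜, IsCharacteristicCocycle D s α := by
  choose g hg using fun a ↦ hS.exists_global_ratio hs (D a s)
  let lin : ∀ x, Cₛ^∞⟮𝓘(ℝ, E); F, A⟯ →ₗ[ℝ] ℝ := fun x ↦
    { toFun := fun a ↦ g a x
      map_add' := fun a a' ↦ smul_cancel_right (hs x) (by
        rw [← hg, hD.add_left, SectionSpace.coe_add, hg, hg, ← add_smul])
      map_smul' := fun c a ↦ smul_cancel_right (hs x) (by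
        have h1 := hD.isConnection.apply_of_eq_sum (x := x) (a := c • a) {()}
          (t := fun _ ↦ a) (c := fun _ ↦ c) (by rw [Finset.sum_singleton]; rfl) s
        rw [← hg, h1, Finset.sum_singleton, hg, smul_smul]
        rfl) }
  have hfun : ∀ f a x, g (funSMul f a) x = f x * g a x := fun f a x ↦
    smul_cancel_right (hs x) (by
      rw [← hg, hD.fun_smul_left, SectionSpace.coe_funSMul, hg, smul_smul])
  obtain ⟨α, hα⟩ := exists_form_of_tensorial (k := 1)
    (fun x ↦ AlternatingMap.ofSubsingleton ℝ _ ℝ (0 : Fin 1) (lin x))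
    (fun a ↦ (g (a 0)).contMDiff) (by
      intro x a i f b
      obtain rfl := Subsingleton.elim i 0
      change g (Function.update a 0 (funSMul f b) 0) x = f x * g (Function.update a 0 b 0) x
      rw [Function.update_self, Function.update_self, hfun])
  have hα' : ∀ (a : Fin 1 → Cₛ^∞⟮𝓘(ℝ, E); F, A⟯) x, α.1 x (fun i ↦ a i x) = g (a 0) x := hα
  have hclosed : IsDifferential 𝒜 α 0 := by
    intro a x
    have h1 : Finset.Ioi (0 : Fin 2) = {1} := rfl
    have h2 : Finset.Ioi (1 : Fin 2) = ∅ := rfl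
    rw [Fin.sum_univ_two, Fin.sum_univ_two, h1, h2, Finset.sum_singleton, Finset.sum_empty]
    have h3 : ∀ i : Fin 2, (fun y ↦ α.1 y (fun l ↦ a (i.succAbove l) y)) =
        g (a (i.succAbove 0)) := fun i ↦ funext fun y ↦ hα' (fun l ↦ a (i.succAbove l)) y
    have h4 := hα' (fun l ↦ Function.update a 1 (𝒜.bracket (a 0) (a 1)) ((0 : Fin 2).succAbove l)) x
    rw [h3, h3, h4]
    have h5 : (0 : Fin 2).succAbove 0 = 1 := rfl
    have h6 : (1 : Fin 2).succAbove 0 = 0 := rfl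
    rw [h5, h6, Function.update_self]
    have h7 : g (𝒜.bracket (a 0) (a 1)) x = dirDeriv (g (a 1)) x (𝒜.anchor x (a 0 x)) -
        dirDeriv (g (a 0)) x (𝒜.anchor x (a 1 x)) := by
      refine smul_cancel_right (hs x) ?_
      have h8 : ∀ a a', (D a (D a' s)).1 x =
          (g a' x * g a x + dirDeriv (g a') x (𝒜.anchor x (a x))) • s.1 x := by
        intro a a'
        rw [hD.isConnection.apply_of_eq_smul a (Eventually.of_forall (hg a')), hg, smul_smul,
          ← add_smul]
      rw [← hg, ← hD.flat, SectionSpace.coe_sub, h8, h8, ← sub_smul]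
      congr 1
      ring
    rw [h7]
    change (0 : ℝ) = _
    simp only [Fin.val_zero, Fin.val_one, pow_zero, zero_add, pow_one]
    ring
  refine ⟨⟨α, hclosed⟩, fun a x ↦ ?_⟩
  rw [hg]
  exact congrArg (· • s.1 x) (hα' (fun _ ↦ a) x)

theorem tensorRep_spec (hS : IsLine S) (hD : IsRepresentation 𝒜 S D) :
    IsTensorRep 𝒜 S S D D (tensorRep 𝒜 S S D D) :=
  Classical.epsilon_spec (exists_isTensorRep hS hS hD hD)

/-- The square of a line bundle has a nowhere-vanishing section. -/
theorem exists_nonvanishing_tensor [SecondCountableTopology M] (hS : IsLine S) :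
    ∃ t : (S.tensor S).carrier, ∀ x, t.1 x ≠ 0 := by
  have : LocallyCompactSpace M := ChartedSpace.locallyCompactSpace E M
  choose s hs using hS.exists_ne_zero
  have hU : ∀ x, ∃ U : Set M, IsOpen U ∧ x ∈ U ∧ ∀ y ∈ U, (s x).1 y ≠ 0 := by
    intro x
    obtain ⟨U, h1, h2, h3⟩ := eventually_nhds_iff.1 (hS.ratio (hs x)).1
    exact ⟨U, h2, h3, h1⟩
  choose U hUo hxU hUs using hU
  obtain ⟨ρ, hρ⟩ := SmoothPartitionOfUnity.exists_isSubordinate 𝓘(ℝ, E) isClosed_univ U hUo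
    (fun x _ ↦ Set.mem_iUnion.2 ⟨x, hxU x⟩)
  have hfin : ∀ x, ∃ J : Finset M, ∀ᶠ y in 𝓝 x, Function.support (fun i ↦ ρ i y) ⊆ J := by
    intro x
    obtain ⟨V, hV, hfin⟩ := ρ.locallyFinite x
    refine ⟨hfin.toFinset, Filter.mem_of_superset hV fun y hy i hi ↦ ?_⟩
    exact hfin.mem_toFinset.2 ⟨y, hi, hy⟩
  -- Squares of local frames glued by a partition of unity: a change of frame multiplies a square by
  -- a positive function, so no cancellation can occur.
  let t : ∀ y, L y ⊗[ℝ] L y := fun y ↦ ∑ᶠ i, ρ i y • (S.tmul S (s i) (s i)).1 y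
  have ht : ∀ {y} {J : Finset M}, Function.support (fun i ↦ ρ i y) ⊆ J →
      t y = ∑ i ∈ J, ρ i y • (S.tmul S (s i) (s i)).1 y := by
    intro y J hJ
    refine finsum_eq_sum_of_support_subset _ (subset_trans (fun i hi ↦ ?_) hJ)
    intro h0
    exact hi (by simp only [h0, zero_smul])
  have hmem : t ∈ (S.tensor S).carrier := by
    refine (hS.tensor hS).mem_of_local _ fun x ↦ ?_
    obtain ⟨J, hJ⟩ := hfin x
    refine ⟨(∑ i ∈ J, (S.tensor S).funSMul (ρ i) (S.tmul S (s i) (s i))).1,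
      Subtype.property _, ?_⟩
    filter_upwards [hJ] with y hy
    rw [ht hy, SectionSpace.sum_apply]
    rfl
  refine ⟨⟨t, hmem⟩, fun x h0 ↦ ?_⟩
  obtain ⟨J, hJ⟩ := hfin x
  choose c hc using fun i ↦ (hS.ratio (hs x)).2 (s i)
  have h1 : t x = (∑ i ∈ J, ρ i x * (c i x) ^ 2) • (S.tmul S (s x) (s x)).1 x := by
    rw [ht hJ.self_of_nhds, Finset.sum_smul]
    refine Finset.sum_congr rfl fun i _ ↦ ?_
    rw [SectionSpace.coe_tmul, SectionSpace.coe_tmul, (hc i).self_of_nhds,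
      TensorProduct.smul_tmul_smul, smul_smul, sq]
  -- A sum of nonnegative terms. Its vanishing kills each `ρ i x`, because `s i` does not vanish on
  -- the support of `ρ i`; this contradicts `∑ ρ i = 1`.
  have h2 : (∑ i ∈ J, ρ i x * (c i x) ^ 2) = 0 :=
    (smul_eq_zero.1 (h1.symm.trans h0)).resolve_right (tmul_ne_zero_of_ne_zero (hs x) (hs x))
  rw [Finset.sum_eq_zero_iff_of_nonneg fun i _ ↦ mul_nonneg (ρ.nonneg i x) (sq_nonneg _)] at h2
  have h3 : ∀ i, ρ i x = 0 := by
    intro i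
    by_contra hi
    have h4 := h2 i (hJ.self_of_nhds hi)
    have h5 : c i x = 0 := by simpa [hi] using h4
    have h6 := (hc i).self_of_nhds
    rw [h5, zero_smul] at h6
    exact hUs i x (hρ i (subset_tsupport _ hi)) h6
  have h7 := ρ.sum_eq_one (Set.mem_univ x)
  simp [h3] at h7

theorem exists_isCharacteristicClass [SecondCountableTopology M] (hS : IsLine S)
    (hD : IsRepresentation 𝒜 S D) : ∃ c, IsCharacteristicClass 𝒜 S D c := by
  by_cases h : ∃ s : S.carrier, ∀ x, s.1 x ≠ 0
  · obtain ⟨s, hs⟩ := h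
    obtain ⟨α, hα⟩ := exists_characteristicCocycle hS hD hs
    exact ⟨_, Or.inl ⟨s, α, hs, hα, rfl⟩⟩
  · obtain ⟨t, ht⟩ := exists_nonvanishing_tensor hS
    obtain ⟨α, hα⟩ := exists_characteristicCocycle (hS.tensor hS) (tensorRep_spec hS hD).1 ht
    refine ⟨(2⁻¹ : ℝ) • H1.mk α, Or.inr ⟨h, t, α, ht, hα, ?_⟩⟩
    rw [smul_smul, mul_inv_cancel₀ two_ne_zero, one_smul]

/-- If `s` is nowhere vanishing with cocycle `α`, then `s ⊗ s` has cocycle `2 α`. Thus both cases of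
the definition are treated through `L ⊗ L`, and orientability plays no further role. -/
theorem IsCharacteristicClass.exists_tensor {c : H1 𝒜} (hS : IsLine S)
    (hD : IsRepresentation 𝒜 S D) (hc : IsCharacteristicClass 𝒜 S D c) :
    ∃ (t : (S.tensor S).carrier) (α : cocycles 𝒜), (∀ x, t.1 x ≠ 0) ∧
      IsCharacteristicCocycle (tensorRep 𝒜 S S D D) t α ∧ (2 : ℝ) • c = H1.mk α := by
  obtain ⟨s, α, hs, hα, rfl⟩ | ⟨-, h⟩ := hc
  · refine ⟨S.tmul S s s, (2 : ℝ) • α, fun x ↦ tmul_ne_zero_of_ne_zero (hs x) (hs x),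
      fun a x ↦ ?_, rfl⟩
    rw [(tensorRep_spec hS hD).2, SectionSpace.coe_add, SectionSpace.coe_tmul,
      SectionSpace.coe_tmul, SectionSpace.coe_tmul, ← hα a x, TensorProduct.tmul_smul,
      ← TensorProduct.smul_tmul', ← two_smul ℝ, smul_smul]
    rfl
  · exact h

/-- The characteristic cocycle of `D ⊗ D` in terms of a local frame. -/
theorem IsCharacteristicCocycle.tensor_local (hS : IsLine S) (hD : IsRepresentation 𝒜 S D)
    {t : (S.tensor S).carrier} {α : cocycles 𝒜}
    (hα : IsCharacteristicCocycle (tensorRep 𝒜 S S D D) t α) {s : S.carrier} {x : M}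
    (hs : s.1 x ≠ 0) {p : C^∞⟮𝓘(ℝ, E), M; ℝ⟯}
    (hp : ∀ᶠ y in 𝓝 x, t.1 y = p y • (S.tmul S s s).1 y) {a : Cₛ^∞⟮𝓘(ℝ, E); F, A⟯} {γ : ℝ}
    (hγ : (D a s).1 x = γ • s.1 x) :
    α.1.1 x (fun _ ↦ a x) * p x = dirDeriv p x (𝒜.anchor x (a x)) + 2 * p x * γ := by
  refine smul_cancel_right (tmul_ne_zero_of_ne_zero hs hs) ?_
  have h1 := hα a x
  rw [hp.self_of_nhds, (tensorRep_spec hS hD).1.isConnection.apply_of_eq_smul a hp,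
    (tensorRep_spec hS hD).2, SectionSpace.coe_add, SectionSpace.coe_tmul, SectionSpace.coe_tmul,
    SectionSpace.coe_tmul, hγ, TensorProduct.tmul_smul, ← TensorProduct.smul_tmul', ← two_smul ℝ,
    smul_smul, smul_smul, smul_smul, ← add_smul] at h1
  rw [h1]
  congr 1
  ring

end CharacteristicClass

/-! ### Modular classes and logarithmic coboundaries -/

section Cocycles

variable {E : Type*} [NormedAddCommGroup E] [NormedSpace ℝ E] [FiniteDimensional ℝ E]
  {M : Type*} [TopologicalSpace M] [ChartedSpace E M] [IsManifold 𝓘(ℝ, E) ∞ M] [T2Space M]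
  {F : Type*} [NormedAddCommGroup F] [NormedSpace ℝ F] [FiniteDimensional ℝ F]
  {A : M → Type*} [TopologicalSpace (TotalSpace F A)] [∀ x, TopologicalSpace (A x)]
  [∀ x, AddCommGroup (A x)] [∀ x, Module ℝ (A x)] [FiberBundle F A] [VectorBundle ℝ F A]
  [ContMDiffVectorBundle ∞ F A 𝓘(ℝ, E)]
  {E' : Type*} [NormedAddCommGroup E'] [NormedSpace ℝ E'] [FiniteDimensional ℝ E']
  {N : Type*} [TopologicalSpace N] [ChartedSpace E' N] [IsManifold 𝓘(ℝ, E') ∞ N] [T2Space N]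
  {F' : Type*} [NormedAddCommGroup F'] [NormedSpace ℝ F'] [FiniteDimensional ℝ F']
  {B : N → Type*} [TopologicalSpace (TotalSpace F' B)] [∀ x, TopologicalSpace (B x)]
  [∀ x, AddCommGroup (B x)] [∀ x, Module ℝ (B x)] [FiberBundle F' B] [VectorBundle ℝ F' B]
  [ContMDiffVectorBundle ∞ F' B 𝓘(ℝ, E')]
  {𝒜 : LieAlgebroid E F A} {ℬ : LieAlgebroid E' F' B} {Φ : BundleMap E F A E' F' B}

theorem isCharacteristicClass_modularClass [SecondCountableTopology M] (𝒜 : LieAlgebroid E F A) :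
    IsCharacteristicClass 𝒜 (canonicalLine E F A) (canonicalRep 𝒜) (modularClass 𝒜) :=
  Classical.epsilon_spec (exists_isCharacteristicClass (isLine_canonicalLine E F A 𝒜)
    (canonicalRep_spec 𝒜).1)

/-- The primitive is `log |f|`. -/
theorem mem_coboundaries_of_log {α : Form E F A 1} {f : C^∞⟮𝓘(ℝ, E), M; ℝ⟯}
    (hf : ∀ x, f x ≠ 0) (hα : ∀ (a : Cₛ^∞⟮𝓘(ℝ, E); F, A⟯) x,
      α.1 x (fun _ ↦ a x) = dirDeriv f x (𝒜.anchor x (a x)) / f x) :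
    α ∈ coboundaries 𝒜 := by
  refine ⟨⟨fun x ↦ AlternatingMap.constOfIsEmpty ℝ _ _ (Real.log (f x)), fun a x ↦ ?_⟩,
    fun a x ↦ ?_⟩
  · exact ((Real.contDiffAt_log.2 (hf x)).contMDiffAt.comp x f.contMDiff.contMDiffAt)
  · have h1 : (fun i ↦ a i x) = fun _ ↦ a 0 x := by
      funext i
      rw [Subsingleton.elim (α := Fin 1) i 0]
    rw [h1, hα, ← dirDeriv_log f.contMDiff (hf x)]
    have h2 : Finset.Ioi (0 : Fin 1) = ∅ := rfl
    rw [Fin.sum_univ_one, Fin.sum_univ_one, h2, Finset.sum_empty, add_zero]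
    simp only [Fin.val_zero, pow_zero, one_mul]
    rfl

end Cocycles

/-! ### Comparison of characteristic cocycles under an isomorphism -/

section Comparison

variable {E : Type*} [NormedAddCommGroup E] [NormedSpace ℝ E] [FiniteDimensional ℝ E]
  {M : Type*} [TopologicalSpace M] [ChartedSpace E M] [IsManifold 𝓘(ℝ, E) ∞ M] [T2Space M]
  {F : Type*} [NormedAddCommGroup F] [NormedSpace ℝ F] [FiniteDimensional ℝ F]
  {A : M → Type*} [TopologicalSpace (TotalSpace F A)] [∀ x, TopologicalSpace (A x)]
  [∀ x, AddCommGroup (A x)] [∀ x, Module ℝ (A x)] [FiberBundle F A] [VectorBundle ℝ F A]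
  [ContMDiffVectorBundle ∞ F A 𝓘(ℝ, E)]
  {E' : Type*} [NormedAddCommGroup E'] [NormedSpace ℝ E'] [FiniteDimensional ℝ E']
  {N : Type*} [TopologicalSpace N] [ChartedSpace E' N] [IsManifold 𝓘(ℝ, E') ∞ N] [T2Space N]
  {F' : Type*} [NormedAddCommGroup F'] [NormedSpace ℝ F'] [FiniteDimensional ℝ F']
  {B : N → Type*} [TopologicalSpace (TotalSpace F' B)] [∀ x, TopologicalSpace (B x)]
  [∀ x, AddCommGroup (B x)] [∀ x, Module ℝ (B x)] [FiberBundle F' B] [VectorBundle ℝ F' B]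
  [ContMDiffVectorBundle ∞ F' B 𝓘(ℝ, E')]
  {𝒜 : LieAlgebroid E F A} {ℬ : LieAlgebroid E' F' B} {Φ : BundleMap E F A E' F' B}
  {L : M → Type*} [∀ x, AddCommGroup (L x)] [∀ x, Module ℝ (L x)]
  {K : N → Type*} [∀ x, AddCommGroup (K x)] [∀ x, Module ℝ (K x)]
  {S : SectionSpace E L} {S' : SectionSpace E' K}
  {D : Cₛ^∞⟮𝓘(ℝ, E); F, A⟯ → S.carrier → S.carrier}
  {D' : Cₛ^∞⟮𝓘(ℝ, E'); F', B⟯ → S'.carrier → S'.carrier}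
  {DP : Cₛ^∞⟮𝓘(ℝ, E); F, A⟯ → (S'.pullback E Φ.base).carrier → (S'.pullback E Φ.base).carrier}
  {ℓ : ∀ m, L m →ₗ[ℝ] K (Φ.base m)}

/-- An isomorphism from a representation on a line bundle to the pull-back of a representation
compares the characteristic cocycles of their squares. -/
theorem exists_comparison (hΦ : IsPullbackMorphism 𝒜 ℬ Φ) (hS : IsLine S) (hS' : IsLine S')
    (hD : IsRepresentation 𝒜 S D) (hD' : IsRepresentation ℬ S' D')
    (hDP : IsPullbackRep 𝒜 Φ S' D' DP) (hℓ : IsModuleIso 𝒜 S (S'.pullback E Φ.base) D DP ℓ)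
    {t : (S.tensor S).carrier} {α : cocycles 𝒜} (ht : ∀ x, t.1 x ≠ 0)
    (hα : IsCharacteristicCocycle (tensorRep 𝒜 S S D D) t α)
    {t' : (S'.tensor S').carrier} {α' : cocycles ℬ} (ht' : ∀ x, t'.1 x ≠ 0)
    (hα' : IsCharacteristicCocycle (tensorRep ℬ S' S' D' D') t' α') :
    ∃ f : C^∞⟮𝓘(ℝ, E), M; ℝ⟯, (∀ m, f m ≠ 0) ∧ ∀ (a : Cₛ^∞⟮𝓘(ℝ, E); F, A⟯) m,
      α.1.1 m (fun _ ↦ a m) - α'.1.1 (Φ.base m) (fun _ ↦ Φ.map m (a m)) =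
        dirDeriv f m (𝒜.anchor m (a m)) / f m := by
  have hP : IsLine (S'.pullback E Φ.base) := hS'.pullback Φ.contMDiff_base
  have hcont := fun m ↦ Φ.contMDiff_base.continuous.continuousAt (x := m)
  choose s hs using hS.exists_ne_zero
  choose y hy using fun m ↦ hS'.exists_ne_zero (Φ.base m)
  choose p hp using fun m ↦ ((hS.tensor hS).ratio (s := S.tmul S (s m) (s m))
    (tmul_ne_zero_of_ne_zero (hs m) (hs m))).2 t
  choose q hq using fun m ↦ ((hS'.tensor hS').ratio (s := S'.tmul S' (y m) (y m))
    (tmul_ne_zero_of_ne_zero (hy m) (hy m))).2 t'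
  let s' : M → (S'.pullback E Φ.base).carrier := fun m ↦
    ⟨fun z ↦ ℓ z ((s m).1 z), (hℓ.smooth_iff _).1 (s m).2⟩
  -- Around each `m`: `t = p s²`, `t' = q y²` and `ℓ(s) = h · (y ∘ φ)`. Hence `(ℓ ⊗ ℓ) t = (p h² /
  -- (q ∘ φ)) · (t' ∘ φ)`, where `k` below stands for the inverse of `q ∘ φ`.
  choose h hh using fun m ↦ (hP.ratio (s := S'.pullbackSec Φ.base (y m)) (hy m)).2 (s' m)
  have hh' : ∀ m, ∀ᶠ z in 𝓝 m, ℓ z ((s m).1 z) = h m z • (y m).1 (Φ.base z) := hh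
  have hh0 : ∀ m, h m m ≠ 0 := by
    intro m h0
    have h1 := (hh' m).self_of_nhds
    rw [h0, zero_smul] at h1
    exact hs m ((hℓ.bijective m).1 (h1.trans (map_zero _).symm))
  have hp0 : ∀ m, p m m ≠ 0 := by
    intro m h0
    refine ht m ?_
    rw [(hp m).self_of_nhds, h0, zero_smul]
  have hq0 : ∀ m, q m (Φ.base m) ≠ 0 := by
    intro m h0
    refine ht' (Φ.base m) ?_
    rw [(hq m).self_of_nhds, h0, zero_smul]
  let qφ : M → C^∞⟮𝓘(ℝ, E), M; ℝ⟯ := fun m ↦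
    ⟨fun z ↦ q m (Φ.base z), (q m).contMDiff.comp Φ.contMDiff_base⟩
  choose k hk using fun m ↦ exists_local_inverse (h := qφ m) (hq0 m)
  have hmap : ∀ m, ∀ᶠ z in 𝓝 m, TensorProduct.map (ℓ z) (ℓ z) (t.1 z) =
      (p m z * (h m z * h m z) * k m z) • t'.1 (Φ.base z) := by
    intro m
    filter_upwards [hp m, hh' m, (hcont m).eventually (hq m), hk m] with z h1 h2 h3 h4
    rw [h1, h3, map_smul, SectionSpace.coe_tmul, SectionSpace.coe_tmul, TensorProduct.map_tmul, h2,
      TensorProduct.smul_tmul_smul, smul_smul, smul_smul]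
    congr 1
    have h5 : q m (Φ.base z) * k m z = 1 := h4
    linear_combination (-(p m z * h m z ^ 2)) * h5
  -- Each local formula is taken at its centre. They glue smoothly because the ratio of `(ℓ ⊗ ℓ) t`
  -- to `t' ∘ φ` does not depend on the frames.
  let f₀ : M → ℝ := fun m ↦ p m m * (h m m * h m m) * k m m
  have hf₀loc : ∀ m, ∀ᶠ z in 𝓝 m, f₀ z = p m z * (h m z * h m z) * k m z := by
    intro m
    filter_upwards [hmap m] with z hz
    exact smul_cancel_right (ht' (Φ.base z)) ((hmap z).self_of_nhds.symm.trans hz)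
  let f : C^∞⟮𝓘(ℝ, E), M; ℝ⟯ := ⟨f₀, fun m ↦
    (p m * (h m * h m) * k m).contMDiff.contMDiffAt.congr_of_eventuallyEq (hf₀loc m)⟩
  have hf0 : ∀ m, f m ≠ 0 := fun m ↦
    mul_ne_zero (mul_ne_zero (hp0 m) (mul_ne_zero (hh0 m) (hh0 m)))
      (right_ne_zero_of_mul_eq_one (hk m).self_of_nhds)
  refine ⟨f, hf0, fun a m ↦ ?_⟩
  obtain ⟨b, hb⟩ := exists_section_eq (E := E') (F := F') (Φ.map m (a m))
  obtain ⟨γ, hγ⟩ := (hS.ratio (hs m)).2 (D a (s m))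
  obtain ⟨γ', hγ'⟩ := (hS'.ratio (hy m)).2 (D' b (y m))
  have e1 := hα.tensor_local hS hD (hs m) (hp m) hγ.self_of_nhds
  have e2 := hα'.tensor_local hS' hD' (hy m) (hq m) hγ'.self_of_nhds
  have e3 : (fun z ↦ f z * qφ m z) =ᶠ[𝓝 m] fun z ↦ p m z * (h m z * h m z) := by
    filter_upwards [hf₀loc m, hk m] with z h1 h2
    change f₀ z * qφ m z = _
    rw [h1]
    linear_combination (p m z * h m z ^ 2) * h2
  have e4 := dirDeriv_congr e3 (𝒜.anchor m (a m))
  rw [dirDeriv_mul f.contMDiff.contMDiffAt (qφ m).contMDiff.contMDiffAt,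
    dirDeriv_mul (g := fun z ↦ h m z * h m z) (p m).contMDiff.contMDiffAt ((h m).contMDiff.mul (h m).contMDiff).contMDiffAt,
    dirDeriv_mul (h m).contMDiff.contMDiffAt (h m).contMDiff.contMDiffAt] at e4
  have e5 : dirDeriv (qφ m) m (𝒜.anchor m (a m)) =
      dirDeriv (q m) (Φ.base m) (ℬ.anchor (Φ.base m) (b (Φ.base m))) := by
    rw [hb, hΦ.anchor_map]
    exact dirDeriv_comp (q m).contMDiff Φ.contMDiff_base _
  -- Equivariance on the local frame `s m`: the coefficients `γ` and `γ'` of the two connections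
  -- differ by the logarithmic derivative of `h`.
  have e6 : γ m * h m m = h m m * γ' (Φ.base m) + dirDeriv (h m) m (𝒜.anchor m (a m)) := by
    refine smul_cancel_right (hy m) ?_
    have h1 := hℓ.equivariant a (s m) (s' m) (fun _ ↦ rfl) m
    have h2 := hγ'.self_of_nhds
    rw [hDP.1.isConnection.apply_of_eq_smul a (hh m), hDP.2 a b (y m) m hb.symm, h2,
      hγ.self_of_nhds, map_smul, (hh' m).self_of_nhds, smul_smul, smul_smul] at h1
    rw [← h1, add_smul]
    rfl
  have e7 := e3.self_of_nhds
  have e8 : qφ m m = q m (Φ.base m) := rfl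
  simp only [hb] at e2
  rw [e5] at e4
  simp only [hb, e8] at e4 e7
  rw [eq_div_iff (hf0 m)]
  refine mul_right_cancel₀ (hq0 m) ?_
  -- Logarithmic differentiation of `f (q ∘ φ) = p h²`, after clearing denominators.
  linear_combination (h m m ^ 2) * e1 - f m * e2 - e4 + (2 * p m m * h m m) * e6 +
    (α.1.1 m (fun _ ↦ a m) - 2 * γ' (Φ.base m)) * e7

end Comparison

/-! ### Vanishing of the modular class -/

section Vanishing

variable {E : Type*} [NormedAddCommGroup E] [NormedSpace ℝ E] [FiniteDimensional ℝ E]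
  {M : Type*} [TopologicalSpace M] [ChartedSpace E M] [IsManifold 𝓘(ℝ, E) ∞ M] [T2Space M]
  [SecondCountableTopology M]
  {F : Type*} [NormedAddCommGroup F] [NormedSpace ℝ F] [FiniteDimensional ℝ F]
  {A : M → Type*} [TopologicalSpace (TotalSpace F A)] [∀ x, TopologicalSpace (A x)]
  [∀ x, AddCommGroup (A x)] [∀ x, Module ℝ (A x)] [FiberBundle F A] [VectorBundle ℝ F A]
  [ContMDiffVectorBundle ∞ F A 𝓘(ℝ, E)]
  {E' : Type*} [NormedAddCommGroup E'] [NormedSpace ℝ E'] [FiniteDimensional ℝ E']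
  {N : Type*} [TopologicalSpace N] [ChartedSpace E' N] [IsManifold 𝓘(ℝ, E') ∞ N] [T2Space N]
  [SecondCountableTopology N]
  {F' : Type*} [NormedAddCommGroup F'] [NormedSpace ℝ F'] [FiniteDimensional ℝ F']
  {B : N → Type*} [TopologicalSpace (TotalSpace F' B)] [∀ x, TopologicalSpace (B x)]
  [∀ x, AddCommGroup (B x)] [∀ x, Module ℝ (B x)] [FiberBundle F' B] [VectorBundle ℝ F' B]
  [ContMDiffVectorBundle ∞ F' B 𝓘(ℝ, E')]
  {𝒜 : LieAlgebroid E F A} {ℬ : LieAlgebroid E' F' B} {Φ : BundleMap E F A E' F' B}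

theorem morphismModularClass_eq_zero (hΦ : IsPullbackMorphism 𝒜 ℬ Φ)
    (hsub : ∀ m, Function.Surjective (mfderiv 𝓘(ℝ, E) 𝓘(ℝ, E') Φ.base m)) :
    morphismModularClass hΦ.1 = 0 := by
  have hA := isLine_canonicalLine E F A 𝒜
  have hB := isLine_canonicalLine E' F' B ℬ
  have hD := (canonicalRep_spec 𝒜).1
  have hD' := (canonicalRep_spec ℬ).1
  obtain ⟨t, α, ht, hα, h1⟩ := (isCharacteristicClass_modularClass 𝒜).exists_tensor hA hD
  obtain ⟨t', α', ht', hα', h2⟩ := (isCharacteristicClass_modularClass ℬ).exists_tensor hB hD'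
  obtain ⟨f, hf, hcomp⟩ := exists_comparison hΦ hA hB hD hD' (pullbackRep_spec hΦ hsub)
    (isModuleIso_canonicalIso hΦ hsub) ht hα ht' hα'
  have h3 : H1.mk α = H1.map hΦ.1 (H1.mk α') :=
    (Submodule.Quotient.eq _).2 (mem_coboundaries_of_log hf hcomp)
  -- Only doubled classes are represented by cocycles of the squares; the factor `2` is removed
  -- because `H¹(A)` is a real vector space.
  have h4 : (2 : ℝ) • morphismModularClass hΦ.1 = 0 := by
    rw [morphismModularClass, smul_sub, ← map_smul, h1, h2, h3, sub_self]
  exact (smul_eq_zero.1 h4).resolve_left two_ne_zero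

end Vanishing

end ModularClass

end

theorem proposition3p8
    {E : Type*} [NormedAddCommGroup E] [NormedSpace ℝ E] [FiniteDimensional ℝ E]
    {M : Type*} [TopologicalSpace M] [ChartedSpace E M] [IsManifold 𝓘(ℝ, E) ∞ M]
    [T2Space M] [SecondCountableTopology M]
    {F : Type*} [NormedAddCommGroup F] [NormedSpace ℝ F] [FiniteDimensional ℝ F]
    {A : M → Type*} [TopologicalSpace (TotalSpace F A)] [∀ x, TopologicalSpace (A x)]
    [∀ x, AddCommGroup (A x)] [∀ x, Module ℝ (A x)] [FiberBundle F A] [VectorBundle ℝ F A]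
    [ContMDiffVectorBundle ∞ F A 𝓘(ℝ, E)]
    {E' : Type*} [NormedAddCommGroup E'] [NormedSpace ℝ E'] [FiniteDimensional ℝ E']
    {N : Type*} [TopologicalSpace N] [ChartedSpace E' N] [IsManifold 𝓘(ℝ, E') ∞ N]
    [T2Space N] [SecondCountableTopology N]
    {F' : Type*} [NormedAddCommGroup F'] [NormedSpace ℝ F'] [FiniteDimensional ℝ F']
    {B : N → Type*} [TopologicalSpace (TotalSpace F' B)] [∀ x, TopologicalSpace (B x)]
    [∀ x, AddCommGroup (B x)] [∀ x, Module ℝ (B x)] [FiberBundle F' B] [VectorBundle ℝ F' B]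
    [ContMDiffVectorBundle ∞ F' B 𝓘(ℝ, E')]
    (𝒜 : LieAlgebroid E F A) (ℬ : LieAlgebroid E' F' B) (Φ : BundleMap E F A E' F' B)
    (hΦ : IsPullbackMorphism 𝒜 ℬ Φ)
    (hsub : ∀ m, Function.Surjective (mfderiv 𝓘(ℝ, E) 𝓘(ℝ, E') Φ.base m)) :
    IsModuleIso 𝒜 (canonicalLine E F A) ((canonicalLine E' F' B).pullback E Φ.base)
      (canonicalRep 𝒜)
      (pullbackRep 𝒜 Φ (canonicalLine E' F' B) (canonicalRep ℬ))
      (canonicalIso 𝒜 ℬ Φ) ∧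
    morphismModularClass hΦ.1 = 0 := by
  exact ⟨isModuleIso_canonicalIso hΦ hsub, morphismModularClass_eq_zero hΦ hsub⟩
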